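/- Let $G$ be a finite simple connected graph and $K$ a field. Let $I_G\subset K[e : e\in E(G)]$ be the toric ideal of $G$, generated by all binomials $x^{a}-x^{b}$ with $\deg(x^a)=\deg(x^b)$, where $\deg(e)=v+v'$ for $e=\{v,v'\}$, in the free abelian group on the vertices. A binomial is minimal if it belongs to some minimal (with respect to inclusion) system of binomial generators of $I_G$. Let $w=(e_1,\dots,e_{2q})$, $q\ge 1$, $e_i=\{v_i,v_{i+1}\}$, $v_{2q+1}=v_1$, be an even closed walk in $G$ (vertices and edges may repeat). Put $E^+(w)=e_1e_3\cdots e_{2q-1}$, $E^-(w)=e_2e_4\cdots e_{2q}$ and $B_w=E^+(w)-E^-(w)$. Let $\mathbf w$ be the subgraph of $G$ formed by the vertices and edges of $w$; its blocks are its maximal biconnected subgraphs (connected, without cut vertex). * $w$ is primitive if no edge occurs in both $E^+(w)$ and $E^-(w)$, and there is no even closed walk $\xi$ with $0<\operatorname{length}(\xi)<2q$, $E^+(\xi)\mid E^+(w)$ and $E^-(\xi)\mid E^-(w)$. * A sink of a block $B$ is a common vertex of two terms $e_i,e_j$ of $w$ that lie in $B$, with $i\ne j$ and $i\equiv j \pmod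 2$. The walk $w$ is strongly primitive if it is primitive and no cyclic block of $\mathbf w$ (a block that is a cycle) has two sinks that are adjacent in it. * A chord of $w$ is an edge of $G$ that joins two vertices of $\mathbf w$ and is not an edge of $\mathbf w$. A chord is a bridge if its two endpoints can be assigned to two different blocks $B_1\neq B_2$ of $\mathbf w$, the first endpoint lying in $B_1$ and the second in $B_2$ (they may also share a block). A chord $f$ is odd if it is not a bridge and $f=\{v_i,v_j\}$ with $1\le i<j\le 2q$ and $j-i$ even, so that $f$ breaks $w$ into two odd closed walks. * Two odd chords $f=\{v_s,v_j\}$, $f'=\{v_{s'},v_{j'}\}$ ($1\le s<j\le 2q$, $1\le s'<j'\le 2q$) cross effectively if $s'-s$ is odd and $s<s'<j<j'$ or $s'<s<j'<j$. * An $F_4$ of $w$ is a cycle $(e_a,f,e_b,f')$ of length four in $G$, where $a<b$, $a\equiv b\pmod 2$, and $f,f'$ are odd chords that cross effectively. Two odd chords cross strongly effectively if they cross effectively and do not form an $F_4$ with any two edges of $w$. * An odd chord $g$ crosses the $F_4$ $(e_a,f,e_b,f')$ if $g\ne f$, $g\neq f'$, and $g$ has one endpoint in $\{v_{a+1},\dots,v_b\}$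 and the other in $\{v_{b+1},\dots,v_{2q},v_1,\dots,v_a\}$. Theorem. $B_w$ is minimal if and only if all of the following hold: $w$ is strongly primitive; all chords of $w$ are odd; no two odd chords of $w$ cross strongly effectively; and no odd chord of $w$ crosses an $F_4$ of $w$. -/

import Mathlib

namespace ToricGraph

open MvPolynomial

noncomputable section

variable {V : Type*} {G : SimpleGraph V}

/-! ### The toric ideal of a graph -/

/-- The vector `a_e = v_i + v_j`, for `e = {v_i, v_j}`, in the free abelian group on the vertices. -/
def edgeVec (e : Sym2 V) : V →₀ ℤ :=
  Sym2.lift ⟨fun x y => Finsupp.single x 1 + Finsupp.single y 1, fun _ _ => add_comm _ _⟩ e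

/-- The `A_G`-degree of the monomial with exponent vector `a`. -/
def deg (a : G.edgeSet →₀ ℕ) : V →₀ ℤ :=
  a.sum fun e n => n • edgeVec (e : Sym2 V)

/-- The (pure difference) binomial `x^a - x^b`. -/
def binom (K : Type*) [Field K] (a b : G.edgeSet →₀ ℕ) : MvPolynomial G.edgeSet K :=
  monomial a 1 - monomial b 1

/-- The toric ideal `I_G`. -/
def toricIdeal (K : Type*) [Field K] (G : SimpleGraph V) : Ideal (MvPolynomial G.edgeSet K) :=
  Ideal.span {p | ∃ a b : G.edgeSet →₀ ℕ, deg a = deg b ∧ p = binom K a b}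

/-- `S` is a minimal system of binomial generators of `I_G`: it consists of binomials, it generates
`I_G`, and no proper subset of it generates `I_G`. -/
def IsMinimalBinomialGenerators (K : Type*) [Field K] (G : SimpleGraph V)
    (S : Set (MvPolynomial G.edgeSet K)) : Prop :=
  (∀ p ∈ S, ∃ a b : G.edgeSet →₀ ℕ, p = binom K a b) ∧
    Ideal.span S = toricIdeal K G ∧
    ∀ T : Set (MvPolynomial G.edgeSet K), T ⊂ S → Ideal.span T ≠ toricIdeal K G

/-- `B` is a minimal binomial of `I_G`. -/
def IsMinimalBinomial (K : Type*) [Field K] (G : SimpleGraph V)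
    (B : MvPolynomial G.edgeSet K) : Prop :=
  ∃ S : Set (MvPolynomial G.edgeSet K), IsMinimalBinomialGenerators K G S ∧ B ∈ S

/-! ### Closed walks and their binomials

The vertices of a walk `w` of length `2q` are `w.getVert 0, …, w.getVert (2q)`, and its edges are
`{w.getVert i, w.getVert (i + 1)}` for `i < 2q`. Positions are counted from `0`, so the odd edges
(first, third, …) of the walk stand in the positions `0, 2, …`. -/

/-- The edge in position `i` of a walk. -/
def edgeAt {u v : V} (w : G.Walk u v) (i : Fin w.length) : G.edgeSet :=
  ⟨s(w.getVert i, w.getVert (i + 1)), w.adj_getVert_succ i.isLt⟩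

/-- The exponent vector of `E⁺(w)`, the product of the first, third, fifth, … edges. -/
def posExp {u v : V} (w : G.Walk u v) : G.edgeSet →₀ ℕ :=
  ∑ i : Fin w.length with Even i.val, Finsupp.single (edgeAt w i) 1

/-- The exponent vector of `E⁻(w)`, the product of the second, fourth, sixth, … edges. -/
def negExp {u v : V} (w : G.Walk u v) : G.edgeSet →₀ ℕ :=
  ∑ i : Fin w.length with Odd i.val, Finsupp.single (edgeAt w i) 1

/-- The binomial `B_w = E⁺(w) - E⁻(w)`. -/
def walkBinomial (K : Type*) [Field K] {u : V} (w : G.Walk u u) : MvPolynomial G.edgeSet K :=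
  binom K (posExp w) (negExp w)

/-- An even closed walk `w` is primitive: the odd and the even edges of `w` form two disjoint
classes, and there is no even closed walk `ξ` (with at least one edge) of smaller length with
`E⁺(ξ) ∣ E⁺(w)` and `E⁻(ξ) ∣ E⁻(w)`. The first clause only excludes that `w` is one edge traversed
back and forth, for which `B_w = 0`. -/
def IsPrimitive {u : V} (w : G.Walk u u) : Prop :=
  Disjoint (posExp w).support (negExp w).support ∧
    ¬ ∃ (x : V) (ξ : G.Walk x x), 0 < ξ.length ∧ Even ξ.length ∧ ξ.length < w.length ∧
      posExp ξ ≤ posExp w ∧ negExp ξ ≤ negExp w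

/-! ### Blocks, sinks, strong primitivity -/

/-- A subgraph is biconnected if it is connected and has no cut vertex, i.e. no vertex whose removal
disconnects what remains. -/
def Biconnected (B : G.Subgraph) : Prop :=
  B.Connected ∧ ∀ x ∈ B.verts, (B.deleteVerts {x}).Preconnected

/-- `B` is a block of the graph of the walk `w`: a maximal biconnected subgraph of it. -/
def IsBlock {u v : V} (w : G.Walk u v) (B : G.Subgraph) : Prop :=
  Maximal (fun C : G.Subgraph => C ≤ w.toSubgraph ∧ Biconnected C) B

/-- The subgraph `B` is a cycle. -/
def IsCyclic (B : G.Subgraph) : Prop :=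
  ∃ (x : V) (c : G.Walk x x), c.IsCycle ∧ c.toSubgraph = B

/-- `x` is a sink of `B` for the walk `w`: a common vertex of two odd, or of two even, edges of the
walk which belong to `B`. Two occurrences of a multiple edge of the walk count as two edges. -/
def IsSink {u v : V} (w : G.Walk u v) (B : G.Subgraph) (x : V) : Prop :=
  ∃ i j : Fin w.length, i ≠ j ∧ (Even i.val ↔ Even j.val) ∧
    (edgeAt w i : Sym2 V) ∈ B.edgeSet ∧ (edgeAt w j : Sym2 V) ∈ B.edgeSet ∧
    x ∈ (edgeAt w i : Sym2 V) ∧ x ∈ (edgeAt w j : Sym2 V)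

/-- A primitive walk without two sinks of the same cyclic block at distance one in it. -/
def IsStronglyPrimitive {u : V} (w : G.Walk u u) : Prop :=
  IsPrimitive w ∧
    ¬ ∃ (B : G.Subgraph) (x y : V), IsBlock w B ∧ IsCyclic B ∧ B.Adj x y ∧
      IsSink w B x ∧ IsSink w B y

/-! ### Chords -/

/-- A chord of `w`: an edge of `G` between vertices of `w` which is not an edge of `w`. -/
def IsChord {u v : V} (w : G.Walk u v) (f : Sym2 V) : Prop :=
  f ∈ G.edgeSet ∧ (∀ x ∈ f, x ∈ w.support) ∧ f ∉ w.edges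

/-- A chord `{x, y}` is a bridge if `x` and `y` lie in two different blocks of the graph of `w`.
(They may at the same time lie in a common block.) -/
def IsBridgeChord {u v : V} (w : G.Walk u v) (f : Sym2 V) : Prop :=
  IsChord w f ∧ ∃ (x y : V) (B C : G.Subgraph), f = s(x, y) ∧
    IsBlock w B ∧ IsBlock w C ∧ B ≠ C ∧ x ∈ B.verts ∧ y ∈ C.verts

/-- The edge `f` joins the vertices of the closed walk `w` in the positions `i < j`. -/
def JoinsAt {u : V} (w : G.Walk u u) (f : Sym2 V) (i j : ℕ) : Prop :=
  i < j ∧ j < w.length ∧ f = s(w.getVert i, w.getVert j)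

/-- An odd chord: a chord which is not a bridge, and which breaks `w` into two odd walks, one
made of `f` and the `j - i` edges of `w` from position `i` to position `j`, the other of `f` and the
remaining edges of `w`. -/
def IsOddChord {u : V} (w : G.Walk u u) (f : Sym2 V) : Prop :=
  IsChord w f ∧ ¬ IsBridgeChord w f ∧
    ∃ i j : ℕ, JoinsAt w f i j ∧ Odd (j - i + 1) ∧ Odd (w.length - (j - i) + 1)

/-- The odd chords `f` and `f'` cross effectively in `w`. -/
def CrossEffectively {u : V} (w : G.Walk u u) (f f' : Sym2 V) : Prop :=
  IsOddChord w f ∧ IsOddChord w f' ∧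
    ∃ s j s' j' : ℕ, JoinsAt w f s j ∧ JoinsAt w f' s' j' ∧ Odd (s + s') ∧
      ((s < s' ∧ s' < j ∧ j < j') ∨ (s' < s ∧ s < j' ∧ j' < j))

/-- `(e, f, e', f')` is an `F₄` of `w`, where `e` and `e'` are the edges of `w` in the positions
`a < b`: a cycle of length four with vertices `x, y, z, t`, where `e, e'` are both odd or both even
edges of `w`, and `f, f'` are odd chords which cross effectively. -/
def IsF4 {u : V} (w : G.Walk u u) (a b : Fin w.length) (f f' : Sym2 V) : Prop :=
  a < b ∧ (Even a.val ↔ Even b.val) ∧ CrossEffectively w f f' ∧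
    ∃ x y z t : V, [x, y, z, t].Nodup ∧
      (edgeAt w a : Sym2 V) = s(x, y) ∧ f = s(y, z) ∧
      (edgeAt w b : Sym2 V) = s(z, t) ∧ f' = s(t, x)

/-- `f` and `f'` cross strongly effectively: effectively, and without forming an `F₄`. -/
def CrossStronglyEffectively {u : V} (w : G.Walk u u) (f f' : Sym2 V) : Prop :=
  CrossEffectively w f f' ∧ ¬ ∃ a b : Fin w.length, IsF4 w a b f f'

/-- The odd chord `g` crosses the `F₄` `(e, f, e', f')`, where `e, e'` stand in the positions `a < b`
of `w`. Up to rotation `w = (w₁, e, w₂, e')`; the vertices of `w₂` are those in the positions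
`a + 1, …, b`, and the vertices of `w₁` are those in the positions `b + 1, …, w.length` and
`0, …, a`. -/
def CrossesF4 {u : V} (w : G.Walk u u) (g : Sym2 V) (a b : Fin w.length) (f f' : Sym2 V) : Prop :=
  IsOddChord w g ∧ IsF4 w a b f f' ∧ g ≠ f ∧ g ≠ f' ∧
    ∃ i j : ℕ, (i ≤ a.val ∨ b.val + 1 ≤ i ∧ i ≤ w.length) ∧ (a.val + 1 ≤ j ∧ j ≤ b.val) ∧
      g = s(w.getVert i, w.getVert j)

end

end ToricGraph

/-! Call the monomials of a given `deg` a fiber, and join two of them when they share a variable.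
Multiplying a binomial of `I_G` by a polynomial without constant term gives a combination of
binomials whose two terms are joined. By a graded Nakayama argument, a set of binomials of `I_G`
therefore generates `I_G` exactly when, modulo the span of such linked binomials, it spans all of
`I_G`. Hence a binomial of `I_G` is minimal iff its two terms lie in different components of their
fiber (`isMinimalBinomial_iff`), and the question is whether `E⁺(w)` and `E⁻(w)` are connected.

In a primitive walk two visits of a vertex are at odd distance, so no vertex is visited three times,
and the visits of two vertices do not interlace (`IsPrimitive.isPrim`). The graph of the walk is
therefore a tree of cycles and cut edges, and statements on blocks, sinks and bridges become
statements on positions along the walk (`exists_cyclic_block`, `separates`, `isBlock_eq`).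

Necessity. On an arc of the walk, replace the edges of one parity by those of the other; by
telescoping (`deg_seg`) the degree changes only at the two ends of the arc. Each forbidden
configuration supplies chords, repeated vertices or edges that repair these ends, and so gives a
monomial of the fiber with edges of both parities, which joins `E⁺(w)` to `E⁻(w)` (`false_of_one`).
A chord crossing an `F₄` needs two intermediate monomials (`false_of_two`).

Sufficiency. Give a walk edge the parity of its position, and a chord of an `F₄` the parity of the
two walk edges of that `F₄`. Every monomial of the fiber has edges of one type only
(`forall_hasType`). Without chords this holds because its edges alternate along the walk. With
chords, a shortest one is crossed effectively by another one (`exists_crossing`); the two form an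
`F₄`, and exchanging them for its walk edges leaves fewer chords. The type of an edge is unambiguous
because no chord crosses an `F₄` (`HasType.even_sub`, for length above four). So linked monomials
have the same type, while `E⁺(w)` and `E⁻(w)` have different ones. Length at most four is settled by
degree. -/

namespace ToricGraph

open MvPolynomial

/-! ### The degree of a monomial -/

section Degree

variable {V : Type*} {G : SimpleGraph V}

@[simp] lemma edgeVec_mk (x y : V) :
    edgeVec s(x, y) = Finsupp.single x 1 + Finsupp.single y 1 := rfl

@[simp] lemma deg_zero : deg (0 : G.edgeSet →₀ ℕ) = 0 := by simp [deg]

lemma deg_add (a b : G.edgeSet →₀ ℕ) : deg (a + b) = deg a + deg b := by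
  unfold deg
  exact Finsupp.sum_add_index' (by simp) (by intros; rw [add_smul])

@[simp] lemma deg_single (e : G.edgeSet) (n : ℕ) :
    deg (Finsupp.single e n) = n • edgeVec (e : Sym2 V) := by
  simp [deg]

/-- The value of a weight of the vertices on the degree of a monomial. -/
lemma linearCombination_deg (χ : V → ℤ) (a : G.edgeSet →₀ ℕ) :
    Finsupp.linearCombination ℤ χ (deg a) =
      a.sum fun e n => n * Finsupp.linearCombination ℤ χ (edgeVec (e : Sym2 V)) := by
  simp [deg, Finsupp.sum, map_sum]

lemma linearCombination_edgeVec (χ : V → ℤ) (x y : V) :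
    Finsupp.linearCombination ℤ χ (edgeVec s(x, y)) = χ x + χ y := by
  simp

/-- The weight 1 on all vertices counts every edge twice; this makes `I_G` homogeneous for the total
degree. -/
lemma linearCombination_one_deg (a : G.edgeSet →₀ ℕ) :
    Finsupp.linearCombination ℤ (fun _ : V => (1 : ℤ)) (deg a) = 2 * a.degree := by
  rw [linearCombination_deg, Finsupp.sum, Finsupp.degree_apply, Nat.cast_sum, Finset.mul_sum]
  refine Finset.sum_congr rfl fun e _ => ?_
  obtain ⟨e, he⟩ := e
  induction e with
  | h x y => rw [linearCombination_edgeVec]; ring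

lemma degree_eq_of_deg_eq {a b : G.edgeSet →₀ ℕ} (h : deg a = deg b) :
    a.degree = b.degree := by
  have := linearCombination_one_deg a
  rw [h, linearCombination_one_deg b] at this
  omega

lemma edgeVec_injective {e f : Sym2 V} (h : edgeVec e = edgeVec f) : e = f := by
  classical
  induction e with
  | h u v =>
  induction f with
  | h x y =>
    have hu := DFunLike.congr_fun h u
    have key : u = x ∨ u = y := by
      by_contra! hne
      simp only [edgeVec_mk, Finsupp.add_apply, Finsupp.single_apply, if_neg hne.1.symm,
        if_neg hne.2.symm, if_true] at hu
      split_ifs at hu <;> omega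
    rcases key with rfl | rfl
    · have h1 : Finsupp.single v (1 : ℤ) = Finsupp.single y 1 := add_left_cancel h
      rw [Finsupp.single_left_injective one_ne_zero h1]
    · have h1 : Finsupp.single v (1 : ℤ) = Finsupp.single x 1 := by
        rw [edgeVec_mk, edgeVec_mk, add_comm (Finsupp.single x (1 : ℤ))] at h
        exact add_left_cancel h
      rw [Finsupp.single_left_injective one_ne_zero h1, Sym2.eq_swap]

end Degree

/-! ### The graph on a fiber -/

section Linked

variable {V : Type*} {G : SimpleGraph V}

/-- Two monomials of the same degree with a common variable. -/
def Linked (a b : G.edgeSet →₀ ℕ) : Prop :=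
  deg a = deg b ∧ ∃ e, 0 < a e ∧ 0 < b e

/-- Two monomials of the same degree joined by a chain of monomials, each of which has a common
variable with the next one. -/
def Conn : (G.edgeSet →₀ ℕ) → (G.edgeSet →₀ ℕ) → Prop := Relation.ReflTransGen Linked

lemma Linked.symm {a b : G.edgeSet →₀ ℕ} (h : Linked a b) : Linked b a :=
  ⟨h.1.symm, h.2.imp fun _ he => ⟨he.2, he.1⟩⟩

lemma Conn.symm {a b : G.edgeSet →₀ ℕ} (h : Conn a b) : Conn b a :=
  have : Std.Symm (Linked (G := G)) := ⟨fun _ _ h => h.symm⟩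
  (Relation.ReflTransGen.stdSymm (r := Linked (G := G))).symm _ _ h

/-- Cancelling the common variable lowers the degree; the Nakayama induction rests on this. -/
lemma Linked.exists_single {a b : G.edgeSet →₀ ℕ} (h : Linked a b) :
    ∃ e a' b', a = Finsupp.single e 1 + a' ∧ b = Finsupp.single e 1 + b' ∧ deg a' = deg b' := by
  obtain ⟨h, e, ha, hb⟩ := h
  have ha' : Finsupp.single e 1 ≤ a := by simpa [Nat.one_le_iff_ne_zero, Nat.pos_iff_ne_zero] using ha
  have hb' : Finsupp.single e 1 ≤ b := by simpa [Nat.one_le_iff_ne_zero, Nat.pos_iff_ne_zero] using hb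
  refine ⟨e, a - Finsupp.single e 1, b - Finsupp.single e 1, ?_, ?_, ?_⟩
  · rw [add_tsub_cancel_of_le ha']
  · rw [add_tsub_cancel_of_le hb']
  · rw [← add_tsub_cancel_of_le ha', ← add_tsub_cancel_of_le hb', deg_add, deg_add] at h
    exact add_left_cancel h

end Linked

/-! ### Minimal binomials and components of a fiber -/

section Algebra

variable {V : Type*} {G : SimpleGraph V} {K : Type*} [Field K]

lemma binom_mem {a b : G.edgeSet →₀ ℕ} (h : deg a = deg b) : binom K a b ∈ toricIdeal K G :=
  Ideal.subset_span ⟨a, b, h, rfl⟩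

lemma monomial_mul_binom (c a b : G.edgeSet →₀ ℕ) (r : K) :
    monomial c r * binom K a b = r • binom K (c + a) (c + b) := by
  simp [binom, mul_sub, monomial_mul, smul_sub, smul_monomial]

/-- The homomorphism to the group algebra of the free abelian group on the vertices, which sends
each variable to the group element of its edge, kills `I_G` and sends a monomial to its degree. -/
lemma deg_eq_of_binom_mem {a b : G.edgeSet →₀ ℕ} (h : binom K a b ∈ toricIdeal K G) :
    deg a = deg b := by
  let φ : MvPolynomial G.edgeSet K →ₐ[K] AddMonoidAlgebra K (V →₀ ℤ) :=
    aeval fun e => AddMonoidAlgebra.single (edgeVec (e : Sym2 V)) 1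
  have hφ (a : G.edgeSet →₀ ℕ) : φ (monomial a 1) = AddMonoidAlgebra.single (deg a) 1 := by
    induction a using Finsupp.induction_linear with
    | zero => rw [deg_zero]; exact map_one φ
    | add a b ha hb =>
      rw [deg_add, ← mul_one (1 : K), ← monomial_mul, map_mul, ha, hb,
        AddMonoidAlgebra.single_mul_single]
    | single e n =>
      rw [deg_single]
      simp [φ, aeval_monomial, AddMonoidAlgebra.single_pow]
  have hker : toricIdeal K G ≤ RingHom.ker φ.toRingHom := by
    refine Ideal.span_le.2 ?_
    rintro _ ⟨a, b, hab, rfl⟩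
    change φ (binom K a b) = 0
    rw [binom, map_sub, hφ, hφ, hab, sub_self]
  have h0 : φ (binom K a b) = 0 := hker h
  rw [binom, map_sub, hφ, hφ, sub_eq_zero] at h0
  by_contra hne
  have := (AddMonoidAlgebra.single_left_injective (one_ne_zero (α := K))) h0
  exact hne this

lemma homogeneousComponent_binom {a b : G.edgeSet →₀ ℕ} (h : deg a = deg b) (k : ℕ) :
    homogeneousComponent k (binom K a b) = if a.degree = k then binom K a b else 0 := by
  rw [binom, map_sub, homogeneousComponent_of_mem (isHomogeneous_monomial _ rfl),
    homogeneousComponent_of_mem (isHomogeneous_monomial _ rfl), ← degree_eq_of_deg_eq h]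
  split_ifs <;> simp_all

/-- The binomials whose two monomials are linked span the multiples of binomials of `I_G`
by monomials of positive degree. -/
noncomputable def linkedSpan (K : Type*) [Field K] (G : SimpleGraph V) :
    Submodule K (MvPolynomial G.edgeSet K) :=
  Submodule.span K {p | ∃ a b : G.edgeSet →₀ ℕ, Linked a b ∧ p = binom K a b}

lemma Conn.binom_mem_linkedSpan {a b : G.edgeSet →₀ ℕ} (h : Conn a b) :
    binom K a b ∈ linkedSpan K G := by
  induction h with
  | refl => simp [binom]
  | tail _ h ih =>
    rename_i b c _
    have : binom K a c = binom K a b + binom K b c := by simp [binom]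
    rw [this]
    exact add_mem ih (Submodule.subset_span ⟨_, _, h, rfl⟩)

/-- Summing the coefficients over the component of `a` is a linear functional that vanishes on
linked binomials but not on `binom K a b` when `b` is in another component. -/
lemma conn_of_binom_mem_linkedSpan {a b : G.edgeSet →₀ ℕ}
    (h : binom K a b ∈ linkedSpan K G) : Conn a b := by
  classical
  by_contra hab
  let φ : MvPolynomial G.edgeSet K →ₗ[K] K :=
    Finsupp.linearCombination K (fun c : G.edgeSet →₀ ℕ => if Conn a c then (1 : K) else 0) ∘ₗ
      (AddMonoidAlgebra.coeffLinearEquiv K).toLinearMap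
  have hφ (c : G.edgeSet →₀ ℕ) : φ (monomial c 1) = if Conn a c then (1 : K) else 0 := by
    have : (AddMonoidAlgebra.coeffLinearEquiv K) (monomial c (1 : K)) = Finsupp.single c 1 := rfl
    simp [φ, this]
  have hker : linkedSpan K G ≤ LinearMap.ker φ := by
    refine Submodule.span_le.2 ?_
    rintro _ ⟨c, d, hcd, rfl⟩
    have : Conn a c ↔ Conn a d := ⟨fun h => h.tail hcd, fun h => h.tail hcd.symm⟩
    simp [binom, hφ, this]
  have h0 : φ (binom K a b) = 0 := hker h
  rw [binom, map_sub, hφ, hφ, if_pos (show Conn a a from Relation.ReflTransGen.refl), if_neg hab] at h0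
  simp at h0

/-- A monomial other than 1 contributes a common variable to both terms, so only the constant term
of `q` survives modulo `linkedSpan`. -/
lemma mul_binom_sub_mem (q : MvPolynomial G.edgeSet K) {a b : G.edgeSet →₀ ℕ}
    (h : deg a = deg b) :
    q * binom K a b - coeff 0 q • binom K a b ∈ linkedSpan K G := by
  classical
  induction q using MvPolynomial.induction_on' with
  | monomial c r =>
    rw [monomial_mul_binom, coeff_monomial]
    by_cases hc : c = 0
    · simp [hc]
    · rw [if_neg hc, zero_smul, sub_zero]
      refine Submodule.smul_mem _ _ (Submodule.subset_span ⟨_, _, ⟨?_, ?_⟩, rfl⟩)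
      · rw [deg_add, deg_add, h]
      · obtain ⟨e, he⟩ := Finsupp.ne_iff.1 hc
        refine ⟨e, ?_⟩
        simp at he ⊢
        omega
  | add p q hp hq =>
    have : (p + q) * binom K a b - coeff 0 (p + q) • binom K a b =
        (p * binom K a b - coeff 0 p • binom K a b) +
        (q * binom K a b - coeff 0 q • binom K a b) := by
      rw [coeff_add, add_mul, add_smul]; abel
    rw [this]
    exact add_mem hp hq

lemma ideal_span_le_span_sup (S : Set (MvPolynomial G.edgeSet K))
    (hS : ∀ p ∈ S, ∃ a b : G.edgeSet →₀ ℕ, deg a = deg b ∧ p = binom K a b)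
    {x : MvPolynomial G.edgeSet K} (hx : x ∈ Ideal.span S) :
    x ∈ Submodule.span K S ⊔ linkedSpan K G := by
  induction hx using Submodule.span_induction with
  | zero => exact zero_mem _
  | mem x hx => exact Submodule.mem_sup_left (Submodule.subset_span hx)
  | add x y _ _ hx hy => exact add_mem hx hy
  | smul q x hx' hx =>
    clear hx
    induction hx' using Submodule.span_induction generalizing q with
    | zero => simp
    | mem x hx =>
      obtain ⟨a, b, hab, rfl⟩ := hS x hx
      have := mul_binom_sub_mem (K := K) q hab
      rw [smul_eq_mul, ← sub_add_cancel (q * binom K a b) (coeff 0 q • binom K a b)]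
      exact add_mem (Submodule.mem_sup_right this)
        (Submodule.mem_sup_left (Submodule.smul_mem _ _ (Submodule.subset_span hx)))
    | add x y _ _ hx hy => rw [smul_add]; exact add_mem (hx q) (hy q)
    | smul r x _ hx => rw [smul_smul]; exact hx _

/-- A graded Nakayama lemma: binomials which span `I_G` modulo the linked binomials generate. -/
lemma ideal_span_eq_toricIdeal (T : Set (MvPolynomial G.edgeSet K))
    (hT : ∀ p ∈ T, ∃ a b : G.edgeSet →₀ ℕ, deg a = deg b ∧ p = binom K a b)
    (h : ∀ a b : G.edgeSet →₀ ℕ, deg a = deg b →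
      binom K a b ∈ Submodule.span K T ⊔ linkedSpan K G) :
    Ideal.span T = toricIdeal K G := by
  apply le_antisymm
  · refine Ideal.span_le.2 fun p hp => ?_
    obtain ⟨a, b, hab, rfl⟩ := hT p hp
    exact binom_mem hab
  refine Ideal.span_le.2 ?_
  rintro _ ⟨a, b, hab, rfl⟩
  have main : ∀ (k : ℕ) (a b : G.edgeSet →₀ ℕ), a.degree = k → deg a = deg b →
      binom K a b ∈ Ideal.span T := by
    intro k
    induction k using Nat.strong_induction_on with
    | _ k ih =>
    intro a b hk hab
    obtain ⟨t, ht, j, hj, htj⟩ := Submodule.mem_sup.1 (h a b hab)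
    -- Only the part in degree `k` matters, so that the linked binomials that occur have degree `k`
    -- and their quotients by a variable have degree `k - 1`.
    have e : binom K a b = homogeneousComponent k t + homogeneousComponent k j := by
      rw [← map_add, htj, homogeneousComponent_binom hab, if_pos hk]
    rw [e]
    refine add_mem ?_ ?_
    · clear htj e
      induction ht using Submodule.span_induction with
      | zero => simp
      | mem x hx =>
        obtain ⟨c, d, hcd, rfl⟩ := hT x hx
        rw [homogeneousComponent_binom hcd]
        split_ifs
        · exact Ideal.subset_span hx
        · exact zero_mem _
      | add x y _ _ hx hy => rw [map_add]; exact add_mem hx hy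
      | smul r x _ hx => rw [map_smul]; exact Submodule.smul_of_tower_mem _ r hx
    · clear htj e
      induction hj using Submodule.span_induction with
      | zero => simp
      | mem x hx =>
        obtain ⟨c, d, hcd, rfl⟩ := hx
        rw [homogeneousComponent_binom hcd.1]
        split_ifs with hc
        · obtain ⟨e, c', d', rfl, rfl, hcd'⟩ := hcd.exists_single
          have : binom K (Finsupp.single e 1 + c') (Finsupp.single e 1 + d') =
              monomial (Finsupp.single e 1) 1 * binom K c' d' := by
            rw [monomial_mul_binom, one_smul]
          rw [this]
          refine Ideal.mul_mem_left _ _ (ih c'.degree ?_ c' d' rfl hcd')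
          rw [map_add, Finsupp.degree_single] at hc
          omega
        · exact zero_mem _
      | add x y _ _ hx hy => rw [map_add]; exact add_mem hx hy
      | smul r x _ hx => rw [map_smul]; exact Submodule.smul_of_tower_mem _ r hx
  exact main _ a b rfl hab

/-- A binomial of `I_G` is minimal if and only if its two monomials are not connected. -/
theorem isMinimalBinomial_iff {a b : G.edgeSet →₀ ℕ} (hab : deg a = deg b) :
    IsMinimalBinomial K G (binom K a b) ↔ ¬ Conn a b := by
  constructor
  · rintro ⟨S, ⟨hS, hspan, hmin⟩, hB⟩ hconn
    have hS' : ∀ p ∈ S, ∃ a b : G.edgeSet →₀ ℕ, deg a = deg b ∧ p = binom K a b := by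
      intro p hp
      obtain ⟨c, d, rfl⟩ := hS p hp
      exact ⟨c, d, deg_eq_of_binom_mem (K := K) (hspan ▸ Ideal.subset_span hp), rfl⟩
    -- If the terms are connected, `binom K a b` is zero modulo `linkedSpan` and can be dropped from
    -- `S`.
    refine hmin (S \ {binom K a b}) ⟨Set.sdiff_subset, fun h => (h hB).2 rfl⟩ ?_
    refine ideal_span_eq_toricIdeal _ (fun p hp => hS' p hp.1) fun c d hcd => ?_
    have h1 := ideal_span_le_span_sup S hS' (x := binom K c d) (hspan ▸ binom_mem hcd)
    refine (sup_le (Submodule.span_le.2 fun p hp => ?_) le_sup_right :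
      Submodule.span K S ⊔ linkedSpan K G ≤ _) h1
    by_cases hpB : p = binom K a b
    · rw [hpB]; exact Submodule.mem_sup_right hconn.binom_mem_linkedSpan
    · exact Submodule.mem_sup_left (Submodule.subset_span ⟨hp, hpB⟩)
  · intro hconn
    have hB : binom K a b ∉ linkedSpan K G := fun h => hconn (conn_of_binom_mem_linkedSpan h)
    let t : Set (MvPolynomial G.edgeSet K) :=
      {p | ∃ a b : G.edgeSet →₀ ℕ, deg a = deg b ∧ p = binom K a b}
    -- A nonzero vector of the quotient by `linkedSpan` extends to a basis, consisting of classes of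
    -- binomials, of the image of `I_G`. Spanning gives generation and independence gives
    -- minimality.
    obtain ⟨S, hSt, hBS, hspan, hind⟩ := exists_linearIndepOn_extension (K := K)
      (v := (linkedSpan K G).mkQ) (s := {binom K a b}) (t := t)
      (LinearIndepOn.singleton (by simpa using hB)) (by rintro _ rfl; exact ⟨a, b, hab, rfl⟩)
    refine ⟨S, ⟨fun p hp => ?_, ?_, ?_⟩, hBS rfl⟩
    · obtain ⟨c, d, -, h⟩ := hSt hp
      exact ⟨c, d, h⟩
    · refine ideal_span_eq_toricIdeal S hSt fun c d hcd => ?_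
      have h1 := hspan ⟨_, ⟨c, d, hcd, rfl⟩, rfl⟩
      rw [← Submodule.map_span] at h1
      have h2 : binom K c d ∈
          Submodule.comap (linkedSpan K G).mkQ (Submodule.map (linkedSpan K G).mkQ
            (Submodule.span K S)) := h1
      rw [Submodule.comap_map_mkQ, sup_comm] at h2
      exact h2
    · intro T hTS hT
      obtain ⟨p, hpS, hpT⟩ := Set.exists_of_ssubset hTS
      obtain ⟨c, d, hcd, rfl⟩ := hSt hpS
      have h1 := ideal_span_le_span_sup T (fun p hp => hSt (hTS.1 hp)) (x := binom K c d)
        (hT ▸ binom_mem hcd)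
      rw [sup_comm, ← Submodule.comap_map_mkQ, Submodule.mem_comap, Submodule.map_span] at h1
      refine hind.notMem_span hpS (Submodule.span_mono (Set.image_mono fun q hq => ?_) h1)
      exact ⟨hTS.1 hq, fun h => hpT (h ▸ hq)⟩

end Algebra

end ToricGraph

namespace ToricGraph

/-! ### Closed walks as periodic sequences -/

section CyclicWalk

variable {V : Type*} {G : SimpleGraph V}

/-- A closed walk of length `n` seen as a periodic sequence of vertices. -/
structure CyclicWalk (G : SimpleGraph V) (n : ℕ) where
  vert : ℤ → V
  adj : ∀ i, G.Adj (vert i) (vert (i + 1))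
  per : ∀ i, vert (i + n) = vert i

namespace CyclicWalk

variable {n : ℕ} (c : CyclicWalk G n)

/-- The edge in position `i`. -/
def edge (i : ℤ) : G.edgeSet := ⟨s(c.vert i, c.vert (i + 1)), c.adj i⟩

lemma edge_coe (i : ℤ) : (c.edge i : Sym2 V) = s(c.vert i, c.vert (i + 1)) := rfl

lemma vert_add_mul (i k : ℤ) : c.vert (i + n * k) = c.vert i := by
  induction k with
  | zero => simp
  | succ k ih => rw [← ih, mul_add, mul_one, ← add_assoc, c.per]
  | pred k ih => rw [← ih, ← c.per (i + n * (-k - 1))]; congr 1; ring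

lemma vert_congr {i j : ℤ} (h : (n : ℤ) ∣ i - j) : c.vert i = c.vert j := by
  obtain ⟨k, hk⟩ := h
  rw [← c.vert_add_mul j k, ← hk]
  congr 1; ring

lemma edge_congr {i j : ℤ} (h : (n : ℤ) ∣ i - j) : c.edge i = c.edge j := by
  have h1 : c.vert (i + 1) = c.vert (j + 1) := c.vert_congr (by simpa using h)
  simp [edge, c.vert_congr h, h1]

lemma edge_add (i : ℤ) : c.edge (i + n) = c.edge i := c.edge_congr (by simp)

lemma vert_ne (i : ℤ) : c.vert i ≠ c.vert (i + 1) := (c.adj i).ne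

/-- Every position has a representative in a given period. -/
lemma exists_rep (hn : 0 < n) (a i : ℤ) : ∃ j, a ≤ j ∧ j < a + n ∧ (n : ℤ) ∣ i - j := by
  have hn' : (0 : ℤ) < n := by exact_mod_cast hn
  refine ⟨a + (i - a) % n, ?_, ?_, (i - a) / n, ?_⟩
  · have := Int.emod_nonneg (i - a) hn'.ne'
    omega
  · have := Int.emod_lt_of_pos (i - a) hn'
    omega
  · have := Int.emod_add_mul_ediv (i - a) n
    linarith

/-- The edges in the positions `k ≡ ε` with `i ≤ k < j`. -/
noncomputable def seg (ε i j : ℤ) : G.edgeSet →₀ ℕ :=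
  ∑ k ∈ Finset.Ico i j with Even (k + ε), Finsupp.single (c.edge k) 1

lemma seg_congr {ε ε' : ℤ} (h : Even (ε + ε')) (i j : ℤ) : c.seg ε i j = c.seg ε' i j := by
  unfold seg
  congr 1
  ext k
  simp only [Finset.mem_filter, and_congr_right_iff]
  intro _
  grind

lemma seg_add (ε : ℤ) {i j k : ℤ} (hij : i ≤ j) (hjk : j ≤ k) :
    c.seg ε i k = c.seg ε i j + c.seg ε j k := by
  unfold seg
  rw [← Finset.Ico_union_Ico_eq_Ico hij hjk, Finset.filter_union, Finset.sum_union]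
  exact Finset.disjoint_filter_filter (Finset.Ico_disjoint_Ico_consecutive i j k)

@[simp] lemma seg_self (ε i : ℤ) : c.seg ε i i = 0 := by simp [seg]

lemma seg_succ_of_even {ε i : ℤ} (h : Even (i + ε)) :
    c.seg ε i (i + 1) = Finsupp.single (c.edge i) 1 := by
  have : Finset.Ico i (i + 1) = {i} := by ext; simp; omega
  simp [seg, this, Finset.filter_singleton, h]

lemma seg_succ_of_odd {ε i : ℤ} (h : Odd (i + ε)) : c.seg ε i (i + 1) = 0 := by
  have : Finset.Ico i (i + 1) = {i} := by ext; simp; omega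
  rw [seg, this, Finset.filter_singleton, if_neg (Int.not_even_iff_odd.2 h), Finset.sum_empty]

lemma seg_pos {ε i j : ℤ} (k : ℤ) (hi : i ≤ k) (hj : k < j) (h : Even (k + ε)) :
    0 < c.seg ε i j (c.edge k) := by
  rw [seg_add c ε hi hj.le, seg_add c ε (show k ≤ k + 1 by omega) (show k + 1 ≤ j by omega),
    seg_succ_of_even c h]
  simp

lemma exists_of_seg_pos {ε i j : ℤ} {e : G.edgeSet} (h : 0 < c.seg ε i j e) :
    ∃ k, i ≤ k ∧ k < j ∧ Even (k + ε) ∧ c.edge k = e := by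
  by_contra! hne
  have : c.seg ε i j e = 0 := by
    rw [seg, Finsupp.finsetSum_apply]
    refine Finset.sum_eq_zero fun k hk => ?_
    simp only [Finset.mem_filter, Finset.mem_Ico] at hk
    exact Finsupp.single_eq_of_ne (hne k hk.1.1 hk.1.2 hk.2).symm
  omega

lemma seg_shift (hn : Even n) (ε i j : ℤ) : c.seg ε (i + n) (j + n) = c.seg ε i j := by
  unfold seg
  symm
  refine Finset.sum_bij (fun k _ => k + n) ?_ ?_ ?_ ?_
  · intro k hk
    simp only [Finset.mem_filter, Finset.mem_Ico] at hk ⊢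
    refine ⟨by omega, ?_⟩
    have : Even (n : ℤ) := by exact_mod_cast hn
    grind
  · intro a _ b _ h; omega
  · intro k hk
    simp only [Finset.mem_filter, Finset.mem_Ico] at hk
    refine ⟨k - n, ?_, by ring⟩
    simp only [Finset.mem_filter, Finset.mem_Ico]
    refine ⟨by omega, ?_⟩
    have : Even (n : ℤ) := by exact_mod_cast hn
    grind
  · intro k _
    rw [c.edge_add]

/-- Moving the window by one step drops an edge and gains the same edge one period later, with the
same parity as `n` is even. So `E⁺` and `E⁻` can be read from any starting position. -/
lemma seg_period (hn : Even n) (ε i : ℤ) : c.seg ε i (i + n) = c.seg ε 0 n := by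
  have key (i : ℤ) : c.seg ε i (i + n) = c.seg ε (i + 1) (i + 1 + n) := by
    rcases Nat.eq_zero_or_pos n with rfl | h0
    · simp
    have h1 := c.seg_add ε (show i ≤ i + n by omega) (show i + n ≤ i + 1 + n by omega)
    have h2 := c.seg_add ε (show i ≤ i + 1 by omega) (show i + 1 ≤ i + 1 + n by omega)
    rw [c.seg_shift hn] at h1
    rw [h1, add_comm] at h2
    exact add_left_cancel h2
  induction i with
  | zero => simp
  | succ k ih => rw [← key, ih]
  | pred k ih => rw [key, sub_add_cancel, ih]

/-- `1` if `m` is even, and `-1` if `m` is odd. -/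
def sgn (m : ℤ) : ℤ := if Even m then 1 else -1

lemma sgn_even {m : ℤ} (h : Even m) : sgn m = 1 := if_pos h

lemma sgn_odd {m : ℤ} (h : Odd m) : sgn m = -1 := if_neg (Int.not_even_iff_odd.2 h)

/-- The alternating sum of the edge vectors telescopes, as consecutive edges share a vertex with
opposite signs. Exchanging the two parities on an arc thus changes the degree only at its ends. -/
lemma deg_seg (ε : ℤ) {i j : ℤ} (hij : i ≤ j) :
    deg (c.seg ε i j) + sgn (j + ε) • Finsupp.single (c.vert j) 1 =
      deg (c.seg (ε + 1) i j) + sgn (i + ε) • Finsupp.single (c.vert i) 1 := by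
  induction j, hij using Int.leInduction with
  | base => simp
  | succ k hk ih =>
    rw [c.seg_add _ hk (Int.le_add_one le_rfl), c.seg_add (ε + 1) hk (Int.le_add_one le_rfl),
      deg_add, deg_add]
    rcases Int.even_or_odd (k + ε) with h | h
    · rw [c.seg_succ_of_even h, c.seg_succ_of_odd (by grind), sgn_odd (m := k + 1 + ε) (by grind)]
      rw [sgn_even h] at ih
      simp only [deg_single, edge_coe, edgeVec_mk, deg_zero, one_smul, neg_smul] at ih ⊢
      rw [add_zero, ← ih]
      abel
    · rw [c.seg_succ_of_odd h, c.seg_succ_of_even (by grind), sgn_even (m := k + 1 + ε) (by grind)]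
      rw [sgn_odd h] at ih
      simp only [deg_single, edge_coe, edgeVec_mk, deg_zero, one_smul, neg_smul] at ih ⊢
      rw [add_zero, add_right_comm, ← ih]
      abel

lemma linearCombination_deg_seg_aux (χ : V → ℤ) (ε : ℤ) {i j : ℤ} (hij : i ≤ j) :
    Finsupp.linearCombination ℤ χ (deg (c.seg ε i j)) +
        (if Even (i + ε) then 0 else χ (c.vert i)) =
      ∑ k ∈ Finset.Ico i j, χ (c.vert k) + if Even (j + ε) then 0 else χ (c.vert j) := by
  induction j, hij using Int.leInduction with
  | base => simp
  | succ k hk ih =>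
    rw [c.seg_add _ hk (Int.le_add_one le_rfl), deg_add, map_add,
      ← Finset.insert_Ico_right_eq_Ico_add_one hk, Finset.sum_insert (by simp)]
    rcases Int.even_or_odd (k + ε) with h | h
    · rw [if_pos h] at ih
      rw [c.seg_succ_of_even h, if_neg (show ¬ Even (k + 1 + ε) by grind), deg_single, edge_coe,
        one_smul, linearCombination_edgeVec]
      linarith
    · rw [if_neg (Int.not_even_iff_odd.2 h)] at ih
      rw [c.seg_succ_of_odd h, if_pos (show Even (k + 1 + ε) by grind), deg_zero, map_zero]
      linarith

/-- The edges of one parity match up the positions of a full period, so the degree counts the visits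
of each vertex. -/
lemma linearCombination_deg_seg (hn : Even n) (χ : V → ℤ) (ε a : ℤ) :
    Finsupp.linearCombination ℤ χ (deg (c.seg ε a (a + n))) =
      ∑ k ∈ Finset.Ico a (a + n), χ (c.vert k) := by
  have h := c.linearCombination_deg_seg_aux χ ε (show a ≤ a + n by omega)
  have hn' : Even (n : ℤ) := by exact_mod_cast hn
  have h2 : Even (a + n + ε) ↔ Even (a + ε) := by grind
  rw [c.per] at h
  simp only [h2] at h
  exact add_right_cancel h

lemma deg_seg_period (hn : Even n) : deg (c.seg 0 0 n) = deg (c.seg 1 0 n) := by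
  have h := c.deg_seg 0 (show (0 : ℤ) ≤ n by omega)
  have h0 : c.vert n = c.vert 0 := by simpa using c.per 0
  have hn' : Even (n : ℤ) := by exact_mod_cast hn
  rw [h0, sgn_even (by simpa), sgn_even (by simp)] at h
  exact add_right_cancel h

end CyclicWalk

end CyclicWalk

/-! ### From a walk to its periodic sequence -/

section OfWalk

variable {V : Type*} {G : SimpleGraph V}

/-- The periodic sequence of the vertices of a closed walk. -/
def CyclicWalk.ofWalk {u : V} (w : G.Walk u u) (hpos : 0 < w.length) :
    CyclicWalk G w.length where
  vert i := w.getVert (i % w.length).toNat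
  adj i := by
    have hn : (0 : ℤ) < w.length := by exact_mod_cast hpos
    have h1 := Int.emod_nonneg i hn.ne'
    have h2 := Int.emod_lt_of_pos i hn
    have h3 : (i + 1) % w.length = (i % w.length + 1) % w.length := by simp
    have hadj := w.adj_getVert_succ (i := (i % w.length).toNat) (by omega)
    rcases (show i % w.length + 1 < w.length ∨ i % w.length + 1 = w.length by omega) with h | h
    · rw [h3, Int.emod_eq_of_lt (by omega) h]
      have : (i % w.length + 1).toNat = (i % w.length).toNat + 1 := by omega
      rwa [this]
    · have h4 : (i % w.length).toNat + 1 = w.length := by omega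
      rw [h3, h, Int.emod_self]
      rw [h4, w.getVert_length] at hadj
      simpa using hadj
  per i := by simp

variable {u : V} {w : G.Walk u u} {hpos : 0 < w.length}

lemma CyclicWalk.ofWalk_vert {k : ℕ} (hk : k ≤ w.length) :
    (ofWalk w hpos).vert k = w.getVert k := by
  change w.getVert ((k : ℤ) % w.length).toNat = _
  rcases hk.lt_or_eq with h | h
  · rw [Int.emod_eq_of_lt (by omega) (by omega)]
    simp
  · rw [h]; simp

lemma CyclicWalk.ofWalk_edge (i : Fin w.length) :
    (ofWalk w hpos).edge i = edgeAt w i := by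
  apply Subtype.ext
  rw [edge_coe]
  have h := ofWalk_vert (hpos := hpos) (k := i + 1) (by omega)
  push_cast at h
  rw [h, ofWalk_vert (by omega)]
  rfl

lemma CyclicWalk.exists_fin (i : ℤ) : ∃ k : Fin w.length, (w.length : ℤ) ∣ i - (k : ℕ) ∧
    (ofWalk w hpos).edge i = edgeAt w k ∧ (ofWalk w hpos).vert i = w.getVert k := by
  obtain ⟨j, h0, h1, hj⟩ := exists_rep hpos 0 i
  lift j to ℕ using h0
  refine ⟨⟨j, by omega⟩, hj, ?_, ?_⟩
  · rw [← ofWalk_edge (hpos := hpos), edge_congr _ hj]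
  · rw [vert_congr _ hj, ofWalk_vert (by omega)]

lemma posExp_eq_seg : posExp w = (CyclicWalk.ofWalk w hpos).seg 0 0 w.length := by
  refine Finset.sum_bij (fun i _ => (i.val : ℤ)) ?_ ?_ ?_ ?_
  · intro i hi
    simp only [Finset.mem_filter, Finset.mem_univ, true_and, Finset.mem_Ico] at hi ⊢
    exact ⟨⟨by omega, by omega⟩, by simpa using hi⟩
  · intro i _ j _ h; ext; exact_mod_cast h
  · intro k hk
    simp only [Finset.mem_filter, Finset.mem_Ico] at hk
    obtain ⟨⟨h0, h1⟩, h2⟩ := hk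
    lift k to ℕ using h0
    refine ⟨⟨k, by omega⟩, ?_, rfl⟩
    simpa using h2
  · intro i _
    rw [CyclicWalk.ofWalk_edge]

lemma negExp_eq_seg : negExp w = (CyclicWalk.ofWalk w hpos).seg 1 0 w.length := by
  refine Finset.sum_bij (fun i _ => (i.val : ℤ)) ?_ ?_ ?_ ?_
  · intro i hi
    simp only [Finset.mem_filter, Finset.mem_univ, true_and, Finset.mem_Ico] at hi ⊢
    refine ⟨⟨by omega, by omega⟩, ?_⟩
    exact_mod_cast hi.add_one
  · intro i _ j _ h; ext; exact_mod_cast h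
  · intro k hk
    simp only [Finset.mem_filter, Finset.mem_Ico] at hk
    obtain ⟨⟨h0, h1⟩, h2⟩ := hk
    lift k to ℕ using h0
    refine ⟨⟨k, by omega⟩, ?_, rfl⟩
    simp only [Finset.mem_filter, Finset.mem_univ, true_and]
    have h3 : Even (k + 1) := by exact_mod_cast h2
    rwa [Nat.even_add_one, Nat.not_even_iff_odd] at h3
  · intro i _
    rw [CyclicWalk.ofWalk_edge]

lemma deg_posExp_eq (hpos : 0 < w.length) (hw : Even w.length) : deg (posExp w) = deg (negExp w) := by
  rw [posExp_eq_seg (hpos := hpos), negExp_eq_seg (hpos := hpos)]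
  exact CyclicWalk.deg_seg_period _ hw

lemma mem_support_iff_exists (x : V) :
    x ∈ w.support ↔ ∃ i, (CyclicWalk.ofWalk w hpos).vert i = x := by
  rw [SimpleGraph.Walk.mem_support_iff_exists_getVert]
  constructor
  · rintro ⟨k, rfl, hk⟩
    exact ⟨k, CyclicWalk.ofWalk_vert hk⟩
  · rintro ⟨i, rfl⟩
    obtain ⟨k, -, -, h⟩ := CyclicWalk.exists_fin (hpos := hpos) i
    exact ⟨k, h.symm, by omega⟩

lemma mem_edges_iff_exists (e : Sym2 V) :
    e ∈ w.edges ↔ ∃ i, ((CyclicWalk.ofWalk w hpos).edge i : Sym2 V) = e := by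
  have h : e ∈ w.edges ↔ ∃ i : Fin w.length, (edgeAt w i : Sym2 V) = e := by
    rw [← SimpleGraph.Walk.mem_edges_toSubgraph]
    induction e with
    | h x y =>
      rw [SimpleGraph.Subgraph.mem_edgeSet, SimpleGraph.Walk.toSubgraph_adj_iff]
      constructor
      · rintro ⟨i, h, hi⟩
        exact ⟨⟨i, hi⟩, h⟩
      · rintro ⟨i, h⟩
        exact ⟨i, by rw [← h]; rfl, i.2⟩
  rw [h]
  constructor
  · rintro ⟨k, rfl⟩
    exact ⟨k, by rw [CyclicWalk.ofWalk_edge]⟩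
  · rintro ⟨i, rfl⟩
    obtain ⟨k, -, h, -⟩ := CyclicWalk.exists_fin (hpos := hpos) i
    exact ⟨k, by rw [h]⟩

lemma toSubgraph_adj_iff_exists (x y : V) :
    w.toSubgraph.Adj x y ↔ ∃ i, ((CyclicWalk.ofWalk w hpos).edge i : Sym2 V) = s(x, y) := by
  rw [← mem_edges_iff_exists, ← SimpleGraph.Walk.mem_edges_toSubgraph,
    SimpleGraph.Subgraph.mem_edgeSet]

end OfWalk

/-! ### Repeated vertices of a primitive walk -/

section Primitive

variable {V : Type*} {G : SimpleGraph V}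

/-- The properties of the sequence of vertices of a primitive walk: its odd and even edges form two
disjoint classes, two visits of a vertex cut it into two odd walks, and the visits of two different
vertices do not interlace. -/
structure CyclicWalk.IsPrim {n : ℕ} (c : CyclicWalk G n) : Prop where
  pos : 0 < n
  even : Even n
  disj : ∀ i j : ℤ, Odd (i - j) → c.edge i ≠ c.edge j
  odd : ∀ i j : ℤ, i < j → j < i + n → c.vert i = c.vert j → Odd (j - i)
  noncross : ∀ i k j l : ℤ, i < k → k < j → j < l → l < i + n → c.vert i = c.vert j →
    c.vert k = c.vert l → False

lemma exists_walk_of_adj (m : ℕ) (p : ℕ → V) (h : ∀ k < m, G.Adj (p k) (p (k + 1))) :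
    ∃ ξ : G.Walk (p 0) (p m), ξ.length = m ∧ ∀ k ≤ m, ξ.getVert k = p k := by
  induction m generalizing p with
  | zero => exact ⟨.nil, rfl, fun k hk => by simp [Nat.le_zero.1 hk]⟩
  | succ m ih =>
    obtain ⟨ξ, h1, h2⟩ := ih (fun k => p (k + 1)) fun k hk => h (k + 1) (by omega)
    refine ⟨.cons (h 0 (by omega)) ξ, by simp [h1], fun k hk => ?_⟩
    cases k with
    | zero => simp
    | succ k => simpa using h2 k (by omega)

lemma sum_single_le {ι κ E : Type*} {A : Finset ι} {B : Finset κ} {f : ι → E} {g : κ → E}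
    (τ : ι → κ) (hτ : ∀ i ∈ A, τ i ∈ B) (hinj : Set.InjOn τ A) (hfg : ∀ i ∈ A, g (τ i) = f i) :
    ∑ i ∈ A, Finsupp.single (f i) 1 ≤ ∑ j ∈ B, Finsupp.single (g j) 1 := by
  classical
  rw [Finset.sum_congr rfl fun i hi => by rw [← hfg i hi],
    ← Finset.sum_image (f := fun j => Finsupp.single (g j) 1) hinj]
  refine Finset.sum_le_sum_of_subset fun j hj => ?_
  obtain ⟨i, hi, rfl⟩ := Finset.mem_image.1 hj
  exact hτ i hi

variable {u : V} {w : G.Walk u u} (hpos : 0 < w.length)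

/-- `σ` sends the positions of `ξ` to positions of `w`. Its injectivity modulo the period and its
preservation of parity give the two divisibilities, multiplicities included. -/
lemma IsPrimitive.false_of_walk (hw : Even w.length) (hp : IsPrimitive w) {x : V} (ξ : G.Walk x x)
    (h0 : 0 < ξ.length) (heven : Even ξ.length) (hlt : ξ.length < w.length) (σ : ℕ → ℤ)
    (hσ : ∀ k : Fin ξ.length, edgeAt ξ k = (CyclicWalk.ofWalk w hpos).edge (σ k))
    (hinj : ∀ k < ξ.length, ∀ l < ξ.length, (w.length : ℤ) ∣ σ k - σ l → k = l)
    (hpar : ∀ k < ξ.length, Even (σ k + k)) : False := by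
  have hn : (0 : ℤ) < w.length := by exact_mod_cast hpos
  have hw' : Even (w.length : ℤ) := by exact_mod_cast hw
  have hparmod (i : ℤ) : Even (i % w.length + i) := by
    have := Int.emod_add_mul_ediv i w.length
    have h2 : Even (w.length * (i / w.length)) := hw'.mul_right _
    grind
  refine hp.2 ⟨x, ξ, h0, heven, hlt, ?_, ?_⟩
  · rw [posExp_eq_seg (hpos := hpos)]
    refine sum_single_le (fun k => σ k % w.length) ?_ ?_ ?_
    · intro k hk
      simp only [Finset.mem_filter, Finset.mem_univ, true_and, Finset.mem_Ico] at hk ⊢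
      have h1 := hpar k k.2
      have h2 := hparmod (σ k)
      have h3 : Even ((k : ℕ) : ℤ) := by exact_mod_cast hk
      exact ⟨⟨Int.emod_nonneg _ hn.ne', Int.emod_lt_of_pos _ hn⟩, by grind⟩
    · intro k _ l _ h
      exact Fin.ext (hinj k k.2 l l.2 (Int.ModEq.dvd (Eq.symm h)))
    · intro k _
      rw [hσ]
      exact CyclicWalk.edge_congr _ (Int.ModEq.dvd (by simp [Int.ModEq]))
  · rw [negExp_eq_seg (hpos := hpos)]
    refine sum_single_le (fun k => σ k % w.length) ?_ ?_ ?_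
    · intro k hk
      simp only [Finset.mem_filter, Finset.mem_univ, true_and, Finset.mem_Ico] at hk ⊢
      have h1 := hpar k k.2
      have h2 := hparmod (σ k)
      have h3 : Odd ((k : ℕ) : ℤ) := by exact_mod_cast hk
      exact ⟨⟨Int.emod_nonneg _ hn.ne', Int.emod_lt_of_pos _ hn⟩, by grind⟩
    · intro k _ l _ h
      exact Fin.ext (hinj k k.2 l l.2 (Int.ModEq.dvd (Eq.symm h)))
    · intro k _
      rw [hσ]
      exact CyclicWalk.edge_congr _ (Int.ModEq.dvd (by simp [Int.ModEq]))

lemma IsPrimitive.false_of_closed_aux (hw : Even w.length) (hp : IsPrimitive w) (p : ℕ → V)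
    {m : ℕ} (h0 : 0 < m) (heven : Even m) (hlt : m < w.length) (hclosed : p m = p 0) (σ : ℕ → ℤ)
    (hσ : ∀ k < m, s(p k, p (k + 1)) = ((CyclicWalk.ofWalk w hpos).edge (σ k) : Sym2 V))
    (hinj : ∀ k < m, ∀ l < m, (w.length : ℤ) ∣ σ k - σ l → k = l)
    (hpar : ∀ k < m, Even (σ k + k)) : False := by
  obtain ⟨ξ, h1, h2⟩ := exists_walk_of_adj (G := G) m p fun k hk => by
    rw [← SimpleGraph.mem_edgeSet, hσ k hk]
    exact Subtype.mem _
  refine hp.false_of_walk hpos hw (ξ.copy rfl hclosed) (by simpa [h1]) (by simpa [h1])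
    (by simpa [h1]) σ ?_ (by simpa [h1]) (by simpa [h1])
  rintro ⟨k, hk⟩
  rw [SimpleGraph.Walk.length_copy, h1] at hk
  apply Subtype.ext
  simp only [edgeAt]
  rw [SimpleGraph.Walk.getVert_copy, SimpleGraph.Walk.getVert_copy, h2 k hk.le, h2 (k + 1) hk,
    hσ k hk]

/-- A primitive walk contains no shorter even closed walk whose edges have, along that walk, all the
same parity as in the given walk, or all the other parity. -/
lemma IsPrimitive.false_of_closed (hw : Even w.length) (hp : IsPrimitive w) (p : ℕ → V)
    {m : ℕ} (h0 : 0 < m) (heven : Even m) (hlt : m < w.length) (hclosed : p m = p 0) (σ : ℕ → ℤ)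
    (δ : ℤ) (hσ : ∀ k < m, s(p k, p (k + 1)) = ((CyclicWalk.ofWalk w hpos).edge (σ k) : Sym2 V))
    (hinj : ∀ k < m, ∀ l < m, (w.length : ℤ) ∣ σ k - σ l → k = l)
    (hpar : ∀ k < m, Even (σ k + k + δ)) : False := by
  rcases Int.even_or_odd δ with hδ | hδ
  · exact hp.false_of_closed_aux hpos hw p h0 heven hlt hclosed σ hσ hinj fun k hk => by
      have := hpar k hk; grind
  -- Reversing a walk of even length exchanges its odd and even edges, which removes the odd shift
  -- `δ`.
  · refine hp.false_of_closed_aux hpos hw (fun k => p (m - k)) h0 heven hlt (by simp [hclosed])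
      (fun k => σ (m - 1 - k)) (fun k hk => ?_) (fun k hk l hl h => ?_) fun k hk => ?_
    · rw [← hσ (m - 1 - k) (by omega), Sym2.eq_swap, show m - (k + 1) = m - 1 - k by omega,
        show m - 1 - k + 1 = m - k by omega]
    · have := hinj _ (by omega) _ (by omega) h
      omega
    · have h1 := hpar (m - 1 - k) (by omega)
      have h2 : ((m - 1 - k : ℕ) : ℤ) = m - 1 - k := by omega
      have h3 : Even (m : ℤ) := by exact_mod_cast heven
      rw [h2] at h1
      grind

lemma dvd_sub_of_window {n : ℕ} {a i j : ℤ} (hi : a ≤ i) (hi' : i < a + n) (hj : a ≤ j)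
    (hj' : j < a + n) (h : (n : ℤ) ∣ i - j) : i = j := by
  have := Int.eq_zero_of_abs_lt_dvd h (by rw [abs_lt]; omega)
  omega

/-- Two visits at even distance would cut off a shorter even closed walk. Interlacing visits would
allow such a walk to be glued from two arcs, one of them run backwards. -/
lemma IsPrimitive.isPrim (hw : Even w.length) (hp : IsPrimitive w) :
    (CyclicWalk.ofWalk w hpos).IsPrim := by
  have hodd : ∀ i j : ℤ, i < j → j < i + w.length →
      (CyclicWalk.ofWalk w hpos).vert i = (CyclicWalk.ofWalk w hpos).vert j → Odd (j - i) := by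
    intro i j hij hj h
    rw [← Int.not_even_iff_odd]
    intro hev
    obtain ⟨m, hm⟩ := Int.eq_ofNat_of_zero_le (show 0 ≤ j - i by omega)
    obtain rfl : j = i + m := by omega
    refine hp.false_of_closed hpos hw (fun k => (CyclicWalk.ofWalk w hpos).vert (i + k)) (m := m)
      (by omega) (by rw [hm] at hev; exact_mod_cast hev) (by omega) (by simp [h])
      (fun k => i + k) i (fun k hk => ?_) (fun k hk l hl h => ?_) fun k hk => ?_
    · rw [CyclicWalk.edge_coe]; push_cast; rw [add_assoc]
    · have := dvd_sub_of_window (a := i) (by omega) (by omega) (by omega) (by omega) h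
      omega
    · exact ⟨i + k, by ring⟩
  refine ⟨hpos, hw, ?_, hodd, ?_⟩
  · intro i j hij h
    have key : ∀ i j : ℤ, Even i → Odd j →
        (CyclicWalk.ofWalk w hpos).edge i ≠ (CyclicWalk.ofWalk w hpos).edge j := by
      intro i j hi hj h
      have hw' : Even (w.length : ℤ) := by exact_mod_cast hw
      refine absurd hp.1 (Finset.not_disjoint_iff.2 ⟨(CyclicWalk.ofWalk w hpos).edge i, ?_, ?_⟩)
      · rw [posExp_eq_seg (hpos := hpos), ← CyclicWalk.seg_period _ hw 0 i, Finsupp.mem_support_iff]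
        exact (CyclicWalk.seg_pos _ i le_rfl (by omega) (by simpa)).ne'
      · rw [h, negExp_eq_seg (hpos := hpos), ← CyclicWalk.seg_period _ hw 1 j,
          Finsupp.mem_support_iff]
        exact (CyclicWalk.seg_pos _ j le_rfl (by omega) hj.add_one).ne'
    rcases Int.even_or_odd i with hi | hi
    · exact key i j hi (by grind) h
    · exact key j i (by grind) hi h.symm
  · have key : ∀ i k j l : ℤ, i < k → k < j → j < l → l < i + w.length → Even (k - i) →
        (CyclicWalk.ofWalk w hpos).vert i = (CyclicWalk.ofWalk w hpos).vert j →
        (CyclicWalk.ofWalk w hpos).vert k = (CyclicWalk.ofWalk w hpos).vert l → False := by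
      intro i k j l hik hkj hjl hl hev h1 h2
      have o1 := hodd i j (by omega) (by omega) h1
      have o2 := hodd k l (by omega) (by omega) h2
      obtain ⟨a, ha⟩ := Int.eq_ofNat_of_zero_le (show 0 ≤ k - i by omega)
      obtain ⟨b, hb⟩ := Int.eq_ofNat_of_zero_le (show 0 ≤ l - j by omega)
      have hev' : Even ((a : ℤ) + b) := by
        simp only [Int.even_iff, Int.odd_iff] at hev o1 o2 ⊢
        omega
      -- Run forwards from `i` to `k`, continue at the same vertex in position `l`, and run
      -- backwards to `j`, which is the vertex of `i` again. The backward arc fits the parity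
      -- pattern because `l - k` is odd.
      refine hp.false_of_closed hpos hw (m := a + b)
        (fun t => if t ≤ a then (CyclicWalk.ofWalk w hpos).vert (i + t)
          else (CyclicWalk.ofWalk w hpos).vert (l - (t - a)))
        (by omega) (by exact_mod_cast hev') (by omega) ?_
        (fun t => if t < a then i + t else l - (t - a) - 1) i (fun t ht => ?_)
        (fun t ht s hs h => ?_) fun t ht => ?_
      · rw [if_neg (by omega), if_pos (by omega)]
        push_cast
        rw [show l - ((a : ℤ) + b - a) = j by omega, ← h1]; simp
      · rw [CyclicWalk.edge_coe]
        rcases lt_trichotomy t a with h | h | h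
        · rw [if_pos h.le, if_pos (by omega), if_pos h]
          push_cast; rw [add_assoc]
        · rw [if_pos h.le, if_neg (by omega), if_neg (by omega), h, show i + (a : ℤ) = k by omega, h2,
            Sym2.eq_swap, show l - (((a + 1 : ℕ) : ℤ) - a) = l - (a - a) - 1 by push_cast; ring]
          simp
        · rw [if_neg (by omega), if_neg (by omega), if_neg (by omega), Sym2.eq_swap,
            show l - (((t + 1 : ℕ) : ℤ) - a) = l - (t - a) - 1 by push_cast; ring,
            sub_add_cancel]
      · have := dvd_sub_of_window (a := i) (i := if t < a then i + t else l - (t - a) - 1)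
          (j := if s < a then i + s else l - (s - a) - 1) (by split_ifs <;> omega)
          (by split_ifs <;> omega) (by split_ifs <;> omega) (by split_ifs <;> omega) h
        split_ifs at this <;> omega
      · rw [ha] at hev
        simp only [Int.even_iff, Int.odd_iff] at hev hev' o1 o2 ⊢
        split_ifs <;> omega
    intro i k j l hik hkj hjl hl h1 h2
    rcases Int.even_or_odd (k - i) with h | h
    · exact key i k j l hik hkj hjl hl h h1 h2
    -- Starting at `k` instead, the first arc has length `j - k`, which is even since `j - i` and `k
    -- - i` are odd.
    · have o1 := hodd i j (by omega) (by omega) h1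
      refine key k j l (i + w.length) hkj hjl hl (by omega) (by
        simp only [Int.even_iff, Int.odd_iff] at h o1 ⊢
        omega) h2 ?_
      rw [CyclicWalk.per, h1]

end Primitive

/-! ### Biconnected subgraphs -/

section Biconnected

open Relation

variable {V : Type*} {G : SimpleGraph V}

lemma preconnected_iff_reflTransGen (D : G.Subgraph) :
    D.Preconnected ↔ ∀ x ∈ D.verts, ∀ y ∈ D.verts, ReflTransGen D.Adj x y := by
  rw [SimpleGraph.Subgraph.preconnected_iff]
  constructor
  · intro h x hx y hy
    have h1 := (SimpleGraph.reachable_iff_reflTransGen _ _).1 (h ⟨x, hx⟩ ⟨y, hy⟩)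
    exact h1.lift Subtype.val fun a b hab => hab
  · rintro h ⟨x, hx⟩ ⟨y, hy⟩
    rw [SimpleGraph.reachable_iff_reflTransGen]
    have h1 := h x hx y hy
    induction h1 with
    | refl => exact ReflTransGen.refl
    | tail _ hbc ih => exact (ih (D.edge_vert hbc)).tail hbc

/-- Adjacency in a subgraph of two vertices different from `z`. -/
def AdjAvoiding (D : G.Subgraph) (z x y : V) : Prop := D.Adj x y ∧ x ≠ z ∧ y ≠ z

lemma AdjAvoiding.symm {D : G.Subgraph} {z x y : V} (h : AdjAvoiding D z x y) :
    AdjAvoiding D z y x := ⟨h.1.symm, h.2.2, h.2.1⟩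

lemma reflTransGen_symm {α : Type*} {r : α → α → Prop} (hr : ∀ a b, r a b → r b a) {x y : α}
    (h : ReflTransGen r x y) : ReflTransGen r y x := by
  have : Std.Symm r := ⟨hr⟩
  exact (ReflTransGen.stdSymm (r := r)).symm _ _ h

lemma reflTransGen_mono {α : Type*} {r s : α → α → Prop} (h : ∀ a b, r a b → s a b) {x y : α}
    (hxy : ReflTransGen r x y) : ReflTransGen s x y := hxy.lift id h

/-- Paths in `ReflTransGen` form allow inductions along them. A vertex `z` outside `D` may be
admitted, since every path of `D` avoids it. -/
lemma biconnected_iff (D : G.Subgraph) :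
    Biconnected D ↔ D.verts.Nonempty ∧ (∀ x ∈ D.verts, ∀ y ∈ D.verts, ReflTransGen D.Adj x y) ∧
      ∀ z, ∀ x ∈ D.verts, ∀ y ∈ D.verts, x ≠ z → y ≠ z → ReflTransGen (AdjAvoiding D z) x y := by
  have hadj (z x y : V) : (D.deleteVerts {z}).Adj x y ↔ AdjAvoiding D z x y := by
    rw [SimpleGraph.Subgraph.deleteVerts_adj]
    constructor
    · rintro ⟨-, h1, -, h2, h⟩
      exact ⟨h, h1, h2⟩
    · rintro ⟨h, h1, h2⟩
      exact ⟨D.edge_vert h, h1, D.edge_vert h.symm, h2, h⟩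
  have hdel (z : V) : (D.deleteVerts {z}).Preconnected ↔
      ∀ x ∈ D.verts, ∀ y ∈ D.verts, x ≠ z → y ≠ z → ReflTransGen (AdjAvoiding D z) x y := by
    rw [preconnected_iff_reflTransGen]
    have : (D.deleteVerts {z}).Adj = AdjAvoiding D z := by ext x y; exact hadj z x y
    rw [this]
    simp only [SimpleGraph.Subgraph.deleteVerts_verts, Set.mem_sdiff, Set.mem_singleton_iff]
    grind
  simp only [Biconnected, SimpleGraph.Subgraph.connected_iff, preconnected_iff_reflTransGen D, hdel]
  constructor
  · rintro ⟨⟨h1, h2⟩, h3⟩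
    refine ⟨h2, h1, fun z x hx y hy hxz hyz => ?_⟩
    by_cases hz : z ∈ D.verts
    · exact h3 z hz x hx y hy hxz hyz
    · refine reflTransGen_mono (fun a b hab => ⟨hab, ?_, ?_⟩) (h1 x hx y hy)
      · rintro rfl; exact hz (D.edge_vert hab)
      · rintro rfl; exact hz (D.edge_vert hab.symm)
  · rintro ⟨h1, h2, h3⟩
    exact ⟨⟨h2, h1⟩, fun z _ => h3 z⟩

lemma AdjAvoiding.mono {D E : G.Subgraph} (h : D ≤ E) {z x y : V} (hxy : AdjAvoiding D z x y) :
    AdjAvoiding E z x y := ⟨h.2 hxy.1, hxy.2⟩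

/-- The union of two biconnected subgraphs with two common vertices is biconnected. -/
lemma Biconnected.sup {D E : G.Subgraph} (hD : Biconnected D) (hE : Biconnected E) {x y : V}
    (hxy : x ≠ y) (hxD : x ∈ D.verts) (hyD : y ∈ D.verts) (hxE : x ∈ E.verts) (hyE : y ∈ E.verts) :
    Biconnected (D ⊔ E) := by
  rw [biconnected_iff] at *
  have key (r : V → V → Prop) (hr : ∀ a b, r a b → r b a) (s : V) (P : V → Prop)
      (h1 : ∀ a ∈ D.verts, P a → ReflTransGen r a s) (h2 : ∀ a ∈ E.verts, P a → ReflTransGen r a s) :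
      ∀ a ∈ (D ⊔ E).verts, ∀ b ∈ (D ⊔ E).verts, P a → P b → ReflTransGen r a b := by
    have h3 : ∀ a ∈ (D ⊔ E).verts, P a → ReflTransGen r a s := by
      intro a ha hP
      rw [SimpleGraph.Subgraph.verts_sup] at ha
      exact ha.elim (fun h => h1 a h hP) fun h => h2 a h hP
    exact fun a ha b hb hPa hPb => (h3 a ha hPa).trans (reflTransGen_symm hr (h3 b hb hPb))
  refine ⟨⟨x, by simp [hxD]⟩, fun a ha b hb => ?_, fun z a ha b hb haz hbz => ?_⟩
  · refine key _ (fun a b h => h.symm) x (fun _ => True) (fun a ha _ => ?_) (fun a ha _ => ?_)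
      a ha b hb trivial trivial
    · exact reflTransGen_mono (fun _ _ h => Or.inl h) (hD.2.1 a ha x hxD)
    · exact reflTransGen_mono (fun _ _ h => Or.inr h) (hE.2.1 a ha x hxE)
  -- Of two common vertices at most one is `z`; all paths are routed through the other.
  · obtain ⟨s, hsD, hsE, hsz⟩ : ∃ s, s ∈ D.verts ∧ s ∈ E.verts ∧ s ≠ z := by
      by_cases hx : x = z
      · exact ⟨y, hyD, hyE, by rw [← hx]; exact hxy.symm⟩
      · exact ⟨x, hxD, hxE, hx⟩
    refine key _ (fun a b h => h.symm) s (· ≠ z) (fun a ha haz => ?_) (fun a ha haz => ?_)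
      a ha b hb haz hbz
    · exact reflTransGen_mono (fun _ _ h => h.mono le_sup_left) (hD.2.2 z a ha s hsD haz hsz)
    · exact reflTransGen_mono (fun _ _ h => h.mono le_sup_right) (hE.2.2 z a ha s hsE haz hsz)

lemma biconnected_subgraphOfAdj {x y : V} (h : G.Adj x y) : Biconnected (G.subgraphOfAdj h) := by
  rw [biconnected_iff]
  have hadj : (G.subgraphOfAdj h).Adj x y := by simp
  refine ⟨⟨x, by simp⟩, ?_, ?_⟩
  · intro a ha b hb
    simp only [SimpleGraph.subgraphOfAdj_verts, Set.mem_insert_iff, Set.mem_singleton_iff] at ha hb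
    rcases ha with rfl | rfl <;> rcases hb with rfl | rfl
    · exact .refl
    · exact .single hadj
    · exact .single hadj.symm
    · exact .refl
  · intro z a ha b hb haz hbz
    simp only [SimpleGraph.subgraphOfAdj_verts, Set.mem_insert_iff, Set.mem_singleton_iff] at ha hb
    rcases ha with rfl | rfl <;> rcases hb with rfl | rfl
    · exact .refl
    · exact .single ⟨hadj, haz, hbz⟩
    · exact .single ⟨hadj.symm, haz, hbz⟩
    · exact .refl

/-- The subgraph formed by the vertices and edges of a finite sequence of adjacent vertices. -/
def seqSubgraph (p : ℕ → V) (n : ℕ) (h : ∀ i < n, G.Adj (p i) (p (i + 1))) : G.Subgraph where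
  verts := {x | ∃ i ≤ n, p i = x}
  Adj x y := ∃ i < n, s(p i, p (i + 1)) = s(x, y)
  adj_sub := by
    rintro x y ⟨i, hi, hxy⟩
    rw [← SimpleGraph.mem_edgeSet, ← hxy]
    exact h i hi
  edge_vert := by
    rintro x y ⟨i, hi, hxy⟩
    rcases Sym2.eq_iff.1 hxy with ⟨rfl, -⟩ | ⟨-, rfl⟩
    · exact ⟨i, hi.le, rfl⟩
    · exact ⟨i + 1, hi, rfl⟩
  symm := ⟨by
    rintro x y ⟨i, hi, hxy⟩
    exact ⟨i, hi, hxy.trans Sym2.eq_swap⟩⟩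

lemma toSubgraph_eq_seqSubgraph {x y : V} (w : G.Walk x y) (p : ℕ → V) (n : ℕ)
    (h : ∀ i < n, G.Adj (p i) (p (i + 1))) (hn : w.length = n) (hp : ∀ i ≤ n, w.getVert i = p i) :
    w.toSubgraph = seqSubgraph p n h := by
  ext a b
  · rw [SimpleGraph.Walk.mem_verts_toSubgraph, SimpleGraph.Walk.mem_support_iff_exists_getVert]
    constructor
    · rintro ⟨i, rfl, hi⟩
      exact ⟨i, by omega, (hp i (by omega)).symm⟩
    · rintro ⟨i, hi, rfl⟩
      exact ⟨i, hp i hi, by omega⟩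
  · rw [SimpleGraph.Walk.toSubgraph_adj_iff]
    constructor
    · rintro ⟨i, h, hi⟩
      exact ⟨i, by omega, by rw [← h, hp i (by omega), hp (i + 1) (by omega)]⟩
    · rintro ⟨i, hi, h⟩
      exact ⟨i, by rw [← h, hp i (by omega), hp (i + 1) (by omega)], by omega⟩

/-- A closed sequence of at least three adjacent vertices without repetitions is a cycle. -/
lemma isCyclic_seqSubgraph {p : ℕ → V} {n : ℕ} (h : ∀ i < n, G.Adj (p i) (p (i + 1)))
    (hn : 3 ≤ n) (hclosed : p n = p 0) (hinj : ∀ i < n, ∀ j < n, p i = p j → i = j) :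
    ToricGraph.IsCyclic (seqSubgraph p n h) := by
  obtain ⟨m, rfl⟩ : ∃ m, n = m + 1 := ⟨n - 1, by omega⟩
  obtain ⟨ξ, h1, h2⟩ := exists_walk_of_adj (G := G) m (fun k => p (k + 1))
    fun k hk => h (k + 1) (by omega)
  have h0 : G.Adj (p (m + 1)) (p (0 + 1)) := by rw [hclosed]; exact h 0 (by omega)
  refine ⟨p (m + 1), .cons h0 ξ, ?_, toSubgraph_eq_seqSubgraph _ _ _ _ (by simp [h1]) ?_⟩
  · rw [SimpleGraph.Walk.cons_isCycle_iff]
    have hinj' : ∀ i ≤ m, ∀ j ≤ m, p (i + 1) = p (j + 1) → i = j := by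
      intro i hi j hj hij
      rcases hi.lt_or_eq with hi | rfl <;> rcases hj.lt_or_eq with hj | rfl
      · have := hinj _ (by omega) _ (by omega) hij; omega
      · rw [hclosed] at hij
        have := hinj _ (by omega) _ (by omega) hij; omega
      · rw [hclosed] at hij
        have := hinj _ (by omega) _ (by omega) hij; omega
      · rfl
    constructor
    · rw [← SimpleGraph.Walk.IsPath.getVert_injOn_iff]
      intro i hi j hj hij
      rw [Set.mem_ofPred_eq, h1] at hi hj
      rw [h2 i hi, h2 j hj] at hij
      exact hinj' i hi j hj hij
    · rw [← SimpleGraph.Walk.mem_edges_toSubgraph, SimpleGraph.Subgraph.mem_edgeSet,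
        SimpleGraph.Walk.toSubgraph_adj_iff]
      rintro ⟨i, hi, him⟩
      rw [h1] at him
      rw [h2 i him.le, h2 (i + 1) him] at hi
      rcases Sym2.eq_iff.1 hi with ⟨e1, e2⟩ | ⟨e1, e2⟩
      · have := hinj' _ him.le _ le_rfl e1; omega
      · have := hinj' _ him.le _ (by omega) e1
        have := hinj' _ (by omega) _ le_rfl e2; omega
  · rintro (_ | i) hi
    · simp [hclosed]
    · simpa using h2 i (by omega)

/-- A closed sequence of adjacent vertices without repetitions is biconnected. -/
lemma biconnected_seqSubgraph {p : ℕ → V} {n : ℕ} (h : ∀ i < n, G.Adj (p i) (p (i + 1)))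
    (hn : 0 < n) (hclosed : p n = p 0) (hinj : ∀ i < n, ∀ j < n, p i = p j → i = j) :
    Biconnected (seqSubgraph p n h) := by
  rw [biconnected_iff]
  have hadj : ∀ i < n, (seqSubgraph p n h).Adj (p i) (p (i + 1)) := fun i hi => ⟨i, hi, rfl⟩
  have hsymm := fun a b (h : (seqSubgraph p n h).Adj a b) => h.symm
  refine ⟨⟨p 0, 0, by omega, rfl⟩, ?_, ?_⟩
  · have h0 : ∀ i ≤ n, ReflTransGen (seqSubgraph p n h).Adj (p 0) (p i) := by
      intro i
      induction i with
      | zero => exact fun _ => .refl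
      | succ i ih => exact fun hi => (ih (by omega)).tail (hadj i hi)
    rintro _ ⟨i, hi, rfl⟩ _ ⟨j, hj, rfl⟩
    exact (reflTransGen_symm hsymm (h0 i hi)).trans (h0 j hj)
  · intro z x hx y hy hxz hyz
    -- every vertex different from `z` is joined to a fixed one
    obtain ⟨s, hs⟩ : ∃ s, ∀ i < n, p i ≠ z →
        ReflTransGen (AdjAvoiding (seqSubgraph p n h) z) s (p i) := by
      by_cases hz : ∃ m < n, 0 < m ∧ p m = z
      · obtain ⟨m, hm, hm0, rfl⟩ := hz
        refine ⟨p 0, ?_⟩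
        have hne : ∀ i ≤ n, i ≠ m → p i ≠ p m := by
          intro i hi him e
          rcases hi.lt_or_eq with hi | rfl
          · exact him (hinj i hi m hm e)
          · have := hinj 0 (by omega) m hm (hclosed.symm.trans e); omega
        have hlow : ∀ i < m, ReflTransGen (AdjAvoiding (seqSubgraph p n h) (p m)) (p 0) (p i) := by
          intro i
          induction i with
          | zero => exact fun _ => .refl
          | succ i ih =>
            exact fun hi => (ih (by omega)).tail
              ⟨hadj i (by omega), hne i (by omega) (by omega), hne _ (by omega) (by omega)⟩
        have hup : ∀ k, k + m < n →
            ReflTransGen (AdjAvoiding (seqSubgraph p n h) (p m)) (p 0) (p (n - k)) := by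
          intro k
          induction k with
          | zero => intro _; rw [Nat.sub_zero, hclosed]
          | succ k ih =>
            intro hk
            refine (ih (by omega)).tail (AdjAvoiding.symm ⟨?_, hne _ (by omega) (by omega),
              hne _ (by omega) (by omega)⟩)
            have := hadj (n - (k + 1)) (by omega)
            rwa [show n - (k + 1) + 1 = n - k by omega] at this
        intro i hi hiz
        rcases lt_trichotomy i m with hlt | rfl | hgt
        · exact hlow i hlt
        · exact absurd rfl hiz
        · have := hup (n - i) (by omega)
          rwa [show n - (n - i) = i by omega] at this
      · push Not at hz
        by_cases h0 : p 0 = z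
        · refine ⟨p 1, ?_⟩
          intro i hi hiz
          cases i with
          | zero => exact absurd h0 hiz
          | succ i =>
          clear hiz
          induction i with
          | zero => exact .refl
          | succ i ih =>
            exact (ih (by omega)).tail
              ⟨hadj _ (by omega), hz _ (by omega) (by omega), hz _ (by omega) (by omega)⟩
        · refine ⟨p 0, ?_⟩
          intro i hi hiz
          clear hiz
          induction i with
          | zero => exact .refl
          | succ i ih =>
            refine (ih (by omega)).tail ⟨hadj _ (by omega), ?_, hz _ (by omega) (by omega)⟩
            cases i with
            | zero => exact h0
            | succ i => exact hz _ (by omega) (by omega)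
    have hs' : ∀ x ∈ (seqSubgraph p n h).verts, x ≠ z →
        ReflTransGen (AdjAvoiding (seqSubgraph p n h) z) s x := by
      rintro _ ⟨i, hi, rfl⟩ hiz
      rcases hi.lt_or_eq with hi | rfl
      · exact hs i hi hiz
      · rw [hclosed] at hiz ⊢
        exact hs 0 hn hiz
    exact (reflTransGen_symm (fun _ _ h => h.symm) (hs' x hx hxz)).trans (hs' y hy hyz)

end Biconnected

/-! ### Cyclic blocks of a closed sequence -/

section Blocks

open Relation

variable {V : Type*} {G : SimpleGraph V}

/-- A block of a subgraph `K` is a block of a larger subgraph `H`, if only one vertex `z` of `K`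
is incident with edges of `H` outside `K`. -/
lemma maximal_biconnected_of_le {H K C : G.Subgraph} (hKH : K ≤ H)
    (hC : Maximal (fun D : G.Subgraph => D ≤ K ∧ Biconnected D) C) {x y : V} (hxy : C.Adj x y)
    (z : V) (hK : ∀ a b, H.Adj a b → a ∈ K.verts → a ≠ z → K.Adj a b) :
    Maximal (fun D : G.Subgraph => D ≤ H ∧ Biconnected D) C := by
  refine ⟨⟨hC.1.1.trans hKH, hC.1.2⟩, ?_⟩
  rintro D ⟨hDH, hD⟩ hCD
  obtain ⟨s, hsC, hsz⟩ : ∃ s ∈ C.verts, s ≠ z := by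
    by_cases hx : x = z
    · exact ⟨y, C.edge_vert hxy.symm, fun h => hxy.ne (hx.trans h.symm)⟩
    · exact ⟨x, C.edge_vert hxy, hx⟩
  have hD' := (biconnected_iff D).1 hD
  -- A path of `D` from `s` that avoids `z` never leaves `K`, because edges of `H` outside `K` meet
  -- `K` only at `z`.
  have h1 : ∀ d ∈ D.verts, d ≠ z → d ∈ K.verts := by
    intro d hd hdz
    have := hD'.2.2 z s (hCD.1 hsC) d hd hsz hdz
    clear hd hdz
    induction this with
    | refl => exact hC.1.1.1 hsC
    | tail _ hbc ih => exact K.edge_vert (hK _ _ (hDH.2 hbc.1) ih hbc.2.1).symm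
  have h2 : ∀ a b, D.Adj a b → K.Adj a b := by
    intro a b hab
    by_cases ha : a = z
    · have hb : b ≠ z := fun h => hab.ne (ha.trans h.symm)
      exact (hK b a (hDH.2 hab.symm) (h1 b (D.edge_vert hab.symm) hb) hb).symm
    · exact hK a b (hDH.2 hab) (h1 a (D.edge_vert hab) ha) ha
  refine hC.2 ⟨⟨fun d hd => ?_, fun a b hab => h2 a b hab⟩, hD⟩ hCD
  by_cases hdz : d = z
  · rcases ReflTransGen.cases_head (hD'.2.1 d hd s (hCD.1 hsC)) with h | ⟨b, hb, -⟩
    · exact absurd (h.symm.trans hdz) hsz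
    · exact K.edge_vert (h2 _ _ hb)
  · exact h1 d hd hdz

/-- In a closed sequence of vertices, with no vertex visited three times and without interlacing
visits of two vertices, an edge which is traversed only once lies in a cyclic block. -/
lemma exists_cyclic_block (n : ℕ) : ∀ (p : ℕ → V) (h : ∀ i < n, G.Adj (p i) (p (i + 1))),
    0 < n → p n = p 0 →
    (∀ a b c, a < b → b < c → c < n → p a = p b → p b = p c → False) →
    (∀ a b c d, a < b → b < c → c < d → d < n → p a = p c → p b = p d → False) →
    (∀ j, 0 < j → j < n → s(p j, p (j + 1)) ≠ s(p 0, p 1)) →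
    ∃ C : G.Subgraph, ToricGraph.IsCyclic C ∧ C.Adj (p 0) (p 1) ∧
      Maximal (fun D : G.Subgraph => D ≤ seqSubgraph p n h ∧ Biconnected D) C ∧
      ∀ t < n, (∀ b, 0 < b → b < n → p 0 ≠ p b) →
        (∀ a b, 0 < a → a < b → b < n → p a = p b → t ≤ a ∨ b ≤ t) → p t ∈ C.verts := by
  induction n using Nat.strong_induction_on with
  | _ n ih =>
  intro p h hn hclosed htriple hcross hsingle
  by_cases hrep : ∃ a b, a < b ∧ b < n ∧ p a = p b
  · obtain ⟨a, b, hab, hbn, habp⟩ := hrep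
    rcases Nat.eq_zero_or_pos a with rfl | ha
    · -- keep the loop from `0` to `b`
      obtain ⟨C, hC1, hC2, hC3, -⟩ := ih b hbn p (fun i hi => h i (by omega)) hab habp.symm
        (fun x y z h1 h2 h3 => htriple x y z h1 h2 (by omega))
        (fun x y z w h1 h2 h3 h4 => hcross x y z w h1 h2 h3 (by omega))
        (fun j h1 h2 => hsingle j h1 (by omega))
      -- The last clause is vacuous here, as `p 0` is visited again at `b`.
      refine ⟨C, hC1, hC2, ?_, fun t _ h0 _ => absurd habp (h0 b hab hbn)⟩
      refine maximal_biconnected_of_le ⟨?_, ?_⟩ hC3 hC2 (p 0) ?_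
      · rintro _ ⟨i, hi, rfl⟩
        exact ⟨i, by omega, rfl⟩
      · rintro x y ⟨i, hi, hxy⟩
        exact ⟨i, by omega, hxy⟩
      · rintro x y ⟨j, hj, hxy⟩ ⟨k, hk, rfl⟩ hne
        by_cases hjb : j < b
        · exact ⟨j, hjb, hxy⟩
        exfalso
        have hk0 : k ≠ 0 := by rintro rfl; exact hne rfl
        have hkb : k ≠ b := by rintro rfl; exact hne habp.symm
        -- An edge outside the loop but at the vertex `p k` would give a visit of it after `b`,
        -- interlacing with `0` and `b`.
        obtain ⟨m, hm1, hm2, hm⟩ : ∃ m, b ≤ m ∧ m ≤ n ∧ p m = p k := by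
          rcases Sym2.eq_iff.1 hxy with ⟨e, -⟩ | ⟨-, e⟩
          · exact ⟨j, by omega, by omega, e⟩
          · exact ⟨j + 1, by omega, by omega, e⟩
        have hmb : m ≠ b := by rintro rfl; exact hne (hm.symm.trans habp.symm)
        have hmn : m ≠ n := by rintro rfl; exact hne (hm.symm.trans hclosed)
        exact hcross 0 k b m (by omega) (by omega) (by omega) (by omega) habp hm.symm
    · -- cut out the loop from `a` to `b`
      obtain ⟨q, hq1, hq2⟩ : ∃ q : ℕ → V, (∀ k ≤ a, q k = p k) ∧
          ∀ k, a ≤ k → q k = p (k + (b - a)) := by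
        refine ⟨fun k => if k ≤ a then p k else p (k + (b - a)), fun k hk => if_pos hk,
          fun k hk => ?_⟩
        rcases hk.lt_or_eq with hk | rfl
        · exact if_neg (by omega)
        · dsimp only
          rw [if_pos le_rfl, show a + (b - a) = b by omega, habp]
      -- `τ k` is the position in `p` of the entry `k` of the shortened sequence; it is strictly
      -- increasing, so the hypotheses pass to `q`.
      obtain ⟨τ, hτ⟩ : ∃ τ : ℕ → ℕ, ∀ k, τ k = if k ≤ a then k else k + (b - a) := ⟨_, fun _ => rfl⟩
      have hqτ : ∀ k, q k = p (τ k) := by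
        intro k
        rw [hτ]
        split_ifs with hk
        · exact hq1 k hk
        · exact hq2 k (by omega)
      have hedge : ∀ i, s(q i, q (i + 1)) =
          if i < a then s(p i, p (i + 1)) else s(p (i + (b - a)), p (i + (b - a) + 1)) := by
        intro i
        split_ifs with hi
        · rw [hq1 i (by omega), hq1 (i + 1) (by omega)]
        · rw [hq2 i (by omega), hq2 (i + 1) (by omega), show i + 1 + (b - a) = i + (b - a) + 1 by omega]
      have hqadj : ∀ i < n - (b - a), G.Adj (q i) (q (i + 1)) := by
        intro i hi
        rw [← SimpleGraph.mem_edgeSet, hedge]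
        split_ifs
        · exact h i (by omega)
        · exact h _ (by omega)
      have hq0 : q 0 = p 0 := hq1 0 (by omega)
      have hqone : q 1 = p 1 := hq1 1 (by omega)
      obtain ⟨C, hC1, hC2, hC3, hC4⟩ := ih (n - (b - a)) (by omega) q hqadj (by omega)
        (by rw [hq2 _ (by omega), show n - (b - a) + (b - a) = n by omega, hq0, hclosed])
        (fun x y z h1 h2 h3 e1 e2 => by
          rw [hqτ, hqτ] at e1 e2
          have t1 := hτ x; have t2 := hτ y; have t3 := hτ z
          exact htriple (τ x) (τ y) (τ z) (by split_ifs at * <;> omega)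
            (by split_ifs at * <;> omega) (by split_ifs at * <;> omega) e1 e2)
        (fun x y z w h1 h2 h3 h4 e1 e2 => by
          rw [hqτ, hqτ] at e1 e2
          have t1 := hτ x; have t2 := hτ y; have t3 := hτ z; have t4 := hτ w
          exact hcross (τ x) (τ y) (τ z) (τ w) (by split_ifs at * <;> omega)
            (by split_ifs at * <;> omega) (by split_ifs at * <;> omega)
            (by split_ifs at * <;> omega) e1 e2)
        (fun j h1 h2 => by
          rw [hedge, hq0, hqone]
          split_ifs with hj
          · exact hsingle j h1 (by omega)
          · exact hsingle _ (by omega) (by omega))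
      rw [hq0, hqone] at hC2
      refine ⟨C, hC1, hC2, ?_, ?_⟩
      · refine maximal_biconnected_of_le ⟨?_, ?_⟩ hC3 hC2 (p a) ?_
        · rintro _ ⟨i, hi, rfl⟩
          refine ⟨τ i, ?_, (hqτ i).symm⟩
          have := hτ i
          split_ifs at * <;> omega
        · rintro x y ⟨i, hi, hxy⟩
          rw [hedge] at hxy
          split_ifs at hxy
          · exact ⟨i, by omega, hxy⟩
          · exact ⟨i + (b - a), by omega, hxy⟩
        · rintro x y ⟨j, hj, hxy⟩ ⟨k, hk, rfl⟩ hne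
          by_cases hja : j < a
          · exact ⟨j, by omega, by rw [hedge, if_pos hja, hxy]⟩
          by_cases hjb : b ≤ j
          · refine ⟨j - (b - a), by omega, ?_⟩
            rw [hedge, if_neg (by omega), show j - (b - a) + (b - a) = j by omega, hxy]
          exfalso
          -- A remaining vertex other than `p a` that also occurs inside the removed loop would have
          -- visits interlacing with `a` and `b`.
          obtain ⟨m, hm1, hm2, hm⟩ : ∃ m, a ≤ m ∧ m ≤ b ∧ p m = q k := by
            rcases Sym2.eq_iff.1 hxy with ⟨e, -⟩ | ⟨-, e⟩
            · exact ⟨j, by omega, by omega, e⟩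
            · exact ⟨j + 1, by omega, by omega, e⟩
          have hma : m ≠ a := by rintro rfl; exact hne hm.symm
          have hmb : m ≠ b := by rintro rfl; exact hne (hm.symm.trans habp.symm)
          obtain ⟨l, hl1, hl2, hl⟩ : ∃ l < n, (l ≤ a ∨ b ≤ l) ∧ p l = q k := by
            have h1 := hτ k
            by_cases hl : τ k = n
            · exact ⟨0, hn, by omega, by rw [hqτ, hl, hclosed]⟩
            · exact ⟨τ k, by split_ifs at * <;> omega, by split_ifs at * <;> omega, (hqτ k).symm⟩
          have hla : l ≠ a := by rintro rfl; exact hne hl.symm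
          have hlb : l ≠ b := by rintro rfl; exact hne (hl.symm.trans habp.symm)
          rcases hl2 with hl2 | hl2
          · exact hcross l a m b (by omega) (by omega) (by omega) (by omega) (hl.trans hm.symm) habp
          · exact hcross a m b l (by omega) (by omega) (by omega) (by omega) habp (hm.trans hl.symm)
      -- The removed loop does not enclose `t` strictly, so this vertex survives in `q`.
      · intro t ht hrep0 hsep
        obtain ⟨t', ht', htt, hpt⟩ : ∃ t' < n - (b - a), (t ≤ a ∧ t' = t ∨ b ≤ t ∧ t' + (b - a) = t) ∧
            q t' = p t := by
          rcases hsep a b ha hab hbn habp with h1 | h1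
          · exact ⟨t, by omega, by omega, hq1 t h1⟩
          · refine ⟨t - (b - a), by omega, by omega, ?_⟩
            rw [hq2 _ (by omega), show t - (b - a) + (b - a) = t by omega]
        rw [← hpt]
        refine hC4 t' ht' (fun b' h1 h2 => ?_) fun a' b' h1 h2 h3 e => ?_
        · rw [hq0, hqτ]
          have := hτ b'
          exact hrep0 _ (by split_ifs at * <;> omega) (by split_ifs at * <;> omega)
        · rw [hqτ, hqτ] at e
          have t1 := hτ a'
          have t2 := hτ b'
          have := hsep (τ a') (τ b') (by split_ifs at * <;> omega) (by split_ifs at * <;> omega)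
            (by split_ifs at * <;> omega) e
          split_ifs at * <;> omega
  · push Not at hrep
    have hinj : ∀ i < n, ∀ j < n, p i = p j → i = j := by
      intro i hi j hj e
      rcases lt_trichotomy i j with hlt | heq | hgt
      · exact absurd e (hrep i j hlt hj)
      · exact heq
      · exact absurd e.symm (hrep j i hgt hi)
    -- A closed walk of length two traverses its first edge again on the way back.
    have hn3 : 3 ≤ n := by
      by_contra hlt
      rcases (show n = 1 ∨ n = 2 by omega) with rfl | rfl
      · exact (h 0 (by omega)).ne hclosed.symm
      · refine hsingle 1 (by omega) (by omega) ?_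
        rw [show 1 + 1 = 2 from rfl, hclosed, Sym2.eq_swap]
    refine ⟨seqSubgraph p n h, isCyclic_seqSubgraph h hn3 hclosed hinj, ⟨0, hn, rfl⟩,
      ⟨⟨le_rfl, biconnected_seqSubgraph h hn hclosed hinj⟩, fun D hD _ => hD.1⟩,
      fun t ht _ _ => ⟨t, ht.le, rfl⟩⟩

end Blocks

/-! ### Repeated vertices are cut vertices -/

section Separation

open Relation

variable {V : Type*} {G : SimpleGraph V} {n : ℕ} {c : CyclicWalk G n}

/-- A third visit within a period would give three odd distances, one of them the sum of the other
two. -/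
lemma CyclicWalk.IsPrim.dvd_of_vert_eq (hc : c.IsPrim) {a b : ℤ} (hab : a < b) (hb : b < a + n)
    (h : c.vert a = c.vert b) {i : ℤ} (hi : c.vert i = c.vert a) :
    (n : ℤ) ∣ i - a ∨ (n : ℤ) ∣ i - b := by
  obtain ⟨j, h1, h2, h3⟩ := exists_rep hc.pos a i
  have hj := c.vert_congr h3
  by_cases hja : j = a
  · exact Or.inl (hja ▸ h3)
  by_cases hjb : j = b
  · exact Or.inr (hjb ▸ h3)
  exfalso
  have o1 := hc.odd a b hab hb h
  have o2 := hc.odd a j (by omega) h2 (hi.symm.trans hj)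
  have e : c.vert j = c.vert b := (hj.symm.trans hi).trans h
  rw [Int.odd_iff] at o1 o2
  rcases lt_or_gt_of_ne hjb with hlt | hlt
  · have o3 := hc.odd j b hlt (by omega) e
    rw [Int.odd_iff] at o3
    omega
  · have o3 := hc.odd b j hlt (by omega) e.symm
    rw [Int.odd_iff] at o3
    omega

/-- A vertex which is visited twice separates the two parts of the walk between its visits. -/
lemma CyclicWalk.IsPrim.separates (hc : c.IsPrim) {a b s t : ℤ} (h : c.vert a = c.vert b)
    (has : a < s) (hsb : s < b) (hbt : b < t) (hta : t < a + n) {D : G.Subgraph}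
    (hD : Biconnected D) (hadj : ∀ x y, D.Adj x y → ∃ i, (c.edge i : Sym2 V) = s(x, y))
    (hs : c.vert s ∈ D.verts) (ht : c.vert t ∈ D.verts) : False := by
  have hsz : c.vert s ≠ c.vert a := by
    intro e
    rcases hc.dvd_of_vert_eq (by omega) (by omega) h e with h1 | h1
    · have := dvd_sub_of_window (a := a) (by omega) (by omega) (by omega) (by omega) h1; omega
    · have := dvd_sub_of_window (a := a) (by omega) (by omega) (by omega) (by omega) h1; omega
  have htz : c.vert t ≠ c.vert a := by
    intro e
    rcases hc.dvd_of_vert_eq (by omega) (by omega) h e with h1 | h1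
    · have := dvd_sub_of_window (a := a) (by omega) (by omega) (by omega) (by omega) h1; omega
    · have := dvd_sub_of_window (a := a) (by omega) (by omega) (by omega) (by omega) h1; omega
  -- A path avoiding the repeated vertex keeps to vertices with a visit strictly between `a` and
  -- `b`.
  have key : ∀ y, ReflTransGen (AdjAvoiding D (c.vert a)) (c.vert s) y →
      ∃ r, a < r ∧ r < b ∧ c.vert r = y := by
    intro y hy
    induction hy with
    | refl => exact ⟨s, has, hsb, rfl⟩
    | tail _ hxy ih =>
      rename_i x y _
      obtain ⟨r, hr1, hr2, rfl⟩ := ih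
      obtain ⟨i, hi⟩ := hadj _ _ hxy.1
      -- the position at which the edge leaves the vertex
      obtain ⟨m, d, hd, hm, hmy⟩ : ∃ m d : ℤ, (d = 1 ∨ d = -1) ∧ c.vert m = c.vert r ∧
          c.vert (m + d) = y := by
        rw [c.edge_coe] at hi
        rcases Sym2.eq_iff.1 hi with ⟨e1, e2⟩ | ⟨e1, e2⟩
        · exact ⟨i, 1, Or.inl rfl, e1, e2⟩
        · exact ⟨i + 1, -1, Or.inr rfl, e2, by rw [← e1]; congr 1; ring⟩
      obtain ⟨m', h1, h2, h3⟩ := exists_rep hc.pos a m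
      have hm' : c.vert m' = c.vert r := by rw [← hm, c.vert_congr h3]
      have hmy' : c.vert (m' + d) = y := by
        rw [← hmy]; symm; exact c.vert_congr (by simpa using h3)
      have hma : m' ≠ a := by rintro rfl; exact hxy.2.1 hm'.symm
      have hmb : m' ≠ b := by rintro rfl; exact hxy.2.1 (hm'.symm.trans h.symm)
      have hlt : m' < b := by
        by_contra hlt
        exact hc.noncross a r b m' hr1 hr2 (by omega) h2 h hm'.symm
      have hda : m' + d ≠ a := by intro e; rw [e] at hmy'; exact hxy.2.2 hmy'.symm
      have hdb : m' + d ≠ b := by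
        intro e; rw [e] at hmy'; exact hxy.2.2 (hmy'.symm.trans h.symm)
      exact ⟨m' + d, by omega, by omega, hmy'⟩
  obtain ⟨r, h1, h2, h3⟩ := key _ (((biconnected_iff D).1 hD).2.2 _ _ hs _ ht hsz htz)
  exact hc.noncross a r b t h1 h2 hbt hta h h3

end Separation

/-! ### Blocks and sinks in terms of positions -/

section WalkBlocks

open Relation CyclicWalk

variable {V : Type*} {G : SimpleGraph V}

namespace CyclicWalk

variable {n : ℕ} {c : CyclicWalk G n}

lemma exists_step_of_edge_eq {i : ℤ} {x y : V} (h : (c.edge i : Sym2 V) = s(x, y)) :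
    ∃ m d : ℤ, (d = 1 ∨ d = -1) ∧ c.vert m = x ∧ c.vert (m + d) = y := by
  rw [c.edge_coe] at h
  rcases Sym2.eq_iff.1 h with ⟨e1, e2⟩ | ⟨e1, e2⟩
  · exact ⟨i, 1, Or.inl rfl, e1, e2⟩
  · exact ⟨i + 1, -1, Or.inr rfl, e2, by rw [← e1]; congr 1; ring⟩

/-- The neighbours, in the graph of the walk, of a vertex which is visited twice. -/
lemma IsPrim.neighbor_of_repeated (hc : c.IsPrim) {a b : ℤ} (hab : a < b) (hb : b < a + n)
    (h : c.vert a = c.vert b) {i : ℤ} {y : V} (hi : (c.edge i : Sym2 V) = s(c.vert a, y)) :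
    ∃ d : ℤ, (d = 1 ∨ d = -1) ∧ (y = c.vert (a + d) ∨ y = c.vert (b + d)) := by
  obtain ⟨m, d, hd, hm, hy⟩ := exists_step_of_edge_eq hi
  refine ⟨d, hd, ?_⟩
  rcases hc.dvd_of_vert_eq hab hb h hm with h1 | h1
  · exact Or.inl (by rw [← hy]; exact c.vert_congr (by simpa using h1))
  · exact Or.inr (by rw [← hy]; exact c.vert_congr (by simpa using h1))

lemma dvd_of_vert_eq_of_forall_ne {s : ℤ} (hn : 0 < n)
    (hs : ∀ r, s < r → r < s + n → c.vert s ≠ c.vert r) {m : ℤ} (hm : c.vert m = c.vert s) :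
    (n : ℤ) ∣ m - s := by
  obtain ⟨j, h1, h2, h3⟩ := exists_rep hn s m
  rcases h1.lt_or_eq with h1 | rfl
  · exact absurd (hm.symm.trans (c.vert_congr h3)) (hs j h1 h2)
  · exact h3

/-- The neighbours, in the graph of the walk, of a vertex which is visited once. -/
lemma neighbor_of_forall_ne {s : ℤ} (hn : 0 < n)
    (hs : ∀ r, s < r → r < s + n → c.vert s ≠ c.vert r) {i : ℤ} {y : V}
    (hi : (c.edge i : Sym2 V) = s(c.vert s, y)) : y = c.vert (s + 1) ∨ y = c.vert (s - 1) := by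
  obtain ⟨m, d, hd, hm, hy⟩ := exists_step_of_edge_eq hi
  have h1 := dvd_of_vert_eq_of_forall_ne hn hs hm
  rcases hd with rfl | rfl
  · exact Or.inl (by rw [← hy]; exact c.vert_congr (by simpa using h1))
  · exact Or.inr (by rw [← hy]; exact c.vert_congr (by simpa [sub_eq_add_neg] using h1))

lemma exists_repeat_of_not_dvd (hn : 0 < n) {s p q : ℤ} (hp : c.vert p = c.vert s)
    (hq : c.vert q = c.vert s) (hpq : ¬ (n : ℤ) ∣ p - q) :
    ∃ r, s < r ∧ r < s + n ∧ c.vert s = c.vert r := by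
  by_contra! h
  have h1 := dvd_of_vert_eq_of_forall_ne hn h hp
  have h2 := dvd_of_vert_eq_of_forall_ne hn h hq
  exact hpq (by simpa using dvd_sub h1 h2)

lemma IsPrim.even_cast (hc : c.IsPrim) : Even (n : ℤ) := by exact_mod_cast hc.even

lemma IsPrim.even_of_edge_eq (hc : c.IsPrim) {i j : ℤ} (h : c.edge i = c.edge j) :
    Even (i - j) := by
  rw [← Int.not_odd_iff_even]
  exact fun ho => hc.disj i j ho h

end CyclicWalk

lemma IsCyclic.exists_adj_ne {C : G.Subgraph} (hC : ToricGraph.IsCyclic C) {x : V}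
    (hx : x ∈ C.verts) (y : V) : ∃ y', y' ≠ y ∧ C.Adj x y' := by
  obtain ⟨u, p, hp, rfl⟩ := hC
  have h2 := hp.ncard_neighborSet_toSubgraph_eq_two ((p.mem_verts_toSubgraph).1 hx)
  obtain ⟨a, b, hab, hs⟩ := Set.ncard_eq_two.1 h2
  by_cases ha : a = y
  · refine ⟨b, fun h => hab (ha.trans h.symm), ?_⟩
    have : b ∈ p.toSubgraph.neighborSet x := by rw [hs]; simp
    exact this
  · refine ⟨a, ha, ?_⟩
    have : a ∈ p.toSubgraph.neighborSet x := by rw [hs]; simp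
    exact this

variable {u : V} {w : G.Walk u u} {hpos : 0 < w.length}

lemma IsBlock.exists_edge_eq {B : G.Subgraph} (hB : IsBlock w B) :
    ∀ x y, B.Adj x y → ∃ i, ((ofWalk w hpos).edge i : Sym2 V) = s(x, y) :=
  fun x y hxy => (toSubgraph_adj_iff_exists x y).1 (hB.1.1.2 hxy)

lemma toSubgraph_eq_seqSubgraph_shift (i : ℤ) :
    w.toSubgraph = seqSubgraph (fun k => (ofWalk w hpos).vert (i + k)) w.length
      (fun k _ => by
        have := (ofWalk w hpos).adj (i + k)
        rw [add_assoc] at this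
        exact_mod_cast this) := by
  ext x y
  · rw [SimpleGraph.Walk.mem_verts_toSubgraph, mem_support_iff_exists (hpos := hpos)]
    constructor
    · rintro ⟨j, rfl⟩
      obtain ⟨k, h1, h2, h3⟩ := exists_rep hpos i j
      refine ⟨(k - i).toNat, by omega, ?_⟩
      have e : i + ((k - i).toNat : ℤ) = k := by omega
      dsimp only
      rw [vert_congr _ h3, e]
    · rintro ⟨k, -, rfl⟩
      exact ⟨_, rfl⟩
  · rw [toSubgraph_adj_iff_exists (hpos := hpos)]
    constructor
    · rintro ⟨j, hj⟩
      obtain ⟨k, h1, h2, h3⟩ := exists_rep hpos i j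
      refine ⟨(k - i).toNat, by omega, ?_⟩
      rw [← hj, edge_congr _ h3, edge_coe]
      have e : i + ((k - i).toNat : ℤ) = k := by omega
      push_cast
      rw [← add_assoc, e]
    · rintro ⟨k, -, h⟩
      refine ⟨i + k, ?_⟩
      rw [← h, edge_coe]
      push_cast
      rw [add_assoc]

/-- An edge which the walk traverses only once lies in a cyclic block. -/
lemma CyclicWalk.IsPrim.exists_block (hc : (ofWalk w hpos).IsPrim) (i : ℤ)
    (hsingle : ∀ j, ¬ (w.length : ℤ) ∣ j - i → (ofWalk w hpos).edge j ≠ (ofWalk w hpos).edge i) :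
    ∃ C : G.Subgraph, ToricGraph.IsCyclic C ∧
      C.Adj ((ofWalk w hpos).vert i) ((ofWalk w hpos).vert (i + 1)) ∧ IsBlock w C ∧
      ∀ t, i ≤ t → t < i + w.length →
        (∀ b, i < b → b < i + w.length → (ofWalk w hpos).vert i ≠ (ofWalk w hpos).vert b) →
        (∀ a b, i < a → a < b → b < i + w.length →
          (ofWalk w hpos).vert a = (ofWalk w hpos).vert b → t ≤ a ∨ b ≤ t) →
        (ofWalk w hpos).vert t ∈ C.verts := by
  obtain ⟨C, h1, h2, h3, h4⟩ := exists_cyclic_block w.length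
    (fun k => (ofWalk w hpos).vert (i + k)) (fun k _ => by
        have := (ofWalk w hpos).adj (i + k)
        rw [add_assoc] at this
        exact_mod_cast this) hpos (by simp [(ofWalk w hpos).per])
    (fun x y z hxy hyz hz e1 e2 => by
      have o1 := hc.odd (i + x) (i + y) (by omega) (by omega) e1
      have o2 := hc.odd (i + y) (i + z) (by omega) (by omega) e2
      have o3 := hc.odd (i + x) (i + z) (by omega) (by omega) (e1.trans e2)
      rw [Int.odd_iff] at o1 o2 o3
      omega)
    (fun x y z t hxy hyz hzt ht e1 e2 => hc.noncross (i + x) (i + y) (i + z) (i + t) (by omega)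
      (by omega) (by omega) (by omega) e1 e2)
    (fun j hj0 hj e => by
      refine hsingle (i + j) (fun hd => ?_) (Subtype.ext ?_)
      · have := dvd_sub_of_window (a := i) (by omega) (by omega) (by omega) (by omega) hd
        omega
      · rw [edge_coe, edge_coe]
        push_cast at e
        rw [← add_assoc] at e
        simpa using e)
  refine ⟨C, h1, by simpa using h2, ?_, ?_⟩
  · rw [IsBlock, toSubgraph_eq_seqSubgraph_shift (hpos := hpos) i]
    exact h3
  · intro t ht1 ht2 hrep hsep
    have := h4 (t - i).toNat (by omega) (fun b hb1 hb2 => by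
      simpa using hrep (i + b) (by omega) (by omega)) (fun a b ha hab hb e => by
      have := hsep (i + a) (i + b) (by omega) (by omega) (by omega) e
      omega)
    have e : i + ((t - i).toNat : ℤ) = t := by omega
    simpa only [e] using this

lemma isSink_of_edges (hc : (ofWalk w hpos).IsPrim) {B : G.Subgraph} {x : V} {i j : ℤ}
    (hpar : Even (i - j)) (hne : (ofWalk w hpos).edge i ≠ (ofWalk w hpos).edge j)
    (hi : ((ofWalk w hpos).edge i : Sym2 V) ∈ B.edgeSet)
    (hj : ((ofWalk w hpos).edge j : Sym2 V) ∈ B.edgeSet)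
    (hxi : x ∈ ((ofWalk w hpos).edge i : Sym2 V)) (hxj : x ∈ ((ofWalk w hpos).edge j : Sym2 V)) :
    IsSink w B x := by
  obtain ⟨k, ⟨a, hk⟩, hek, -⟩ := exists_fin (hpos := hpos) i
  obtain ⟨l, ⟨b, hl⟩, hel, -⟩ := exists_fin (hpos := hpos) j
  refine ⟨k, l, ?_, ?_, hek ▸ hi, hel ▸ hj, hek ▸ hxi, hel ▸ hxj⟩
  · rintro rfl; exact hne (hek.trans hel.symm)
  · have ha : Even ((w.length : ℤ) * a) := hc.even_cast.mul_right _
    have hb : Even ((w.length : ℤ) * b) := hc.even_cast.mul_right _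
    rw [Int.even_iff] at ha hb hpar
    rw [Nat.even_iff, Nat.even_iff]
    omega

/-- In a strongly primitive walk, the endpoints of an edge which is traversed only once are not
both visited twice. -/
lemma CyclicWalk.IsPrim.not_isStronglyPrimitive (hc : (ofWalk w hpos).IsPrim) {i r k : ℤ}
    (hsingle : ∀ j, ¬ (w.length : ℤ) ∣ j - i → (ofWalk w hpos).edge j ≠ (ofWalk w hpos).edge i)
    (hir : i < r) (hr : r < i + w.length)
    (hvr : (ofWalk w hpos).vert i = (ofWalk w hpos).vert r)
    (hik : i + 1 < k) (hk : k < i + 1 + w.length)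
    (hvk : (ofWalk w hpos).vert (i + 1) = (ofWalk w hpos).vert k) :
    ¬ IsStronglyPrimitive w := by
  obtain ⟨C, h1, h2, h3, -⟩ := hc.exists_block i hsingle
  generalize hcw : ofWalk w hpos = c at *
  have hadj := h3.exists_edge_eq (hpos := hpos)
  rw [hcw] at hadj
  have hsep := fun a b s t h ha hb hb' ht hs ht' =>
    hc.separates (a := a) (b := b) (s := s) (t := t) h ha hb hb' ht h3.1.2 hadj hs ht'
  have hr1 : r ≠ i + 1 := by rintro rfl; exact c.vert_ne i hvr
  have hrn : r + 1 ≠ i + w.length := by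
    intro e
    refine c.vert_ne r ?_
    rw [e, c.per, hvr]
  have hk1 : k ≠ i + 1 + 1 := by rintro rfl; exact c.vert_ne (i + 1) hvk
  have hkn : k ≠ i + w.length := by
    rintro rfl; rw [c.per] at hvk; exact c.vert_ne i hvk.symm
  have hrodd := hc.odd i r hir hr hvr
  have hkodd := hc.odd (i + 1) k hik hk hvk
  have hin : c.vert (i + w.length) = c.vert i := c.per i
  have hx := C.edge_vert h2
  have hy := C.edge_vert h2.symm
  intro hsp
  refine hsp.2 ⟨C, c.vert i, c.vert (i + 1), h3, h1, h2, ?_, ?_⟩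
  -- The cycle has a second edge at `vert i`. Of the walk neighbours of this vertex, those at `i -
  -- 1` and `r + 1` are separated by it from `vert (i + 1)`, so only `r - 1` remains. As `r - i` is
  -- odd, the edges `i` and `r - 1` have the same parity and make a sink.
  · obtain ⟨y', hy', hCy'⟩ := h1.exists_adj_ne hx (c.vert (i + 1))
    obtain ⟨j, hj⟩ := hadj _ _ hCy'
    have hy'C := C.edge_vert hCy'.symm
    obtain ⟨d, hd, hyd⟩ := hc.neighbor_of_repeated hir hr hvr hj
    have hyr : y' = c.vert (r - 1) := by
      rcases hd with rfl | rfl <;> rcases hyd with rfl | rfl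
      · exact absurd rfl hy'
      · exact (hsep i r (i + 1) (r + 1) hvr (by omega) (by omega) (by omega) (by omega) hy
          hy'C).elim
      · refine (hsep i r (i + 1) (i + -1 + w.length) hvr (by omega) (by omega) (by omega)
          (by omega) hy ?_).elim
        rw [c.per]; exact hy'C
      · rfl
    subst hyr
    have he : (c.edge (r - 1) : Sym2 V) = s(c.vert i, c.vert (r - 1)) := by
      rw [c.edge_coe, sub_add_cancel, ← hvr, Sym2.eq_swap]
    have := isSink_of_edges (hpos := hpos) (w := w) (B := C) (x := c.vert i) (i := i) (j := r - 1)
    rw [hcw] at this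
    refine this hc ?_ ?_ h2 (by rw [he]; exact hCy') (by rw [c.edge_coe]; simp) (by rw [he]; simp)
    · rw [Int.odd_iff] at hrodd
      rw [Int.even_iff]; omega
    · intro e
      have e' := congrArg Subtype.val e
      rw [he, c.edge_coe, Sym2.congr_right] at e'
      exact hy' e'.symm
  · obtain ⟨y', hy', hCy'⟩ := h1.exists_adj_ne hy (c.vert i)
    obtain ⟨j, hj⟩ := hadj _ _ hCy'
    have hy'C := C.edge_vert hCy'.symm
    obtain ⟨d, hd, hyd⟩ := hc.neighbor_of_repeated hik hk hvk hj
    have hxn : c.vert (i + w.length) ∈ C.verts := by rw [hin]; exact hx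
    have hyr : y' = c.vert (k + 1) := by
      -- The second visit of `vert (i + 1)` must precede the return to `vert i`. By the same
      -- separation argument the second edge of the cycle at `vert (i + 1)` is then the edge `k`.
      have hkn' : k < i + w.length := by
        have := hc.noncross i (i + 1) r k (by omega) (by omega)
        by_contra hlt
        omega
      rcases hd with rfl | rfl <;> rcases hyd with rfl | rfl
      · exact (hsep (i + 1) k (i + 1 + 1) (i + w.length) hvk (by omega) (by omega) (by omega)
          (by omega) hy'C hxn).elim
      · rfl
      · exact absurd (by congr 1; ring) hy'
      · exact (hsep (i + 1) k (k + -1) (i + w.length) hvk (by omega) (by omega) (by omega)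
          (by omega) hy'C hxn).elim
    subst hyr
    have he : (c.edge k : Sym2 V) = s(c.vert (i + 1), c.vert (k + 1)) := by
      rw [c.edge_coe, ← hvk]
    have := isSink_of_edges (hpos := hpos) (w := w) (B := C) (x := c.vert (i + 1)) (i := i) (j := k)
    rw [hcw] at this
    refine this hc ?_ ?_ h2 (by rw [he]; exact hCy') (by rw [c.edge_coe]; simp) (by rw [he]; simp)
    · rw [Int.odd_iff] at hkodd
      rw [Int.even_iff]; omega
    · intro e
      have e' := congrArg Subtype.val e
      rw [he, c.edge_coe, Sym2.eq_swap, Sym2.congr_right] at e'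
      exact hy' e'.symm

/-- One edge is biconnected, and finiteness of `V` provides a maximal biconnected subgraph above it.
-/
lemma exists_block_of_position [Finite V] (i : ℤ) :
    ∃ B, IsBlock w B ∧ (ofWalk w hpos).vert i ∈ B.verts ∧ (ofWalk w hpos).vert (i + 1) ∈ B.verts := by
  have hadj := (ofWalk w hpos).adj i
  have hle : G.subgraphOfAdj hadj ≤ w.toSubgraph :=
    SimpleGraph.subgraphOfAdj_le_of_adj _ ((toSubgraph_adj_iff_exists _ _).2 ⟨i, rfl⟩)
  obtain ⟨B, hB1, hB2⟩ := Finite.exists_le_maximal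
    (p := fun C : G.Subgraph => C ≤ w.toSubgraph ∧ Biconnected C)
    (a := G.subgraphOfAdj hadj) ⟨hle, biconnected_subgraphOfAdj hadj⟩
  exact ⟨B, hB2, hB1.1 (by simp), hB1.1 (by simp)⟩

/-! ### Bridges, and vertices visited once -/

section Bridges

/-- The endpoints of a chord which is not a bridge are visited only once. -/
lemma CyclicWalk.IsPrim.vert_ne_of_not_isBridgeChord (hc : (ofWalk w hpos).IsPrim)
    [Finite V] {f : Sym2 V} (hf : IsChord w f)
    (hb : ¬ IsBridgeChord w f) {s : ℤ} (hs : (ofWalk w hpos).vert s ∈ f) (r : ℤ) (hsr : s < r)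
    (hr : r < s + w.length) : (ofWalk w hpos).vert s ≠ (ofWalk w hpos).vert r := by
  intro h
  obtain ⟨y, rfl⟩ := hs
  obtain ⟨t, rfl⟩ := (mem_support_iff_exists (hpos := hpos) y).1 (hf.2.1 y (by simp))
  obtain ⟨B, hB, hB1, hB2⟩ := exists_block_of_position (hpos := hpos) (w := w) s
  obtain ⟨B', hB', hB1', hB2'⟩ := exists_block_of_position (hpos := hpos) (w := w) r
  obtain ⟨C, hC, hC1, -⟩ := exists_block_of_position (hpos := hpos) (w := w) t
  -- The edges leaving the two visits lie on different sides of the cut vertex, so no block contains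
  -- both. The block `C` of the other end differs from one of the two, which makes the chord a
  -- bridge.
  have hne : B ≠ B' := by
    rintro rfl
    have h1 : r ≠ s + 1 := by rintro rfl; exact vert_ne _ s h
    have h2 : r + 1 ≠ s + w.length := by
      intro e
      refine vert_ne (ofWalk w hpos) r ?_
      rw [e, per, h]
    exact hc.separates h (show s < s + 1 by omega) (by omega) (show r < r + 1 by omega) (by omega)
      hB.1.2 hB.exists_edge_eq hB2 hB2'
  by_cases hCB : B = C
  · exact hb ⟨hf, _, _, B', C, rfl, hB', hC, by rw [← hCB]; exact hne.symm, h ▸ hB1', hC1⟩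
  · exact hb ⟨hf, _, _, B, C, rfl, hB, hC, hCB, hB1, hC1⟩

/-- A vertex which is visited twice does not separate the endpoints of a chord which is not a
bridge. -/
lemma CyclicWalk.IsPrim.vert_ne_of_separates (hc : (ofWalk w hpos).IsPrim)
    [Finite V] {s t : ℤ}
    (hf : IsChord w s((ofWalk w hpos).vert s, (ofWalk w hpos).vert t))
    (hb : ¬ IsBridgeChord w s((ofWalk w hpos).vert s, (ofWalk w hpos).vert t)) {a b : ℤ}
    (has : a < s) (hsb : s < b) (hbt : b < t) (hta : t < a + w.length) :
    (ofWalk w hpos).vert a ≠ (ofWalk w hpos).vert b := by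
  intro h
  obtain ⟨B, hB, hB1, -⟩ := exists_block_of_position (hpos := hpos) (w := w) s
  obtain ⟨C, hC, hC1, -⟩ := exists_block_of_position (hpos := hpos) (w := w) t
  refine hb ⟨hf, _, _, B, C, rfl, hB, hC, ?_, hB1, hC1⟩
  rintro rfl
  exact hc.separates h has hsb hbt hta hB.1.2 hB.exists_edge_eq hB1 hC1

/-- A vertex which is visited only once lies in only one block, if it lies in a cyclic block. -/
lemma isBlock_unique_of_isCyclic {s : ℤ}
    (hs : ∀ r, s < r → r < s + w.length → (ofWalk w hpos).vert s ≠ (ofWalk w hpos).vert r)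
    {B C : G.Subgraph} (hB : IsBlock w B) (hC : IsBlock w C) (hcyc : ToricGraph.IsCyclic C)
    (hsB : (ofWalk w hpos).vert s ∈ B.verts) (hsC : (ofWalk w hpos).vert s ∈ C.verts) : B = C := by
  -- A block is not a single vertex, as a walk edge at this vertex is a larger biconnected subgraph.
  obtain ⟨y, hy⟩ : ∃ y, B.Adj ((ofWalk w hpos).vert s) y := by
    by_contra! hno
    have hBv : ∀ y ∈ B.verts, y = (ofWalk w hpos).vert s := by
      intro y hy
      rcases ReflTransGen.cases_head (((biconnected_iff B).1 hB.1.2).2.1 _ hsB y hy) with h | ⟨b, h, -⟩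
      · exact h.symm
      · exact absurd h (hno b)
    have hadj := (ofWalk w hpos).adj s
    have hle : B ≤ G.subgraphOfAdj hadj := by
      refine ⟨fun y hy => by simp [hBv y hy], fun a b hab => ?_⟩
      exact absurd ((hBv a (B.edge_vert hab)).trans (hBv b (B.edge_vert hab.symm)).symm) hab.ne
    have h2 := hB.2 ⟨SimpleGraph.subgraphOfAdj_le_of_adj _
      ((toSubgraph_adj_iff_exists _ _).2 ⟨s, rfl⟩), biconnected_subgraphOfAdj hadj⟩ hle
    exact hadj.ne (hBv _ (h2.1 (by simp))).symm
  -- A vertex visited once has at most two neighbours in the graph of the walk, and the cycle `C`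
  -- uses both. So `B` and `C` share two vertices, and their union is biconnected.
  have hCadj : C.Adj ((ofWalk w hpos).vert s) y := by
    obtain ⟨i, hi⟩ := hB.exists_edge_eq (hpos := hpos) _ _ hy
    obtain ⟨y1, hy1, hC1⟩ := hcyc.exists_adj_ne hsC y
    obtain ⟨y2, hy2, hC2⟩ := hcyc.exists_adj_ne hsC y1
    obtain ⟨i1, hi1⟩ := hC.exists_edge_eq (hpos := hpos) _ _ hC1
    obtain ⟨i2, hi2⟩ := hC.exists_edge_eq (hpos := hpos) _ _ hC2
    have n0 := neighbor_of_forall_ne hpos hs hi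
    have n1 := neighbor_of_forall_ne hpos hs hi1
    have n2 := neighbor_of_forall_ne hpos hs hi2
    have : y = y2 := by grind
    rw [this]; exact hC2
  have hsup := hB.1.2.sup hC.1.2 hy.ne hsB (B.edge_vert hy.symm) hsC (C.edge_vert hCadj.symm)
  have hle : B ⊔ C ≤ w.toSubgraph := sup_le hB.1.1 hC.1.1
  exact le_antisymm (le_sup_left.trans (hC.2 ⟨hle, hsup⟩ le_sup_right))
    (le_sup_right.trans (hB.2 ⟨hle, hsup⟩ le_sup_left))

/-- Two vertices which are visited once, and which no vertex which is visited twice separates, do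
not lie in different blocks. -/
lemma CyclicWalk.IsPrim.isBlock_eq (hc : (ofWalk w hpos).IsPrim)
    {s t : ℤ} (hst : s ≤ t) (htn : t < s + w.length)
    (hs : ∀ r, s < r → r < s + w.length → (ofWalk w hpos).vert s ≠ (ofWalk w hpos).vert r)
    (ht : ∀ r, t < r → r < t + w.length → (ofWalk w hpos).vert t ≠ (ofWalk w hpos).vert r)
    (hsep : ∀ a b, a < s → s < b → b < t → t < a + w.length →
      (ofWalk w hpos).vert a ≠ (ofWalk w hpos).vert b)
    {B C : G.Subgraph} (hB : IsBlock w B) (hC : IsBlock w C)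
    (hsB : (ofWalk w hpos).vert s ∈ B.verts) (htC : (ofWalk w hpos).vert t ∈ C.verts) : B = C := by
  -- The edge leaving `s` is traversed once, so it lies in a cyclic block `D`. Nothing separates `t`
  -- from `s`, so `D` contains `t` as well, and both blocks are equal to `D`.
  obtain ⟨D, h1, h2, h3, h4⟩ := hc.exists_block s fun j hj e => by
    have hpar := hc.even_of_edge_eq e
    have e' := congrArg Subtype.val e
    rw [edge_coe, edge_coe] at e'
    rcases Sym2.eq_iff.1 e' with ⟨e1, -⟩ | ⟨-, e2⟩
    · exact hj (dvd_of_vert_eq_of_forall_ne hpos hs e1)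
    · obtain ⟨k, hk⟩ := dvd_of_vert_eq_of_forall_ne hpos hs e2
      have hk' : Even ((w.length : ℤ) * k) := hc.even_cast.mul_right _
      rw [Int.even_iff] at hk' hpar
      omega
  have hsD := D.edge_vert h2
  have htD := h4 t hst htn hs fun a b ha hab hb e => by
    by_contra! hlt
    refine hsep (b - w.length) a (by omega) ha hlt.1 (by omega) ?_
    have := per (ofWalk w hpos) (b - w.length)
    rw [sub_add_cancel] at this
    rw [← this, e]
  rw [isBlock_unique_of_isCyclic hs hB h3 h1 hsB hsD, isBlock_unique_of_isCyclic ht hC h3 h1 htC htD]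

/-- The edges of a cyclic block are traversed only once. -/
lemma CyclicWalk.IsPrim.edge_ne_of_isCyclic (hc : (ofWalk w hpos).IsPrim)
    {B : G.Subgraph} (hB : IsBlock w B)
    (hcyc : ToricGraph.IsCyclic B) {i : ℤ}
    (hi : B.Adj ((ofWalk w hpos).vert i) ((ofWalk w hpos).vert (i + 1))) (j : ℤ)
    (hj : ¬ (w.length : ℤ) ∣ j - i) : (ofWalk w hpos).edge j ≠ (ofWalk w hpos).edge i := by
  intro e
  have hadj := hB.exists_edge_eq (hpos := hpos)
  generalize hcw : ofWalk w hpos = c at *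
  obtain ⟨j', h1, h2, h3⟩ := exists_rep hpos i j
  have hji : j' ≠ i := by rintro rfl; exact hj h3
  rw [c.edge_congr h3] at e
  clear hj h3
  have hpar := hc.even_of_edge_eq e
  have hn := hc.even_cast
  have e' := congrArg Subtype.val e
  rw [edge_coe, edge_coe] at e'
  rcases Sym2.eq_iff.1 e' with ⟨e1, -⟩ | ⟨e1, e2⟩
  · have := hc.odd i j' (by omega) h2 e1.symm
    rw [Int.odd_iff] at this
    rw [Int.even_iff] at hpar
    omega
  · rw [Int.even_iff] at hpar hn
    have hjn : j' + 1 < i + w.length := by omega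
    have hjn' : j' + 1 + 1 ≠ i + w.length := by
      intro e
      refine c.vert_ne (j' + 1) ?_
      rw [e, c.per, e2]
    -- Here the edge is traversed in both directions. Of the four walk neighbours of `vert i` two
    -- are `vert (i + 1)`, and the other two are separated from it, so the cycle has no second edge
    -- at `vert i`.
    obtain ⟨y, hy, hBy⟩ := hcyc.exists_adj_ne (B.edge_vert hi) (c.vert (i + 1))
    obtain ⟨k, hk⟩ := hadj _ _ hBy
    have hyB := B.edge_vert hBy.symm
    obtain ⟨d, hd, hyd⟩ := hc.neighbor_of_repeated (show i < j' + 1 by omega) hjn e2.symm hk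
    have hsep := fun t h1 h2 h3 => hc.separates e2.symm (show i < i + 1 by omega)
      (show i + 1 < j' + 1 by omega) (t := t) h1 h2 hB.1.2 hadj (B.edge_vert hi.symm) h3
    rcases hd with rfl | rfl <;> rcases hyd with rfl | rfl
    · exact hy rfl
    · exact hsep _ (by omega) (by omega) hyB
    · exact hsep (i + -1 + w.length) (by omega) (by omega) (by rwa [c.per])
    · refine hy ?_
      rw [← e1]; congr 1; ring

/-- A sink is visited twice. -/
lemma CyclicWalk.IsPrim.exists_repeat_of_isSink (hc : (ofWalk w hpos).IsPrim)
    {B : G.Subgraph} {s : ℤ}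
    (hs : IsSink w B ((ofWalk w hpos).vert s)) :
    ∃ r, s < r ∧ r < s + w.length ∧ (ofWalk w hpos).vert s = (ofWalk w hpos).vert r := by
  obtain ⟨i, j, hij, hpar, -, -, hi, hj⟩ := hs
  rw [← ofWalk_edge (hpos := hpos), edge_coe, Sym2.mem_iff] at hi hj
  obtain ⟨p, hp, hpv⟩ : ∃ p : ℤ, (p = (i : ℕ) ∨ p = (i : ℕ) + 1) ∧
      (ofWalk w hpos).vert p = (ofWalk w hpos).vert s :=
    hi.elim (fun h => ⟨_, Or.inl rfl, h.symm⟩) fun h => ⟨_, Or.inr rfl, h.symm⟩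
  obtain ⟨q, hq, hqv⟩ : ∃ q : ℤ, (q = (j : ℕ) ∨ q = (j : ℕ) + 1) ∧
      (ofWalk w hpos).vert q = (ofWalk w hpos).vert s :=
    hj.elim (fun h => ⟨_, Or.inl rfl, h.symm⟩) fun h => ⟨_, Or.inr rfl, h.symm⟩
  -- If the two visits agree modulo the even period, the equal parities of `i` and `j` force equal
  -- offsets, hence `i = j`.
  refine exists_repeat_of_not_dvd hpos hpv hqv fun hd => hij (Fin.ext ?_)
  obtain ⟨k, hk⟩ := hd
  have hk' : Even ((w.length : ℤ) * k) := hc.even_cast.mul_right _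
  have h2 : p - q = ((i : ℕ) : ℤ) - (j : ℕ) := by
    rw [Int.even_iff] at hk'
    rw [Nat.even_iff, Nat.even_iff] at hpar
    omega
  have := dvd_sub_of_window (n := w.length) (a := 0) (i := (i : ℕ)) (j := (j : ℕ)) (by omega)
    (by omega) (by omega) (by omega) ⟨k, by rw [← h2, hk]⟩
  exact_mod_cast this

end Bridges

end WalkBlocks

/-! ### Switches that connect the two monomials -/

section Switches

namespace CyclicWalk

variable {V : Type*} {G : SimpleGraph V} {n : ℕ} {c : CyclicWalk G n}

/-- On an arc of odd length, switching away from the parity of its end edges frees both ends,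
exactly the degree of a chord between them. On an even arc it moves one unit of degree from one end
to the other. -/
lemma deg_seg_odd (c : CyclicWalk G n) {ε i j : ℤ} (hij : i ≤ j) (hi : Even (i + ε))
    (hj : Odd (j + ε)) : deg (c.seg ε i j) =
      deg (c.seg (ε + 1) i j) + Finsupp.single (c.vert i) 1 + Finsupp.single (c.vert j) 1 := by
  have := c.deg_seg ε hij
  rw [sgn_even hi, sgn_odd hj] at this
  rw [one_smul, neg_smul, one_smul, ← sub_eq_add_neg] at this
  rw [← this, sub_add_cancel]

lemma deg_seg_even (c : CyclicWalk G n) {ε i j : ℤ} (hij : i ≤ j) (hi : Even (i + ε))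
    (hj : Even (j + ε)) : deg (c.seg ε i j) + Finsupp.single (c.vert j) 1 =
      deg (c.seg (ε + 1) i j) + Finsupp.single (c.vert i) 1 := by
  have := c.deg_seg ε hij
  rwa [sgn_even hi, sgn_even hj, one_smul, one_smul] at this

lemma deg_seg_even' (c : CyclicWalk G n) {ε i j : ℤ} (hij : i ≤ j) (hi : Odd (i + ε))
    (hj : Odd (j + ε)) : deg (c.seg ε i j) + Finsupp.single (c.vert i) 1 =
      deg (c.seg (ε + 1) i j) + Finsupp.single (c.vert j) 1 := by
  have := c.deg_seg ε hij
  rw [sgn_odd hi, sgn_odd hj] at this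
  simp only [neg_smul, one_smul] at this
  rw [← sub_eq_add_neg, ← sub_eq_add_neg, sub_eq_sub_iff_add_eq_add] at this
  exact this

/-- The products of the odd and of the even edges of a cyclic walk are not connected. -/
def NotConn (c : CyclicWalk G n) : Prop := ¬ Conn (c.seg 0 0 n) (c.seg 1 0 n)

lemma NotConn.add_one (hn : c.NotConn) (ε : ℤ) : ¬ Conn (c.seg ε 0 n) (c.seg (ε + 1) 0 n) := by
  rcases Int.even_or_odd ε with h | h
  · rw [c.seg_congr (ε := ε) (ε' := 0) (by simpa using h),
      c.seg_congr (ε := ε + 1) (ε' := 1) (by grind)]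
    exact hn
  · rw [c.seg_congr (ε := ε) (ε' := 1) (by grind), c.seg_congr (ε := ε + 1) (ε' := 0) (by grind)]
    exact fun h => hn h.symm

lemma deg_seg_add_one (heven : Even n) (ε : ℤ) :
    deg (c.seg (ε + 1) 0 n) = deg (c.seg ε 0 n) := by
  rcases Int.even_or_odd ε with h | h
  · rw [c.seg_congr (ε := ε) (ε' := 0) (by simpa using h), c.seg_congr (ε := ε + 1) (ε' := 1) (by grind)]
    exact (c.deg_seg_period heven).symm
  · rw [c.seg_congr (ε := ε) (ε' := 1) (by grind), c.seg_congr (ε := ε + 1) (ε' := 0) (by grind)]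
    exact c.deg_seg_period heven

lemma linked_seg (hpos : 0 < n) (heven : Even n) {ε : ℤ} {M : G.edgeSet →₀ ℕ}
    (hM : deg M = deg (c.seg ε 0 n)) {k : ℤ} (hk : Even (k + ε)) (hkM : 0 < M (c.edge k)) :
    Linked (c.seg ε 0 n) M := by
  refine ⟨hM.symm, c.edge k, ?_, hkM⟩
  rw [← c.seg_period heven ε k]
  exact c.seg_pos k le_rfl (by omega) hk

/-- The chain is the product of the edges of one parity, `M`, `M'`, the product of the others; the
three links are the edge `k`, `e` and the edge `l`. -/
lemma NotConn.false_of_two (hn : c.NotConn) (hpos : 0 < n) (heven : Even n) (ε : ℤ)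
    {M M' : G.edgeSet →₀ ℕ} (hM : deg M = deg (c.seg ε 0 n)) {k : ℤ} (hk : Even (k + ε))
    (hkM : 0 < M (c.edge k)) (hM' : deg M' = deg M) (e : G.edgeSet) (he : 0 < M e) (he' : 0 < M' e)
    {l : ℤ} (hl : Odd (l + ε)) (hlM : 0 < M' (c.edge l)) : False := by
  refine hn.add_one ε ((Relation.ReflTransGen.single (linked_seg hpos heven hM hk hkM)).tail
    (⟨hM'.symm, e, he, he'⟩ : Linked M M') |>.tail ?_)
  exact (linked_seg hpos heven (by rw [hM', hM, deg_seg_add_one heven]) (by grind) hlM).symm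

lemma NotConn.false_of_one (hn : c.NotConn) (hpos : 0 < n) (heven : Even n) (ε : ℤ)
    {M : G.edgeSet →₀ ℕ} (hM : deg M = deg (c.seg ε 0 n)) {k : ℤ} (hk : Even (k + ε))
    (hkM : 0 < M (c.edge k)) {l : ℤ} (hl : Odd (l + ε)) (hlM : 0 < M (c.edge l)) : False :=
  hn.false_of_two hpos heven ε hM hk hkM rfl (c.edge k) hkM hkM hl hlM

variable (hn : c.NotConn) (hpos : 0 < n) (heven : Even n)

/-- A chord which breaks the walk into two even walks connects its two monomials. -/
lemma NotConn.false_of_even_chord (hn : c.NotConn) (hpos : 0 < n) (heven : Even n) {i j : ℤ}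
    (hij : i < j) (hj : j < i + n) (hodd : Odd (j - i)) (f : G.edgeSet)
    (hf : (f : Sym2 V) = s(c.vert i, c.vert j)) (hne : ∀ k, c.edge k ≠ f) : False := by
  have hn2 : Even (n : ℤ) := by exact_mod_cast heven
  have hji : j ≠ i + 1 := by
    rintro rfl; exact hne i (Subtype.ext hf.symm)
  have hjn : j + 1 ≠ i + n := by
    intro e
    refine hne j (Subtype.ext ?_)
    rw [hf, edge_coe, e, c.per, Sym2.eq_swap]
  -- The chord pays for the ends of the switched arc from `i` to `j`. Neither arc is a single edge,
  -- so edges of both parities remain.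
  refine hn.false_of_one hpos heven i
    (M := Finsupp.single f 1 + c.seg (i + 1) i j + c.seg i j (i + n)) (k := j + 1) (l := i + 1)
    ?_ (by grind) ?_ (by grind) ?_
  · rw [← c.seg_period heven i i, c.seg_add i hij.le hj.le, deg_add, deg_add, deg_add,
      c.deg_seg_odd (ε := i) hij.le (by grind) (by grind), deg_single, hf, one_smul, edgeVec_mk]
    abel
  · have := c.seg_pos (ε := i) (i := j) (j := i + n) (j + 1) (by omega) (by omega) (by grind)
    simp only [Finsupp.add_apply]
    omega
  · have := c.seg_pos (ε := i + 1) (i := i) (j := j) (i + 1) (by omega) (by omega) (by grind)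
    simp only [Finsupp.add_apply]
    omega

/-- An edge which is traversed once, and whose endpoints are visited twice, connects the two
monomials of the walk. -/
lemma NotConn.false_of_adjacent_repeats (hn : c.NotConn) (hpos : 0 < n) (heven : Even n)
    {i k r : ℤ} (hik : i + 1 < k) (hkr : k < r) (hr : r < i + n) (hvr : c.vert i = c.vert r)
    (hvk : c.vert (i + 1) = c.vert k) (hrodd : Odd (r - i)) (hkodd : Odd (k - (i + 1)))
    (hsingle : ∀ j, ¬ (n : ℤ) ∣ j - i → c.edge j ≠ c.edge i) : False := by
  have hkr' : k + 1 ≠ r := by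
    rintro rfl
    refine hsingle k (fun hd => ?_) (Subtype.ext ?_)
    · have := dvd_sub_of_window (a := i) (by omega) (by omega) (by omega) (by omega) hd
      omega
    · rw [edge_coe, edge_coe, ← hvk, ← hvr, Sym2.eq_swap]
  -- Switching on the arc from `k` to `r` frees the vertices of `k` and `r`, which are the ends of
  -- the edge `i`; a further copy of this edge pays for them.
  refine hn.false_of_one hpos heven i
    (M := Finsupp.single (c.edge i) 1 + c.seg i i k + c.seg (i + 1) k r + c.seg i r (i + n))
    (k := i) (l := k + 1) ?_ (by grind) ?_ (by grind) ?_
  · rw [← c.seg_period heven i i, c.seg_add i (show i ≤ k by omega) (show k ≤ i + n by omega),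
      c.seg_add i hkr.le hr.le]
    simp only [deg_add]
    rw [c.deg_seg_odd (ε := i) hkr.le (by grind) (by grind), deg_single, edge_coe, one_smul,
      edgeVec_mk, ← hvk, ← hvr]
    abel
  · simp
  · have := c.seg_pos (ε := i + 1) (i := k) (j := r) (k + 1) (by omega) (by omega) (by grind)
    simp only [Finsupp.add_apply]
    omega

/-- Two odd chords which cross effectively and do not form an `F₄` connect the two monomials of
the walk. -/
lemma NotConn.false_of_crossing (hn : c.NotConn) (hpos : 0 < n) (heven : Even n)
    {s t j k : ℤ} (hst : s < t) (htj : t < j) (hjk : j < k) (hk : k < s + n)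
    (h1 : Odd (t - s)) (h2 : Odd (j - t)) (h3 : Odd (k - j)) (f f' : G.edgeSet)
    (hf : (f : Sym2 V) = s(c.vert s, c.vert j)) (hf' : (f' : Sym2 V) = s(c.vert t, c.vert k))
    (hF1 : ¬ (t = s + 1 ∧ k = j + 1)) (hF2 : ¬ (j = t + 1 ∧ s + n = k + 1)) : False := by
  have hn2 : Even (n : ℤ) := by exact_mod_cast heven
  -- The arcs from `s` to `t` and from `j` to `k` are switched, the other two are kept. An edge of
  -- one parity is missing only if both arcs of one kind are single edges, which is the shape of an
  -- `F₄`.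
  have hA : ∃ l, Even (l + s) ∧ (t ≤ l ∧ l < j ∨ k ≤ l ∧ l < s + n) := by
    by_cases h : t + 1 < j
    · exact ⟨t + 1, by grind, by omega⟩
    · exact ⟨k + 1, by grind, by omega⟩
  have hB : ∃ l, Odd (l + s) ∧ (s ≤ l ∧ l < t ∨ j ≤ l ∧ l < k) := by
    by_cases h : s + 1 < t
    · exact ⟨s + 1, by grind, by omega⟩
    · exact ⟨j + 1, by grind, by omega⟩
  obtain ⟨l, hl, hl'⟩ := hA
  obtain ⟨m, hm, hm'⟩ := hB
  refine hn.false_of_one hpos heven s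
    (M := Finsupp.single f 1 + Finsupp.single f' 1 + c.seg (s + 1) s t + c.seg s t j +
      c.seg (s + 1) j k + c.seg s k (s + n))
    (k := l) (l := m) ?_ hl ?_ hm ?_
  · rw [← c.seg_period heven s s, c.seg_add s hst.le (show t ≤ s + n by omega),
      c.seg_add s htj.le (show j ≤ s + n by omega), c.seg_add s hjk.le hk.le]
    simp only [deg_add]
    rw [c.deg_seg_odd (ε := s) hst.le (by grind) (by grind),
      c.deg_seg_odd (ε := s) hjk.le (by grind) (by grind), deg_single, deg_single, hf, hf',
      one_smul, one_smul, edgeVec_mk, edgeVec_mk]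
    abel
  · simp only [Finsupp.add_apply]
    rcases hl' with hl' | hl'
    · have := c.seg_pos (ε := s) l hl'.1 hl'.2 hl
      omega
    · have := c.seg_pos (ε := s) l hl'.1 hl'.2 hl
      omega
  · simp only [Finsupp.add_apply]
    rcases hm' with hm' | hm'
    · have := c.seg_pos (ε := s + 1) m hm'.1 hm'.2 (by grind)
      omega
    · have := c.seg_pos (ε := s + 1) m hm'.1 hm'.2 (by grind)
      omega

/-- An edge of the graph whose endpoints are separated by a vertex which is visited twice connects
the two monomials of the walk. -/
lemma NotConn.false_of_separated (hn : c.NotConn) (hpos : 0 < n) (heven : Even n)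
    {a s b t : ℤ} (has : a < s) (hsb : s < b) (hbt : b < t) (hta : t < a + n)
    (hab : c.vert a = c.vert b) (hodd : Odd (b - a)) (hst : Even (t - s)) (f : G.edgeSet)
    (hf : (f : Sym2 V) = s(c.vert s, c.vert t)) : False := by
  have hn2 : Even (n : ℤ) := by exact_mod_cast heven
  have hA : ∃ l, Even (l + (s + 1)) ∧ (s ≤ l ∧ l < b ∨ t ≤ l ∧ l < a + n) := by
    by_cases h : s + 1 < b
    · exact ⟨s + 1, by grind, by omega⟩
    · exact ⟨t + 1, by grind, by grind⟩
  have hB : ∃ l, Odd (l + (s + 1)) ∧ (a ≤ l ∧ l < s ∨ b ≤ l ∧ l < t) := by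
    by_cases h : a + 1 < s
    · exact ⟨s - 2, by grind, by omega⟩
    · exact ⟨t - 2, by grind, by grind⟩
  obtain ⟨l, hl, hl'⟩ := hA
  obtain ⟨m, hm, hm'⟩ := hB
  refine hn.false_of_one hpos heven (s + 1)
    (M := Finsupp.single f 1 + c.seg (s + 1 + 1) a s + c.seg (s + 1) s b + c.seg (s + 1 + 1) b t +
      c.seg (s + 1) t (a + n))
    -- Switching the arcs from `a` to `s` and from `b` to `t`, one of odd and one of even length,
    -- frees `vert s` and `vert t`; the contributions at `a` and `b` cancel, being at the same
    -- vertex.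
    (k := l) (l := m) ?_ hl ?_ hm ?_
  · rw [← c.seg_period heven (s + 1) a, c.seg_add (s + 1) has.le (show s ≤ a + n by omega),
      c.seg_add (s + 1) hsb.le (show b ≤ a + n by omega), c.seg_add (s + 1) hbt.le hta.le]
    simp only [deg_add]
    rw [deg_single, hf, one_smul, edgeVec_mk]
    rcases Int.even_or_odd (s - a) with h | h
    · have e1 := c.deg_seg_even' (ε := s + 1) has.le (by grind) (by grind)
      have e2 := c.deg_seg_odd (ε := s + 1) hbt.le (by grind) (by grind)
      ext x
      have e1 := DFunLike.congr_fun e1 x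
      have e2 := DFunLike.congr_fun e2 x
      simp only [Finsupp.add_apply, ← hab] at e1 e2 ⊢
      linarith
    · have e1 := c.deg_seg_odd (ε := s + 1) has.le (by grind) (by grind)
      have e2 := c.deg_seg_even' (ε := s + 1) hbt.le (by grind) (by grind)
      ext x
      have e1 := DFunLike.congr_fun e1 x
      have e2 := DFunLike.congr_fun e2 x
      simp only [Finsupp.add_apply, ← hab] at e1 e2 ⊢
      linarith
  · simp only [Finsupp.add_apply]
    rcases hl' with hl' | hl'
    · have := c.seg_pos (ε := s + 1) l hl'.1 hl'.2 hl
      omega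
    · have := c.seg_pos (ε := s + 1) l hl'.1 hl'.2 hl
      omega
  · simp only [Finsupp.add_apply]
    rcases hm' with hm' | hm'
    · have := c.seg_pos (ε := s + 1 + 1) m hm'.1 hm'.2 (by grind)
      omega
    · have := c.seg_pos (ε := s + 1 + 1) m hm'.1 hm'.2 (by grind)
      omega

/-- An edge of the graph which crosses an `F₄` connects the two monomials of the walk. -/
lemma NotConn.false_of_crossing_F4 (hn : c.NotConn) (hpos : 0 < n) (heven : Even n)
    {a b i j : ℤ} (hab : a < b) (hb : b < a + n) (hpar : Even (b - a)) (haj : a + 1 ≤ j)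
    (hjb : j ≤ b) (hbi : b + 1 ≤ i) (hia : i ≤ a + n) (hij : Even (i - j)) (f f' g : G.edgeSet)
    (hf : (f : Sym2 V) = s(c.vert a, c.vert b))
    (hf' : (f' : Sym2 V) = s(c.vert (a + 1), c.vert (b + 1)))
    (hg : (g : Sym2 V) = s(c.vert i, c.vert j)) (hgf : g ≠ f) (hgf' : g ≠ f') : False := by
  have hn2 : Even (n : ℤ) := by exact_mod_cast heven
  have hgf1 : ¬ (i = a + n ∧ j = b) := by
    rintro ⟨rfl, rfl⟩
    exact hgf (Subtype.ext (by rw [hg, hf, c.per]))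
  have hgf2 : ¬ (i = b + 1 ∧ j = a + 1) := by
    rintro ⟨rfl, rfl⟩
    exact hgf' (Subtype.ext (by rw [hg, hf', Sym2.eq_swap]))
  -- When `b = a + 2`, the period is not four, as then `g` would be `f` or `f'`.
  have hA : ∃ l, Even (l + a) ∧ (a + 1 ≤ l ∧ l < b ∨ b + 1 ≤ l ∧ l < a + n) := by
    by_cases h : a + 2 < b
    · exact ⟨a + 2, by grind, by omega⟩
    · exact ⟨b + 2, by grind, by
        simp only [Int.even_iff] at *
        omega⟩
  -- The first monomial exchanges the edges `a` and `b` for the chords `f` and `f'` of the `F₄`.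
  have hE : deg (Finsupp.single f 1 + Finsupp.single f' 1 + c.seg a (a + 1) b +
      c.seg a (b + 1) (a + n)) = deg (c.seg a 0 n) := by
    rw [← c.seg_period heven a a, c.seg_add a (show a ≤ a + 1 by omega) (show a + 1 ≤ a + n by omega),
      c.seg_add a (show a + 1 ≤ b by omega) (show b ≤ a + n by omega),
      c.seg_add a (show b ≤ b + 1 by omega) (show b + 1 ≤ a + n by omega),
      c.seg_succ_of_even (by grind), c.seg_succ_of_even (by grind)]
    simp only [deg_add, deg_single, one_smul, hf, hf', edge_coe, edgeVec_mk]
    abel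
  have hspl1 := c.seg_add a haj hjb
  have hspl2 := c.seg_add a hbi hia
  obtain ⟨l, hl, hl'⟩ := hA
  have hlpos : 0 < (Finsupp.single f 1 + Finsupp.single f' 1 + c.seg a (a + 1) b +
      c.seg a (b + 1) (a + n) : G.edgeSet →₀ ℕ) (c.edge l) := by
    simp only [Finsupp.add_apply]
    rcases hl' with hl' | hl'
    · have := c.seg_pos (ε := a) l hl'.1 hl'.2 hl
      omega
    · have := c.seg_pos (ε := a) l hl'.1 hl'.2 hl
      omega
  -- The second monomial replaces one of the chords by `g` and switches the two arcs between their
  -- ends: `f` is replaced if `i` has the parity of `a`, and `f'` otherwise. The chord that is kept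
  -- links the two monomials.
  rcases Int.even_or_odd (i - a) with h | h
  · have hB : ∃ l, Odd (l + a) ∧ (i ≤ l ∧ l < a + n ∨ j ≤ l ∧ l < b) := by
      by_cases h : i + 1 < a + n
      · exact ⟨i + 1, by grind, by omega⟩
      · exact ⟨j + 1, by grind, by
          simp only [Int.even_iff] at *
          omega⟩
    obtain ⟨m, hm, hm'⟩ := hB
    refine hn.false_of_two hpos heven a hE hl hlpos
      (M' := Finsupp.single f' 1 + Finsupp.single g 1 + c.seg (a + 1) i (a + n) +
        c.seg (a + 1) j b + c.seg a (a + 1) j + c.seg a (b + 1) i) (l := m) ?_ f'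
      (by simp) (by simp) hm ?_
    · rw [hspl1, hspl2]
      have e1 := c.deg_seg_even (ε := a) hia (by grind) (by grind)
      have e2 := c.deg_seg_even (ε := a) hjb (by grind) (by grind)
      rw [c.per] at e1
      simp only [deg_add, deg_single, one_smul, hf, hf', hg, edgeVec_mk]
      ext x
      have e1 := DFunLike.congr_fun e1 x
      have e2 := DFunLike.congr_fun e2 x
      simp only [Finsupp.add_apply] at e1 e2 ⊢
      linarith
    · simp only [Finsupp.add_apply]
      rcases hm' with hm' | hm'
      · have := c.seg_pos (ε := a + 1) m hm'.1 hm'.2 (by grind)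
        omega
      · have := c.seg_pos (ε := a + 1) m hm'.1 hm'.2 (by grind)
        omega
  · have hB : ∃ l, Odd (l + a) ∧ (b + 1 ≤ l ∧ l < i ∨ a + 1 ≤ l ∧ l < j) := by
      by_cases h : b + 1 < i
      · exact ⟨b + 1, by grind, by omega⟩
      · exact ⟨a + 1, by grind, by omega⟩
    obtain ⟨m, hm, hm'⟩ := hB
    refine hn.false_of_two hpos heven a hE hl hlpos
      (M' := Finsupp.single f 1 + Finsupp.single g 1 + c.seg (a + 1) (b + 1) i +
        c.seg (a + 1) (a + 1) j + c.seg a i (a + n) + c.seg a j b) (l := m) ?_ f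
      (by simp) (by simp) hm ?_
    · rw [hspl1, hspl2]
      have e1 := c.deg_seg_even' (ε := a) hbi (by grind) (by grind)
      have e2 := c.deg_seg_even' (ε := a) haj (by grind) (by grind)
      simp only [deg_add, deg_single, one_smul, hf, hf', hg, edgeVec_mk]
      ext x
      have e1 := DFunLike.congr_fun e1 x
      have e2 := DFunLike.congr_fun e2 x
      simp only [Finsupp.add_apply] at e1 e2 ⊢
      linarith
    · simp only [Finsupp.add_apply]
      rcases hm' with hm' | hm'
      · have := c.seg_pos (ε := a + 1) m hm'.1 hm'.2 (by grind)
        omega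
      · have := c.seg_pos (ε := a + 1) m hm'.1 hm'.2 (by grind)
        omega

end CyclicWalk

end Switches

/-! ### Necessity of the conditions -/

section Necessity

open CyclicWalk

variable {V : Type*} {G : SimpleGraph V} {u : V} {w : G.Walk u u} {hpos : 0 < w.length}

lemma two_mul_degree_posExp {x : V} (ξ : G.Walk x x) (hξ : Even ξ.length) (h0 : 0 < ξ.length) :
    2 * (posExp ξ).degree = ξ.length := by
  have h := (ofWalk ξ h0).linearCombination_deg_seg hξ (fun _ => 1) 0 0
  rw [zero_add, ← posExp_eq_seg, linearCombination_one_deg] at h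
  simp at h
  exact_mod_cast h

/-- If the monomials of an even closed walk are not connected, the walk is primitive. -/
lemma isPrimitive_of_not_conn (hw : Even w.length) (hpos : 0 < w.length)
    (h : ¬ Conn (posExp w) (negExp w)) : IsPrimitive w := by
  have hdeg := deg_posExp_eq hpos hw
  constructor
  · by_contra hd
    obtain ⟨e, he1, he2⟩ := Finset.not_disjoint_iff.1 hd
    rw [Finsupp.mem_support_iff] at he1 he2
    exact h (Relation.ReflTransGen.single ⟨hdeg, e, by omega, by omega⟩)
  · rintro ⟨x, ξ, h0, heven, hlt, hle1, hle2⟩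
    have hξ := deg_posExp_eq h0 heven
    have c1 := two_mul_degree_posExp ξ heven h0
    have c2 := two_mul_degree_posExp w hw hpos
    -- With `a` the cofactor of `E⁺(ξ)` in `E⁺(w)`, the monomial `E⁻(ξ) · a` meets `E⁺(w)` in `a`
    -- and `E⁻(w)` in `E⁻(ξ)`.
    obtain ⟨a, ha⟩ := exists_add_of_le hle1
    have hM : deg (negExp ξ + a) = deg (posExp w) := by rw [ha, deg_add, deg_add, hξ]
    have ha0 : a ≠ 0 := by
      rintro rfl
      rw [ha, add_zero] at c2
      omega
    have hξ0 : negExp ξ ≠ 0 := by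
      intro e
      have := degree_eq_of_deg_eq hξ
      rw [e, map_zero] at this
      omega
    obtain ⟨e, he⟩ := Finsupp.ne_iff.1 ha0
    obtain ⟨e', he'⟩ := Finsupp.ne_iff.1 hξ0
    simp only [Finsupp.coe_zero, Pi.zero_apply] at he he'
    have l1 : Linked (posExp w) (negExp ξ + a) := by
      refine ⟨hM.symm, e, ?_, ?_⟩
      · rw [ha, Finsupp.add_apply]; omega
      · rw [Finsupp.add_apply]; omega
    have l2 : Linked (negExp ξ + a) (negExp w) := by
      refine ⟨hM.trans hdeg, e', ?_, ?_⟩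
      · rw [Finsupp.add_apply]; omega
      · have := hle2 e'
        omega
    exact h ((Relation.ReflTransGen.single l1).tail l2)

lemma IsChord.not_edge {f : Sym2 V} (hf : IsChord w f) (k : ℤ) :
    (ofWalk w hpos).edge k ≠ ⟨f, hf.1⟩ := by
  intro e
  exact hf.2.2 ((mem_edges_iff_exists (hpos := hpos) f).2 ⟨k, by rw [e]⟩)

/-- Sinks are visited twice, and an edge of a cyclic block is traversed once. So adjacent sinks of
such a block give the configuration of `false_of_adjacent_repeats`, with the order of the visits
forced by `noncross`. -/
lemma CyclicWalk.IsPrim.isStronglyPrimitive (hc : (ofWalk w hpos).IsPrim)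
    (hn : (ofWalk w hpos).NotConn) (hp : IsPrimitive w) : IsStronglyPrimitive w := by
  refine ⟨hp, ?_⟩
  rintro ⟨B, x, y, hB, hcyc, hxy, hx, hy⟩
  have key : ∀ i, B.Adj ((ofWalk w hpos).vert i) ((ofWalk w hpos).vert (i + 1)) →
      IsSink w B ((ofWalk w hpos).vert i) → IsSink w B ((ofWalk w hpos).vert (i + 1)) → False := by
    intro i hadj hsi hsi1
    obtain ⟨r, hr1, hr2, hr3⟩ := hc.exists_repeat_of_isSink hsi
    obtain ⟨k, hk1, hk2, hk3⟩ := hc.exists_repeat_of_isSink hsi1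
    have hne := (ofWalk w hpos).vert_ne i
    have hr4 : r ≠ i + 1 := by rintro rfl; exact hne hr3
    have hk4 : k ≠ i + w.length := by rintro rfl; rw [per] at hk3; exact hne hk3.symm
    have hkr : k ≠ r := by rintro rfl; exact hne (hr3.trans hk3.symm)
    have hlt : k < r := by
      by_contra hlt
      exact hc.noncross i (i + 1) r k (by omega) (by omega) (by omega) (by omega) hr3 hk3
    exact hn.false_of_adjacent_repeats hc.pos hc.even hk1 hlt hr2 hr3 hk3
      (hc.odd _ _ hr1 hr2 hr3) (hc.odd _ _ hk1 hk2 hk3) (hc.edge_ne_of_isCyclic hB hcyc hadj)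
  obtain ⟨i, hi⟩ := hB.exists_edge_eq (hpos := hpos) _ _ hxy
  rw [edge_coe] at hi
  rcases Sym2.eq_iff.1 hi with ⟨rfl, rfl⟩ | ⟨rfl, rfl⟩
  · exact key i hxy hx hy
  · exact key i hxy.symm hy hx

/-- A chord joins positions of the same parity. -/
lemma CyclicWalk.IsPrim.even_of_isChord (hc : (ofWalk w hpos).IsPrim)
    (hn : (ofWalk w hpos).NotConn) {i j : ℤ}
    (hf : IsChord w s((ofWalk w hpos).vert i, (ofWalk w hpos).vert j)) : Even (j - i) := by
  obtain ⟨k, h1, h2, h3⟩ := exists_rep hc.pos i j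
  have hkj := (ofWalk w hpos).vert_congr h3
  have hki : k ≠ i := by
    rintro rfl
    exact (G.ne_of_adj hf.1) hkj.symm
  have hev : Even (k - i) := by
    rw [← Int.not_odd_iff_even]
    intro hodd
    exact hn.false_of_even_chord hc.pos hc.even (by omega) h2 hodd ⟨_, hf.1⟩ (by simp [hkj])
      fun k => hf.not_edge k
  obtain ⟨m, hm⟩ := h3
  have hm' : Even ((w.length : ℤ) * m) := hc.even_cast.mul_right _
  rw [Int.even_iff] at *
  omega

/-- Two visits have positions of different parity, and a chord has to match the parity of both. -/
lemma CyclicWalk.IsPrim.vert_ne_of_isChord (hc : (ofWalk w hpos).IsPrim)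
    (hn : (ofWalk w hpos).NotConn) {i j : ℤ}
    (hf : IsChord w s((ofWalk w hpos).vert i, (ofWalk w hpos).vert j)) (r : ℤ) (hir : i < r)
    (hr : r < i + w.length) : (ofWalk w hpos).vert i ≠ (ofWalk w hpos).vert r := by
  intro e
  have h1 := hc.even_of_isChord hn hf
  rw [e] at hf
  have h2 := hc.even_of_isChord hn hf
  have h3 := hc.odd i r hir hr e
  rw [Int.even_iff] at h1 h2
  rw [Int.odd_iff] at h3
  omega

/-- The ends are visited once, so if they lay in different blocks a repeated vertex would separate
them, which `false_of_separated` forbids. -/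
lemma CyclicWalk.IsPrim.isOddChord (hc : (ofWalk w hpos).IsPrim)
    (hn : (ofWalk w hpos).NotConn) {f : Sym2 V} (hf : IsChord w f) : IsOddChord w f := by
  refine ⟨hf, ?_, ?_⟩
  · rintro ⟨-, x, y, B, C, rfl, hB, hC, hBC, hx, hy⟩
    obtain ⟨s, rfl⟩ := (mem_support_iff_exists (hpos := hpos) x).1 (hf.2.1 x (by simp))
    obtain ⟨t', rfl⟩ := (mem_support_iff_exists (hpos := hpos) y).1 (hf.2.1 y (by simp))
    obtain ⟨t, h1, h2, h3⟩ := exists_rep hpos s t'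
    rw [(ofWalk w hpos).vert_congr h3] at hf hy
    refine hBC (hc.isBlock_eq h1 h2 (hc.vert_ne_of_isChord hn hf)
      (hc.vert_ne_of_isChord hn (by rwa [Sym2.eq_swap])) ?_ hB hC hx hy)
    intro a b has hsb hbt hta e
    exact hn.false_of_separated hc.pos hc.even has hsb hbt hta e
      (hc.odd a b (by omega) (by omega) e) (hc.even_of_isChord hn hf) ⟨_, hf.1⟩ rfl
  · induction f with
    | h x y =>
    have key : ∀ i j : Fin w.length, i < j → IsChord w s(w.getVert i, w.getVert j) →
        ∃ i' j', JoinsAt w s(w.getVert i, w.getVert j) i' j' ∧ Odd (j' - i' + 1) ∧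
          Odd (w.length - (j' - i') + 1) := by
      intro i j hij hf
      refine ⟨i, j, ⟨hij, j.2, rfl⟩, ?_⟩
      rw [← ofWalk_vert (hpos := hpos) i.2.le, ← ofWalk_vert (hpos := hpos) j.2.le] at hf
      have h1 := hc.even_of_isChord hn hf
      have h2 := hc.even
      have h3 := j.2
      rw [Fin.lt_def] at hij
      rw [Int.even_iff] at h1
      rw [Nat.even_iff] at h2
      rw [Nat.odd_iff, Nat.odd_iff]
      omega
    obtain ⟨s, rfl⟩ := (mem_support_iff_exists (hpos := hpos) x).1 (hf.2.1 x (by simp))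
    obtain ⟨t, rfl⟩ := (mem_support_iff_exists (hpos := hpos) y).1 (hf.2.1 y (by simp))
    obtain ⟨i, -, -, hi⟩ := exists_fin (hpos := hpos) s
    obtain ⟨j, -, -, hj⟩ := exists_fin (hpos := hpos) t
    rw [hi, hj] at hf ⊢
    rcases lt_trichotomy i j with hlt | rfl | hgt
    · exact key i j hlt hf
    · exact absurd rfl (G.ne_of_adj hf.1)
    · rw [Sym2.eq_swap] at hf ⊢
      exact key j i hgt hf

lemma CrossEffectively.symm {f f' : Sym2 V} (h : CrossEffectively w f f') :
    CrossEffectively w f' f := by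
  obtain ⟨h1, h2, s, j, s', j', h3, h4, h5, h6⟩ := h
  exact ⟨h2, h1, s', j', s, j, h4, h3, by rwa [add_comm], h6.symm⟩

lemma IsF4.symm {a b : Fin w.length} {f f' : Sym2 V} (h : IsF4 w a b f f') : IsF4 w a b f' f := by
  obtain ⟨h1, h2, h3, x, y, z, t, hnd, e1, e2, e3, e4⟩ := h
  refine ⟨h1, h2, h3.symm, y, x, t, z, ?_, by rw [e1, Sym2.eq_swap], by rw [e4, Sym2.eq_swap],
    by rw [e3, Sym2.eq_swap], by rw [e2, Sym2.eq_swap]⟩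
  simp only [List.nodup_cons, List.mem_cons, List.not_mem_nil, or_false, not_or] at hnd ⊢
  grind

/-- The switch of `false_of_crossing` fails only if two opposite arcs are single edges; these edges
and the chords form the `F₄`. -/
lemma CyclicWalk.IsPrim.exists_isF4 (hc : (ofWalk w hpos).IsPrim)
    (hn : (ofWalk w hpos).NotConn) {f f' : Sym2 V} (h : CrossEffectively w f f') {s j t k : ℕ}
    (hf : JoinsAt w f s j) (hf' : JoinsAt w f' t k) (hpar : Odd (s + t)) (hst : s < t) (htj : t < j)
    (hjk : j < k) : ∃ a b : Fin w.length, IsF4 w a b f f' := by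
  obtain ⟨-, hj, rfl⟩ := hf
  obtain ⟨-, hk, rfl⟩ := hf'
  have hcf := h.1.1
  have hcf' := h.2.1.1
  have vs := ofWalk_vert (hpos := hpos) (k := s) (by omega)
  have vt := ofWalk_vert (hpos := hpos) (k := t) (by omega)
  have vj := ofWalk_vert (hpos := hpos) (k := j) (by omega)
  have vk := ofWalk_vert (hpos := hpos) (k := k) (by omega)
  rw [← vs, ← vj] at hcf
  rw [← vt, ← vk] at hcf'
  have p1 := hc.even_of_isChord hn hcf
  have p2 := hc.even_of_isChord hn hcf'
  have p3 := hc.even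
  have n1 := hc.vert_ne_of_isChord hn hcf
  have n2 := hc.vert_ne_of_isChord hn hcf'
  have n3 := hc.vert_ne_of_isChord hn (Sym2.eq_swap ▸ hcf)
  rw [Int.even_iff] at p1 p2
  rw [Nat.even_iff] at p3
  rw [Nat.odd_iff] at hpar
  have nst := n1 t (by omega) (by omega)
  have nsj := n1 j (by omega) (by omega)
  have nsk := n1 k (by omega) (by omega)
  have ntj := n2 j (by omega) (by omega)
  have ntk := n2 k (by omega) (by omega)
  have njk := n3 k (by omega) (by omega)
  rw [vs, vt] at nst
  rw [vs, vj] at nsj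
  rw [vs, vk] at nsk
  rw [vt, vj] at ntj
  rw [vt, vk] at ntk
  rw [vj, vk] at njk
  by_cases hF1 : t = s + 1 ∧ k = j + 1
  · obtain ⟨rfl, rfl⟩ := hF1
    refine ⟨⟨s, by omega⟩, ⟨j, by omega⟩, by rw [Fin.mk_lt_mk]; omega, ?_, h, w.getVert (s + 1),
      w.getVert s, w.getVert j, w.getVert (j + 1), ?_, ?_, rfl, rfl, ?_⟩
    · simp only [Nat.even_iff]; omega
    · simp only [List.nodup_cons, List.mem_cons, List.not_mem_nil, or_false, not_or]
      grind
    · exact Sym2.eq_swap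
    · exact Sym2.eq_swap
  by_cases hF2 : j = t + 1 ∧ s + w.length = k + 1
  · obtain ⟨rfl, hk'⟩ := hF2
    -- Here the second edge of the `F₄` is the last one of the walk, which closes it at position 0.
    obtain rfl : s = 0 := by omega
    refine ⟨⟨t, by omega⟩, ⟨k, by omega⟩, by rw [Fin.mk_lt_mk]; omega, ?_, h, w.getVert t,
      w.getVert (t + 1), w.getVert 0, w.getVert k, ?_, rfl, Sym2.eq_swap, ?_, Sym2.eq_swap⟩
    · simp only [Nat.even_iff]; omega
    · simp only [List.nodup_cons, List.mem_cons, List.not_mem_nil, or_false, not_or]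
      grind
    · change s(w.getVert k, w.getVert (k + 1)) = _
      rw [← hk', zero_add, w.getVert_length, w.getVert_zero, Sym2.eq_swap]
  exact (hn.false_of_crossing hc.pos hc.even (s := s) (t := t) (j := j) (k := k) (by omega)
    (by omega) (by omega) (by omega) (by rw [Int.odd_iff]; omega) (by rw [Int.odd_iff]; omega)
    (by rw [Int.odd_iff]; omega) ⟨_, hcf.1⟩ ⟨_, hcf'.1⟩ rfl rfl (by omega) (by omega)).elim

lemma CyclicWalk.IsPrim.not_crossStronglyEffectively (hc : (ofWalk w hpos).IsPrim)
    (hn : (ofWalk w hpos).NotConn) : ¬ ∃ f f' : Sym2 V, CrossStronglyEffectively w f f' := by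
  rintro ⟨f, f', h, hF4⟩
  obtain ⟨s, j, s', j', h3, h4, h5, h6⟩ := h.2.2
  rcases h6 with ⟨h6, h7, h8⟩ | ⟨h6, h7, h8⟩
  · exact hF4 (hc.exists_isF4 hn h h3 h4 h5 h6 h7 h8)
  · obtain ⟨a, b, hab⟩ := hc.exists_isF4 hn h.symm h4 h3 (by rwa [add_comm]) h6 h7 h8
    exact hF4 ⟨a, b, hab.symm⟩

lemma CyclicWalk.IsPrim.not_crossesF4 (hc : (ofWalk w hpos).IsPrim)
    (hn : (ofWalk w hpos).NotConn) :
    ¬ ∃ (g f f' : Sym2 V) (a b : Fin w.length), CrossesF4 w g a b f f' := by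
  rintro ⟨g, f, f', a, b, hg, ⟨hab, hpar, hcr, x, y, z, t, -, e1, rfl, e3, rfl⟩, hgf, hgf', i, j, hi,
    hj, rfl⟩
  rw [Fin.lt_def] at hab
  have hb := b.2
  have hf := hcr.1.1
  have hf' := hcr.2.1.1
  have hg := hg.1
  rw [← ofWalk_edge (hpos := hpos), edge_coe] at e1 e3
  rw [← ofWalk_vert (hpos := hpos) (k := j) (by omega)] at hg hgf hgf'
  -- Positions up to `a` are moved by one period, so that the outer arc becomes an interval.
  obtain ⟨i', hi1, hi2, hi3⟩ : ∃ i' : ℤ, (b : ℕ) + 1 ≤ i' ∧ i' ≤ (a : ℕ) + w.length ∧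
      w.getVert i = (ofWalk w hpos).vert i' := by
    rcases hi with hi | ⟨hi, hi'⟩
    · exact ⟨i + w.length, by omega, by omega, by rw [per, ofWalk_vert (by omega)]⟩
    · by_cases h : i ≤ a + w.length
      · exact ⟨i, by omega, by omega, (ofWalk_vert (by omega)).symm⟩
      · omega
  rw [hi3] at hg hgf hgf'
  have pg := hc.even_of_isChord hn hg
  have hpar' : Even (((b : ℕ) : ℤ) - (a : ℕ)) := by
    simp only [Nat.even_iff] at hpar
    rw [Int.even_iff]; omega
  have pg' : Even (i' - j) := by
    rw [Int.even_iff] at *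
    omega
  have key : ∀ (f f' : G.edgeSet),
      (f : Sym2 V) = s((ofWalk w hpos).vert (a : ℕ), (ofWalk w hpos).vert (b : ℕ)) →
      (f' : Sym2 V) = s((ofWalk w hpos).vert ((a : ℕ) + 1), (ofWalk w hpos).vert ((b : ℕ) + 1)) →
      (s((ofWalk w hpos).vert i', (ofWalk w hpos).vert j) ≠ f) →
      (s((ofWalk w hpos).vert i', (ofWalk w hpos).vert j) ≠ f') → False := by
    intro f f' h1 h2 h3 h4
    exact hn.false_of_crossing_F4 hc.pos hc.even (by omega) (by omega) hpar' (j := j) (by omega)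
      (by omega) hi1 hi2 pg' f f' ⟨_, hg.1⟩ h1 h2 rfl (fun e => h3 (congrArg Subtype.val e))
      (fun e => h4 (congrArg Subtype.val e))
  have odd_false : ∀ p q : ℤ, Odd (q - p) →
      ¬ IsChord w s((ofWalk w hpos).vert p, (ofWalk w hpos).vert q) := fun p q ho h =>
    Int.not_even_iff_odd.2 ho (hc.even_of_isChord hn h)
  have o1 : Odd (((b : ℕ) : ℤ) - ((a : ℕ) + 1)) := by
    rw [Int.even_iff] at hpar'; rw [Int.odd_iff]; omega
  have o2 : Odd (((b : ℕ) : ℤ) + 1 - (a : ℕ)) := by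
    rw [Int.even_iff] at hpar'; rw [Int.odd_iff]; omega
  -- Of the four orientations of the two walk edges, two make a chord join positions of opposite
  -- parity; the other two differ by the names of `f` and `f'`.
  rcases Sym2.eq_iff.1 e1 with ⟨rfl, rfl⟩ | ⟨rfl, rfl⟩ <;>
    rcases Sym2.eq_iff.1 e3 with ⟨rfl, rfl⟩ | ⟨rfl, rfl⟩
  · exact odd_false _ _ o1 hf
  · exact key ⟨_, hf'.1⟩ ⟨_, hf.1⟩ Sym2.eq_swap rfl hgf' hgf
  · exact key ⟨_, hf.1⟩ ⟨_, hf'.1⟩ rfl Sym2.eq_swap hgf hgf'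
  · exact odd_false _ _ o2 hf

end Necessity

/-! ### Degree at a set of vertices -/

section Mass

variable {V : Type*} {G : SimpleGraph V}

open scoped Classical in
/-- The total degree of a monomial at the vertices of a set. -/
noncomputable def mass (S : Set V) (a : G.edgeSet →₀ ℕ) : ℤ :=
  Finsupp.linearCombination ℤ (fun v => if v ∈ S then (1 : ℤ) else 0) (deg a)

lemma mass_add (S : Set V) (a b : G.edgeSet →₀ ℕ) : mass S (a + b) = mass S a + mass S b := by
  rw [mass, deg_add, map_add, mass, mass]

open scoped Classical in
lemma mass_single (S : Set V) {e : G.edgeSet} {x y : V} (h : (e : Sym2 V) = s(x, y)) :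
    mass S (Finsupp.single e 1) = (if x ∈ S then 1 else 0) + if y ∈ S then 1 else 0 := by
  rw [mass, deg_single, one_smul, h, linearCombination_edgeVec]

lemma dvd_mass {S : Set V} {m : ℤ} {a : G.edgeSet →₀ ℕ}
    (h : ∀ e, 0 < a e → m ∣ mass S (Finsupp.single e 1)) : m ∣ mass S a := by
  rw [mass, linearCombination_deg]
  refine Finset.dvd_sum fun e he => Dvd.dvd.mul_left ?_ _
  have := h e (Nat.pos_of_ne_zero (Finsupp.mem_support_iff.1 he))
  rwa [mass, deg_single, one_smul] at this

lemma mass_nonneg (S : Set V) (a : G.edgeSet →₀ ℕ) : 0 ≤ mass S a := by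
  rw [mass, linearCombination_deg]
  refine Finset.sum_nonneg fun e _ => mul_nonneg (by positivity) ?_
  obtain ⟨e, he⟩ := e
  induction e with
  | h x y =>
    rw [linearCombination_edgeVec]
    split_ifs <;> norm_num

lemma mass_mono (S : Set V) {a b : G.edgeSet →₀ ℕ} (h : a ≤ b) : mass S a ≤ mass S b := by
  obtain ⟨d, rfl⟩ := exists_add_of_le h
  have := mass_nonneg S d
  rw [mass_add]
  omega

lemma one_le_mass_single {x : V} {e : G.edgeSet} (hx : x ∈ (e : Sym2 V)) :
    1 ≤ mass {x} (Finsupp.single e 1) := by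
  obtain ⟨y, hy⟩ := hx
  rw [mass_single _ hy, if_pos (Set.mem_singleton x)]
  split_ifs <;> norm_num

lemma mass_single_of_notMem {x : V} {e : G.edgeSet} (hx : x ∉ (e : Sym2 V)) :
    mass {x} (Finsupp.single e 1) = 0 := by
  obtain ⟨e, he⟩ := e
  induction e with
  | h y z =>
    rw [Sym2.mem_iff, not_or] at hx
    rw [mass_single _ rfl, if_neg (by simpa using Ne.symm hx.1),
      if_neg (by simpa using Ne.symm hx.2), add_zero]

lemma exists_mem_of_mass_ne_zero {x : V} {a : G.edgeSet →₀ ℕ} (h : mass {x} a ≠ 0) :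
    ∃ e, 0 < a e ∧ x ∈ (e : Sym2 V) := by
  by_contra! hne
  exact h (zero_dvd_iff.1 (dvd_mass fun e he => by rw [mass_single_of_notMem (hne e he)]))

lemma single_one_le {e : G.edgeSet} {a : G.edgeSet →₀ ℕ} (h : 0 < a e) :
    Finsupp.single e 1 ≤ a := by
  simpa [Nat.one_le_iff_ne_zero, Nat.pos_iff_ne_zero] using h

lemma single_add_single_le {e e' : G.edgeSet} (h : e ≠ e') {a : G.edgeSet →₀ ℕ} (he : 0 < a e)
    (he' : 0 < a e') : Finsupp.single e 1 + Finsupp.single e' 1 ≤ a := by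
  classical
  intro d
  rw [Finsupp.add_apply, Finsupp.single_apply, Finsupp.single_apply]
  split_ifs with h1 h2 h2
  · exact absurd (h1.trans h2.symm) h
  · rw [← h1]; omega
  · rw [← h2]; omega
  · omega

lemma two_le_mass {x : V} {e e' : G.edgeSet} (h : e ≠ e') {a : G.edgeSet →₀ ℕ} (he : 0 < a e)
    (he' : 0 < a e') (hx : x ∈ (e : Sym2 V)) (hx' : x ∈ (e' : Sym2 V)) : 2 ≤ mass {x} a := by
  have h1 := mass_mono {x} (single_add_single_le h he he')
  have h2 := one_le_mass_single hx
  have h3 := one_le_mass_single hx'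
  rw [mass_add] at h1
  omega

end Mass

/-! ### Monomials of the fiber, vertex by vertex -/

section Fiber

namespace CyclicWalk

variable {V : Type*} {G : SimpleGraph V} {n : ℕ} {c : CyclicWalk G n}

/-- The properties of the sequence of vertices of a strongly primitive walk all of whose chords are
odd: the two ends of an edge which is traversed once are not both visited twice, and no chord has an
end which is visited twice or two ends which are separated by a vertex which is visited twice. -/
structure IsStrong (c : CyclicWalk G n) : Prop extends c.IsPrim where
  single : ∀ i r k : ℤ, (∀ j, ¬ (n : ℤ) ∣ j - i → c.edge j ≠ c.edge i) → i < r → r < i + n →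
    c.vert i = c.vert r → i + 1 < k → k < i + 1 + n → c.vert (i + 1) = c.vert k → False
  chord_even : ∀ (e : G.edgeSet) (s t : ℤ), (∀ k, c.edge k ≠ e) →
    (e : Sym2 V) = s(c.vert s, c.vert t) → Even (t - s)
  chord_ne : ∀ (e : G.edgeSet) (s : ℤ), (∀ k, c.edge k ≠ e) →
    (∀ x ∈ (e : Sym2 V), ∃ i, c.vert i = x) → c.vert s ∈ (e : Sym2 V) → ∀ r, s < r → r < s + n → c.vert s ≠ c.vert r
  chord_sep : ∀ (e : G.edgeSet) (s t : ℤ), (∀ k, c.edge k ≠ e) →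
    (e : Sym2 V) = s(c.vert s, c.vert t) → ∀ a b, a < s → s < b → b < t → t < a + n →
      c.vert a ≠ c.vert b

variable {M : G.edgeSet →₀ ℕ}

open scoped Classical in
lemma mass_fiber (hn : Even n) (hM : deg M = deg (c.seg 0 0 n)) (S : Set V) (a : ℤ) :
    mass S M = ∑ k ∈ Finset.Ico a (a + n), if c.vert k ∈ S then 1 else 0 := by
  rw [mass, hM, ← c.seg_period hn 0 a, c.linearCombination_deg_seg hn]

/-- The degree is supported on the vertices of the walk, so an edge of `M` off the walk is a chord.
-/
lemma exists_vert_eq_of_mem (hn : Even n) (hM : deg M = deg (c.seg 0 0 n)) {e : G.edgeSet}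
    (he : 0 < M e) {x : V} (hx : x ∈ (e : Sym2 V)) : ∃ i, c.vert i = x := by
  by_contra! hne
  have h := mass_fiber hn hM {x} 0
  rw [Finset.sum_eq_zero fun k _ => if_neg (by simpa using hne k)] at h
  have h2 := mass_mono {x} (single_one_le he)
  have h3 := one_le_mass_single hx
  omega

lemma mass_fiber_of_forall_ne (hn : Even n) (h0 : 0 < n) (hM : deg M = deg (c.seg 0 0 n)) {s : ℤ}
    (hs : ∀ r, s < r → r < s + n → c.vert s ≠ c.vert r) : mass {c.vert s} M = 1 := by
  classical
  rw [mass_fiber hn hM _ s, Finset.sum_eq_single s]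
  · simp
  · intro k hk hks
    rw [Finset.mem_Ico] at hk
    exact if_neg fun e => hs k (by omega) hk.2 e.symm
  · intro h
    exact absurd (Finset.mem_Ico.2 ⟨le_rfl, by omega⟩) h

/-- In a monomial of the fiber there is just one edge at a vertex which is visited once. -/
lemma existsUnique_of_forall_ne (hn : Even n) (h0 : 0 < n) (hM : deg M = deg (c.seg 0 0 n)) {s : ℤ}
    (hs : ∀ r, s < r → r < s + n → c.vert s ≠ c.vert r) :
    ∃ e, 0 < M e ∧ c.vert s ∈ (e : Sym2 V) ∧
      ∀ e', 0 < M e' → c.vert s ∈ (e' : Sym2 V) → e' = e := by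
  have h1 := mass_fiber_of_forall_ne hn h0 hM hs
  obtain ⟨e, he, hse⟩ := exists_mem_of_mass_ne_zero (h1.trans_ne one_ne_zero)
  refine ⟨e, he, hse, fun e' he' hse' => ?_⟩
  by_contra hne
  have := two_le_mass hne he' he hse' hse
  omega

lemma mem_edge_left (i : ℤ) : c.vert i ∈ (c.edge i : Sym2 V) := by simp [edge_coe]

lemma mem_edge_right (i : ℤ) : c.vert i ∈ (c.edge (i - 1) : Sym2 V) := by simp [edge_coe]

lemma IsPrim.edge_ne_pred (hc : c.IsPrim) (i : ℤ) : c.edge i ≠ c.edge (i - 1) :=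
  hc.disj _ _ (by simp)

/-- The edges of the walk at the vertex in position `s`. -/
lemma exists_of_vert_mem_edge {x : V} {k : ℤ} (h : x ∈ (c.edge k : Sym2 V)) :
    ∃ m, c.vert m = x ∧ (c.edge k = c.edge m ∨ c.edge k = c.edge (m - 1)) := by
  rw [edge_coe, Sym2.mem_iff] at h
  rcases h with rfl | rfl
  · exact ⟨k, rfl, Or.inl rfl⟩
  · exact ⟨k + 1, rfl, Or.inr (by simp)⟩

lemma edge_eq_of_vert_mem {s k : ℤ} (h0 : 0 < n)
    (hs : ∀ r, s < r → r < s + n → c.vert s ≠ c.vert r) (h : c.vert s ∈ (c.edge k : Sym2 V)) :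
    c.edge k = c.edge s ∨ c.edge k = c.edge (s - 1) := by
  obtain ⟨m, hm, h⟩ := exists_of_vert_mem_edge h
  have hd := dvd_of_vert_eq_of_forall_ne h0 hs hm
  exact h.imp (fun h => h.trans (c.edge_congr hd))
    fun h => h.trans (c.edge_congr (by simpa using hd))

lemma IsPrim.edge_eq_of_vert_mem (hc : c.IsPrim) {a b k : ℤ} (hab : a < b) (hb : b < a + n)
    (hv : c.vert a = c.vert b) (h : c.vert a ∈ (c.edge k : Sym2 V)) :
    (c.edge k = c.edge a ∨ c.edge k = c.edge (b - 1)) ∨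
      (c.edge k = c.edge b ∨ c.edge k = c.edge (a - 1)) := by
  obtain ⟨m, hm, h⟩ := exists_of_vert_mem_edge h
  have h1 (i : ℤ) (hd : (n : ℤ) ∣ m - i) : c.edge k = c.edge i ∨ c.edge k = c.edge (i - 1) :=
    h.imp (fun h => h.trans (c.edge_congr hd))
      fun h => h.trans (c.edge_congr (by simpa using hd))
  have h2 := (hc.dvd_of_vert_eq hab hb hv hm).imp (h1 a) (h1 b)
  tauto

end CyclicWalk

end Fiber

/-! ### Parity at a repeated vertex -/

section Repeated

namespace CyclicWalk

variable {V : Type*} {G : SimpleGraph V} {n : ℕ} {c : CyclicWalk G n} {M : G.edgeSet →₀ ℕ}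

lemma IsPrim.mass_fiber_of_repeated (hc : c.IsPrim) (hM : deg M = deg (c.seg 0 0 n)) {a b : ℤ}
    (hab : a < b) (hb : b < a + n) (hv : c.vert a = c.vert b) : mass {c.vert a} M = 2 := by
  classical
  have hn := hc.pos
  have hsub : ({a, b} : Finset ℤ) ⊆ Finset.Ico a (a + n) := by
    intro k hk
    rw [Finset.mem_insert, Finset.mem_singleton] at hk
    rw [Finset.mem_Ico]
    omega
  rw [mass_fiber hc.even hM _ a, ← Finset.sum_subset hsub, Finset.sum_pair hab.ne,
    if_pos (Set.mem_singleton _), if_pos (Set.mem_singleton_iff.2 hv.symm)]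
  · norm_num
  · intro k hk hkab
    rw [Finset.mem_Ico] at hk
    refine if_neg fun h => hkab ?_
    rw [Finset.mem_insert, Finset.mem_singleton]
    exact (hc.dvd_of_vert_eq hab hb hv h).imp
      (dvd_sub_of_window (a := a) (by omega) (by omega) (by omega) (by omega))
      (dvd_sub_of_window (a := a) (by omega) (by omega) (by omega) (by omega))

/-- The vertices in the positions strictly between `a` and `b`. -/
def interior (c : CyclicWalk G n) (a b : ℤ) : Set V := {x | ∃ k, a < k ∧ k < b ∧ c.vert k = x}

lemma IsPrim.mem_interior_iff (hc : c.IsPrim) {a b k : ℤ} (hab : a < b) (hb : b < a + n)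
    (hv : c.vert a = c.vert b) (hak : a ≤ k) (hk : k < a + n) :
    c.vert k ∈ c.interior a b ↔ a < k ∧ k < b := by
  refine ⟨?_, fun h => ⟨k, h.1, h.2, rfl⟩⟩
  rintro ⟨m, ham, hmb, hm⟩
  have hma : c.vert m ≠ c.vert a := by
    intro h
    rcases hc.dvd_of_vert_eq hab hb hv h with h | h
    · have := dvd_sub_of_window (a := a) (by omega) (by omega) (by omega) (by omega) h
      omega
    · have := dvd_sub_of_window (a := a) (by omega) (by omega) (by omega) (by omega) h
      omega
  have hka : k ≠ a := by rintro rfl; exact hma hm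
  have hkb : k ≠ b := by rintro rfl; exact hma (hm.trans hv.symm)
  by_contra hne
  exact hc.noncross a m b k ham hmb (by omega) hk hv hm

lemma IsPrim.mass_interior (hc : c.IsPrim) (hM : deg M = deg (c.seg 0 0 n)) {a b : ℤ}
    (hab : a < b) (hb : b < a + n) (hv : c.vert a = c.vert b) :
    mass (c.interior a b) M = b - a - 1 := by
  classical
  rw [mass_fiber hc.even hM _ a, Finset.sum_ite, Finset.sum_const_zero, add_zero, Finset.sum_const,
    nsmul_one]
  have : Finset.filter (fun k => c.vert k ∈ c.interior a b) (Finset.Ico a (a + n)) =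
      Finset.Ioo a b := by
    ext k
    simp only [Finset.mem_filter, Finset.mem_Ico, Finset.mem_Ioo]
    constructor
    · rintro ⟨hk, h⟩
      exact (hc.mem_interior_iff hab hb hv hk.1 hk.2).1 h
    · intro h
      exact ⟨by omega, k, h.1, h.2, rfl⟩
  rw [this, Int.card_Ioo]
  omega

lemma add_one_lt_of_vert_eq {a b : ℤ} (hab : a < b)
    (hv : c.vert a = c.vert b) : a + 1 < b := by
  have : b ≠ a + 1 := by rintro rfl; exact c.vert_ne a hv
  omega

lemma IsPrim.mass_interior_single (hc : c.IsPrim) {a b : ℤ} (hab : a < b) (hb : b < a + n)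
    (hv : c.vert a = c.vert b) {e : G.edgeSet} (he : e = c.edge a ∨ e = c.edge (b - 1)) :
    mass (c.interior a b) (Finsupp.single e 1) = 1 := by
  have h1 := add_one_lt_of_vert_eq hab hv
  rcases he with rfl | rfl
  · rw [mass_single _ (c.edge_coe a), if_neg, if_pos]
    · norm_num
    · exact ⟨a + 1, by omega, h1, rfl⟩
    · rw [hc.mem_interior_iff hab hb hv le_rfl (by omega)]; omega
  · rw [mass_single _ (c.edge_coe (b - 1)), if_pos, if_neg]
    · norm_num
    · rw [sub_add_cancel, hc.mem_interior_iff hab hb hv hab.le hb]; omega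
    · exact ⟨b - 1, by omega, by omega, rfl⟩

/-- Only the edges `a` and `b - 1` have just one end in the interior. Other walk edges stay on one
side by `noncross`, and chords by `chord_ne` and `chord_sep`. -/
lemma IsStrong.two_dvd_mass_interior_single (hc : c.IsStrong) {a b : ℤ} (hab : a < b)
    (hb : b < a + n) (hv : c.vert a = c.vert b) {e : G.edgeSet}
    (hsupp : ∀ x ∈ (e : Sym2 V), ∃ i, c.vert i = x) (h1 : e ≠ c.edge a) (h2 : e ≠ c.edge (b - 1)) :
    2 ∣ mass (c.interior a b) (Finsupp.single e 1) := by
  have hn := hc.pos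
  have hmem {k : ℤ} (hak : a ≤ k) (hk : k < a + n) :=
    hc.mem_interior_iff (k := k) hab hb hv hak hk
  by_cases hch : ∃ k, c.edge k = e
  · obtain ⟨k', rfl⟩ := hch
    obtain ⟨k, hk1, hk2, hk⟩ := exists_rep hn a k'
    rw [c.edge_congr hk] at h1 h2 ⊢
    have hka : k ≠ a := by rintro rfl; exact h1 rfl
    have hkb : k ≠ b - 1 := by rintro rfl; exact h2 rfl
    rw [mass_single _ (c.edge_coe k)]
    by_cases hlt : k < b
    · rw [if_pos ((hmem hk1 hk2).2 (by omega)),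
        if_pos ((hmem (by omega) (by omega)).2 (by omega))]
      norm_num
    · rw [if_neg (mt (hmem hk1 hk2).1 (by omega)), if_neg]
      · norm_num
      · by_cases hk3 : k + 1 = a + n
        · rw [hk3, c.per]
          exact mt (hmem le_rfl (by omega)).1 (by omega)
        · exact mt (hmem (by omega) (by omega)).1 (by omega)
  · push Not at hch
    obtain ⟨e, he⟩ := e
    induction e with
    | h x y =>
    obtain ⟨s', hs'⟩ := hsupp x (by simp)
    obtain ⟨t', ht'⟩ := hsupp y (by simp)
    obtain ⟨s, hs1, hs2, hs⟩ := exists_rep hn a s'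
    obtain ⟨t, ht1, ht2, ht⟩ := exists_rep hn a t'
    rw [c.vert_congr hs] at hs'
    rw [c.vert_congr ht] at ht'
    subst hs' ht'
    have ne1 (p : ℤ) (hp : c.vert p ∈ (s(c.vert s, c.vert t) : Sym2 V)) : p ≠ a ∧ p ≠ b := by
      have := hc.chord_ne _ p hch hsupp hp
      constructor
      · rintro rfl; exact this b hab hb hv
      · rintro rfl; exact this (a + n) (by omega) (by omega) (by rw [c.per, hv])
    obtain ⟨hsa, hsb⟩ := ne1 s (by simp)
    obtain ⟨hta, htb⟩ := ne1 t (by simp)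
    have key : (a < s ∧ s < b ↔ a < t ∧ t < b) := by
      by_contra hne
      rcases lt_or_ge s b with h | h
      · exact hc.chord_sep _ s t hch rfl a b (by omega) h (by omega) ht2 hv
      · exact hc.chord_sep _ t s hch Sym2.eq_swap a b (by omega) (by omega) (by omega) hs2 hv
    rw [mass_single _ rfl]
    simp only [hmem hs1 hs2, hmem ht1 ht2, key]
    split_ifs <;> norm_num

lemma IsPrim.edge_ne_of_sides (hc : c.IsPrim) {a b : ℤ} (hab : a < b) (hb : b < a + n)
    (hv : c.vert a = c.vert b) {e e' : G.edgeSet} (he : e = c.edge a ∨ e = c.edge (b - 1))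
    (he' : e' = c.edge b ∨ e' = c.edge (a - 1)) : e ≠ e' := by
  have ho := hc.odd a b hab hb hv
  rw [Int.odd_iff] at ho
  rcases he with rfl | rfl <;> rcases he' with rfl | rfl <;>
    exact hc.disj _ _ (by rw [Int.odd_iff]; omega)

/-- A monomial of the fiber does not use edges on both sides of a vertex which is visited twice. -/
lemma IsStrong.not_both_sides (hc : c.IsStrong) (hM : deg M = deg (c.seg 0 0 n)) {a b : ℤ}
    (hab : a < b) (hb : b < a + n) (hv : c.vert a = c.vert b) {e e' : G.edgeSet}
    (he : e = c.edge a ∨ e = c.edge (b - 1)) (he' : e' = c.edge b ∨ e' = c.edge (a - 1))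
    (hMe : 0 < M e) (hMe' : 0 < M e') : False := by
  have hmem {d : G.edgeSet} (hd : d = c.edge a ∨ d = c.edge (b - 1)) :
      c.vert a ∈ (d : Sym2 V) := by
    rcases hd with rfl | rfl
    · exact mem_edge_left a
    · rw [hv]; exact mem_edge_right b
  have hmem' : c.vert a ∈ (e' : Sym2 V) := by
    rcases he' with rfl | rfl
    · rw [hv]; exact mem_edge_left b
    · exact mem_edge_right a
  obtain ⟨N, hN⟩ := exists_add_of_le (single_one_le hMe)
  have hle (d : G.edgeSet) (hd : 0 < N d) : 0 < M d := by
    rw [hN, Finsupp.add_apply]; omega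
  have hNe' : 0 < N e' := by
    rw [hN, Finsupp.add_apply,
      Finsupp.single_eq_of_ne (hc.edge_ne_of_sides hab hb hv he he').symm] at hMe'
    omega
  have h2 := hc.mass_fiber_of_repeated hM hab hb hv
  have h1 := one_le_mass_single (hmem he)
  have h3 := hc.mass_interior hM hab hb hv
  rw [hN, mass_add] at h2 h3
  rw [hc.mass_interior_single hab hb hv he] at h3
  -- The degree two at the repeated vertex is used up by `e` and `e'`, so `e` is the only edge with
  -- odd mass on the interior. But the total mass there is `b - a - 1`, which is even.
  have h4 : 2 ∣ mass (c.interior a b) N := by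
    refine dvd_mass fun d hd => ?_
    have hnd : ¬ (d = c.edge a ∨ d = c.edge (b - 1)) := by
      intro h
      have := two_le_mass (hc.edge_ne_of_sides hab hb hv h he') hd hNe' (hmem h) hmem'
      omega
    rw [not_or] at hnd
    exact hc.two_dvd_mass_interior_single hab hb hv
      (fun x hx => exists_vert_eq_of_mem hc.even hM (hle d hd) hx) hnd.1 hnd.2
  have h5 := hc.odd a b hab hb hv
  rw [Int.odd_iff] at h5
  omega

end CyclicWalk

end Repeated

/-! ### Alternation along the walk, and crossing chords -/

section Alternation

lemma mass_single_of_mem {V : Type*} {G : SimpleGraph V} {x : V} {e : G.edgeSet}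
    (hx : x ∈ (e : Sym2 V)) : mass {x} (Finsupp.single e 1) = 1 := by
  obtain ⟨e, he⟩ := e
  obtain ⟨y, rfl⟩ := hx
  rw [mass_single _ rfl, if_pos (Set.mem_singleton x), if_neg, add_zero]
  exact (G.ne_of_adj he).symm

namespace CyclicWalk

variable {V : Type*} {G : SimpleGraph V} {n : ℕ} {c : CyclicWalk G n} {M : G.edgeSet →₀ ℕ}

/-- The single edge `e` has to supply the degree two at `x`, so it occurs twice in `M`, and its
other end also has degree at least two. -/
lemma exists_repeat_of_forall_eq (hn : Even n) (h0 : 0 < n) (hM : deg M = deg (c.seg 0 0 n))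
    {x : V} (hx : mass {x} M = 2) {e : G.edgeSet} (hxe : x ∈ (e : Sym2 V))
    (he : ∀ d, 0 < M d → x ∈ (d : Sym2 V) → d = e) {s : ℤ} (hs : c.vert s ∈ (e : Sym2 V)) :
    0 < M e ∧ ∃ r, s < r ∧ r < s + n ∧ c.vert s = c.vert r := by
  obtain ⟨d, hd, hxd⟩ := exists_mem_of_mass_ne_zero (hx.trans_ne two_ne_zero)
  obtain rfl := he d hd hxd
  refine ⟨hd, ?_⟩
  by_contra! hne
  have h1 := mass_fiber_of_forall_ne hn h0 hM hne
  obtain ⟨N, rfl⟩ := exists_add_of_le (single_one_le hd)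
  rw [mass_add, mass_single_of_mem hxd] at hx
  obtain ⟨d', hd', hxd'⟩ := exists_mem_of_mass_ne_zero (x := x) (a := N) (by omega)
  have h3 : d' = d := he d' (by rw [Finsupp.add_apply]; omega) hxd'
  rw [h3] at hd'
  have h2 := mass_mono {c.vert s} (single_one_le hd')
  rw [mass_add] at h1
  rw [mass_single_of_mem hs] at h1 h2
  omega

/-- If a monomial of the fiber uses no edge on one side of a vertex which is visited twice, then it
uses both edges on the other side. -/
lemma IsStrong.both_of_side (hc : c.IsStrong) (hM : deg M = deg (c.seg 0 0 n)) {a b : ℤ}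
    (hab : a < b) (hb : b < a + n) (hv : c.vert a = c.vert b) (h1 : M (c.edge b) = 0)
    (h2 : M (c.edge (a - 1)) = 0) : 0 < M (c.edge a) ∧ 0 < M (c.edge (b - 1)) := by
  have hmass := hc.mass_fiber_of_repeated hM hab hb hv
  have hcases (d : G.edgeSet) (hd : 0 < M d) (hvd : c.vert a ∈ (d : Sym2 V)) :
      d = c.edge a ∨ d = c.edge (b - 1) := by
    by_cases hch : ∃ k, c.edge k = d
    · obtain ⟨k, rfl⟩ := hch
      rcases hc.edge_eq_of_vert_mem hab hb hv hvd with h | h | h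
      · exact h
      · rw [h] at hd; omega
      · rw [h] at hd; omega
    · push Not at hch
      exact absurd hv (hc.chord_ne d a hch
        (fun _ => exists_vert_eq_of_mem hc.even hM hd) hvd b hab hb)
  have hloc (i j : ℤ) (hvi : c.vert a ∈ (c.edge i : Sym2 V)) (e : c.edge j = c.edge i) :
      ((n : ℤ) ∣ j - a ∨ (n : ℤ) ∣ j - b) ∨ ((n : ℤ) ∣ j + 1 - a ∨ (n : ℤ) ∣ j + 1 - b) := by
    rw [← e, edge_coe, Sym2.mem_iff] at hvi
    exact hvi.imp (fun h => hc.dvd_of_vert_eq hab hb hv h.symm)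
      fun h => hc.dvd_of_vert_eq hab hb hv h.symm
  constructor
  · by_contra h0
    have hall (d : G.edgeSet) (hd : 0 < M d) (hvd : c.vert a ∈ (d : Sym2 V)) :
        d = c.edge (b - 1) := by
      refine (hcases d hd hvd).resolve_left ?_
      rintro rfl
      exact h0 hd
    have hvb : c.vert a ∈ (c.edge (b - 1) : Sym2 V) := by rw [hv]; exact mem_edge_right b
    -- If the edge `a` is not used, both ends of the edge `b - 1` are visited twice, against
    -- `single`. A second traversal would identify it with the edge `a`, `b` or `a - 1`, each of
    -- which is excluded.
    obtain ⟨hpos, r, hr1, hr2, hr⟩ :=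
      exists_repeat_of_forall_eq hc.even hc.pos hM hmass hvb hall (mem_edge_left (b - 1))
    refine hc.single (b - 1) r (a + n) (fun j hj e => ?_) hr1 hr2 hr (by omega) (by omega)
      (by rw [sub_add_cancel, c.per, hv])
    rcases hloc _ j hvb e with (h | h) | (h | h)
    · rw [← e, c.edge_congr h] at hpos
      exact h0 hpos
    · exact hc.edge_ne_pred b (by rw [← e, c.edge_congr h])
    · rw [← e, c.edge_congr (show (n : ℤ) ∣ j - (a - 1) by rwa [sub_sub_eq_add_sub])] at hpos
      omega
    · exact hj (by rwa [sub_sub_eq_add_sub])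
  · by_contra h0
    have hall (d : G.edgeSet) (hd : 0 < M d) (hvd : c.vert a ∈ (d : Sym2 V)) : d = c.edge a := by
      refine (hcases d hd hvd).resolve_right ?_
      rintro rfl
      exact h0 hd
    obtain ⟨hpos, r, hr1, hr2, hr⟩ := exists_repeat_of_forall_eq hc.even hc.pos hM hmass
      (mem_edge_left a) hall (s := a + 1) (by simp [edge_coe])
    refine hc.single a b r (fun j hj e => ?_) hab hb hv hr1 hr2 hr
    rcases hloc _ j (mem_edge_left a) e with (h | h) | (h | h)
    · exact hj h
    · rw [← e, c.edge_congr h] at hpos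
      omega
    · refine hc.edge_ne_pred a ?_
      rw [← e, c.edge_congr (show (n : ℤ) ∣ j - (a - 1) by rwa [sub_sub_eq_add_sub])]
    · rw [← e, c.edge_congr (show (n : ℤ) ∣ j - (b - 1) by rwa [sub_sub_eq_add_sub])] at hpos
      exact h0 hpos

/-- At a vertex which is not on a chord of it, a monomial of the fiber uses just one of two
consecutive edges of the walk. -/
lemma IsStrong.pos_iff_of_forall_notMem (hc : c.IsStrong) (hM : deg M = deg (c.seg 0 0 n)) {p : ℤ}
    (hp : ∀ d, 0 < M d → c.vert p ∈ (d : Sym2 V) → ∃ k, c.edge k = d) :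
    0 < M (c.edge p) ↔ M (c.edge (p - 1)) = 0 := by
  by_cases hs : ∀ r, p < r → r < p + n → c.vert p ≠ c.vert r
  · obtain ⟨e, he, hpe, huniq⟩ := existsUnique_of_forall_ne hc.even hc.pos hM hs
    obtain ⟨k, rfl⟩ := hp e he hpe
    have hne := hc.edge_ne_pred p
    constructor
    · intro h
      by_contra h0
      exact hne ((huniq _ h (mem_edge_left p)).trans
        (huniq _ (Nat.pos_of_ne_zero h0) (mem_edge_right p)).symm)
    · intro h
      rcases c.edge_eq_of_vert_mem hc.pos hs hpe with h1 | h1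
      · rwa [← h1]
      · rw [h1] at he; omega
  · push Not at hs
    obtain ⟨r, hpr, hr, hv⟩ := hs
    have hv' : c.vert r = c.vert (p + n) := by rw [c.per, hv]
    have hp1 : c.edge (p + n) = c.edge p := c.edge_add p
    have hp2 : c.edge (p + n - 1) = c.edge (p - 1) := c.edge_congr (by simp)
    constructor
    · intro h
      by_contra h0
      exact hc.not_both_sides hM hpr hr hv (Or.inl rfl) (Or.inr rfl) h (Nat.pos_of_ne_zero h0)
    · intro h
      by_cases hr0 : M (c.edge r) = 0
      · exact (hc.both_of_side hM hpr hr hv hr0 h).1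
      · by_contra h1
        -- The other side of the vertex is the window from `r` to `p + n`. If it supplied all the
        -- degree there, the edge `p - 1` would be used.
        have h2 := (hc.both_of_side hM hr (by omega) hv' (by rw [hp1]; omega) (by
          by_contra h3
          exact hc.not_both_sides hM hpr hr hv (Or.inr rfl) (Or.inl rfl) (Nat.pos_of_ne_zero h3)
            (Nat.pos_of_ne_zero hr0))).2
        rw [hp2] at h2
        omega

/-- A monomial of the fiber has no other edge at an end of a chord of it. -/
lemma IsStrong.eq_of_chord (hc : c.IsStrong) (hM : deg M = deg (c.seg 0 0 n)) {p : ℤ}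
    {f : G.edgeSet} (hf : ∀ k, c.edge k ≠ f) (hMf : 0 < M f) (hp : c.vert p ∈ (f : Sym2 V))
    {d : G.edgeSet} (hd : 0 < M d) (hpd : c.vert p ∈ (d : Sym2 V)) : d = f := by
  obtain ⟨e, -, -, huniq⟩ :=
    existsUnique_of_forall_ne hc.even hc.pos hM fun r =>
      hc.chord_ne f p hf (fun _ => exists_vert_eq_of_mem hc.even hM hMf) hp r
  rw [huniq d hd hpd, huniq f hMf hp]

lemma IsStrong.eq_zero_of_chord (hc : c.IsStrong) (hM : deg M = deg (c.seg 0 0 n)) {p : ℤ}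
    {f : G.edgeSet} (hf : ∀ k, c.edge k ≠ f) (hMf : 0 < M f) (hp : c.vert p ∈ (f : Sym2 V)) :
    M (c.edge p) = 0 ∧ M (c.edge (p - 1)) = 0 := by
  constructor <;> by_contra h
  · exact hf _ (hc.eq_of_chord hM hf hMf hp (Nat.pos_of_ne_zero h) (mem_edge_left p))
  · exact hf _ (hc.eq_of_chord hM hf hMf hp (Nat.pos_of_ne_zero h) (mem_edge_right p))

/-- A monomial of the fiber without chords uses only even, or only odd edges of the walk. -/
lemma IsStrong.pos_iff_of_forall_exists (hc : c.IsStrong) (hM : deg M = deg (c.seg 0 0 n))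
    (hch : ∀ d, 0 < M d → ∃ k, c.edge k = d) (p : ℤ) :
    0 < M (c.edge p) ↔ (Even p ↔ 0 < M (c.edge 0)) := by
  have step (p : ℤ) : 0 < M (c.edge p) ↔ ¬ 0 < M (c.edge (p - 1)) := by
    rw [hc.pos_iff_of_forall_notMem hM fun d hd _ => hch d hd, Nat.pos_iff_ne_zero, not_not]
  induction p with
  | zero => simp
  | succ k ih =>
    have h1 := step (k + 1)
    have h2 : Even (k + 1 : ℤ) ↔ ¬ Even (k : ℤ) := Int.even_add_one
    rw [add_sub_cancel_right] at h1
    tauto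
  | pred k ih =>
    have h1 := step (-k)
    have h2 : Even (-k - 1 : ℤ) ↔ ¬ Even (-k : ℤ) := by
      simp only [Int.even_iff]
      omega
    tauto

/-- A shortest chord of a monomial of the fiber is crossed by another chord of it, in such a way
that their ends have different parities. -/
lemma IsStrong.exists_crossing (hc : c.IsStrong) (hM : deg M = deg (c.seg 0 0 n))
    {f₀ : G.edgeSet} (hf₀ : ∀ k, c.edge k ≠ f₀) (hMf₀ : 0 < M f₀) :
    ∃ (f f' : G.edgeSet) (s t j k : ℤ), 0 < M f ∧ 0 < M f' ∧ (∀ k, c.edge k ≠ f) ∧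
      (∀ k, c.edge k ≠ f') ∧ (f : Sym2 V) = s(c.vert s, c.vert j) ∧
      (f' : Sym2 V) = s(c.vert t, c.vert k) ∧ s < t ∧ t < j ∧ j < k ∧ k < s + n ∧ Odd (t - s) := by
  have hn := hc.pos
  -- `m` is the length of an arc spanned by a chord of the monomial; the least one is taken.
  let P (m : ℕ) : Prop := ∃ (f : G.edgeSet) (s : ℤ), 0 < M f ∧ (∀ k, c.edge k ≠ f) ∧
    (f : Sym2 V) = s(c.vert s, c.vert (s + m)) ∧ 0 < m ∧ m < n
  have locate (f : G.edgeSet) (hMf : 0 < M f) (x : V) (hx : x ∈ (f : Sym2 V)) (a : ℤ) :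
      ∃ i, c.vert i = x ∧ a ≤ i ∧ i < a + n := by
    obtain ⟨i, hi⟩ := exists_vert_eq_of_mem hc.even hM hMf hx
    obtain ⟨j, h1, h2, h3⟩ := exists_rep hn a i
    exact ⟨j, by rw [← hi, c.vert_congr h3], h1, h2⟩
  have other (f : G.edgeSet) (hMf : 0 < M f) (s : ℤ) (hs : c.vert s ∈ (f : Sym2 V)) :
      ∃ k, (f : Sym2 V) = s(c.vert s, c.vert k) ∧ s < k ∧ k < s + n := by
    obtain ⟨y, hy⟩ := hs
    obtain ⟨k, rfl, hk1, hk2⟩ := locate f hMf y (by rw [hy]; simp) s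
    refine ⟨k, hy, lt_of_le_of_ne hk1 ?_, hk2⟩
    rintro rfl
    obtain ⟨f, hf⟩ := f
    obtain rfl : f = _ := hy
    exact G.loopless.irrefl _ hf
  have hP : ∃ m, P m := by
    obtain ⟨x, hx⟩ : ∃ x, x ∈ (f₀ : Sym2 V) := ⟨_, Sym2.out_fst_mem _⟩
    obtain ⟨s, rfl, -, -⟩ := locate f₀ hMf₀ x hx 0
    obtain ⟨k, h1, h2, h3⟩ := other f₀ hMf₀ s hx
    refine ⟨(k - s).toNat, f₀, s, hMf₀, hf₀, ?_, by omega, by omega⟩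
    rw [h1, show s + ((k - s).toNat : ℤ) = k by omega]
  classical
  obtain ⟨f, s, hMf, hf, hfs, hm0, hmn⟩ := Nat.find_spec hP
  have hmin : ∀ k < Nat.find hP, ¬ P k := fun k => Nat.find_min hP
  generalize Nat.find hP = m at *
  have hsupp : ∀ x ∈ (f : Sym2 V), ∃ i, c.vert i = x :=
    fun _ => exists_vert_eq_of_mem hc.even hM hMf
  have hevf := hc.chord_even f s _ hf hfs
  have hsf : c.vert s ∈ (f : Sym2 V) := by rw [hfs]; simp
  have hjf : c.vert (s + m) ∈ (f : Sym2 V) := by rw [hfs]; simp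
  have hs0 := hc.eq_zero_of_chord hM hf hMf hsf
  have hj0 := hc.eq_zero_of_chord hM hf hMf hjf
  -- `s + l` is the first position after `s` at which a chord of the monomial ends.
  let Q (l : ℕ) : Prop := 0 < l ∧ ∃ f', 0 < M f' ∧ (∀ k, c.edge k ≠ f') ∧
    c.vert (s + l) ∈ (f' : Sym2 V)
  have hQ : ∃ l, Q l := ⟨m, hm0, f, hMf, hf, hjf⟩
  obtain ⟨hl0, f', hMf', hf', htf'⟩ := Nat.find_spec hQ
  have hlm : Nat.find hQ ≤ m := Nat.find_min' hQ ⟨hm0, f, hMf, hf, hjf⟩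
  have hlmin : ∀ k < Nat.find hQ, ¬ Q k := fun k => Nat.find_min hQ
  generalize Nat.find hQ = l at *
  have alt (i : ℕ) (hi : i < l) : 0 < M (c.edge (s + i)) ↔ Odd i := by
    induction i with
    | zero => simp [hs0.1]
    | succ i ih =>
      have h1 := hc.pos_iff_of_forall_notMem hM (p := s + (i + 1 : ℕ)) (fun d hd hpd => by
        by_contra! hne
        exact hlmin (i + 1) hi ⟨by omega, d, hd, hne, hpd⟩)
      rw [h1, show s + ((i + 1 : ℕ) : ℤ) - 1 = s + i by push_cast; ring, Nat.odd_add_one,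
        ← ih (by omega)]
      omega
  -- Strictly between `s` and `s + l` the walk edges alternate between unused and used. The edges
  -- adjacent to the chord ends, first and last on this arc, are both unused, so its length is odd,
  -- whereas `m` is even.
  have hodd : Odd l := by
    have h1 := alt (l - 1) (by omega)
    have h2 := (hc.eq_zero_of_chord hM hf' hMf' htf').2
    rw [show s + (l : ℤ) - 1 = s + (l - 1 : ℕ) by omega] at h2
    rw [h2] at h1
    rw [Nat.odd_iff] at *
    omega
  have hlm' : l ≠ m := by
    rintro rfl
    rw [Nat.odd_iff] at hodd
    rw [Int.even_iff] at hevf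
    omega
  have hff' : f' ≠ f := by
    rintro rfl
    rw [hfs, Sym2.mem_iff] at htf'
    rcases htf' with h | h
    · exact hc.chord_ne f' s hf hsupp hsf (s + l) (by omega) (by omega) h.symm
    · exact hc.chord_ne f' (s + l) hf hsupp (by rw [hfs, h]; simp) (s + m) (by omega) (by omega) h
  obtain ⟨k, hfk, hk1, hk2⟩ := other f' hMf' _ htf'
  have hkf' : c.vert k ∈ (f' : Sym2 V) := by rw [hfk]; simp
  have hkj : k ≠ s + m := by
    rintro rfl
    exact hff' (hc.eq_of_chord hM hf hMf hjf hMf' hkf')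
  have hks : k ≠ s + n := by
    rintro rfl
    rw [c.per] at hkf'
    exact hff' (hc.eq_of_chord hM hf hMf hsf hMf' hkf')
  -- Otherwise `f'` would end on the arc of `f` and span a shorter one, against the choice of `m`.
  have hjk : s + m < k := by
    by_contra hlt
    refine hmin (k - (s + l)).toNat (by omega) ⟨f', s + l, hMf', hf', ?_, by omega, by omega⟩
    rw [hfk, show s + l + ((k - (s + l)).toNat : ℤ) = k by omega]
  have hkn : k < s + n := by
    by_contra hlt
    refine hmin (s + l + n - k).toNat (by omega) ⟨f', k - n, hMf', hf', ?_, by omega, by omega⟩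
    rw [hfk, Sym2.eq_swap, ← c.per (k - n), sub_add_cancel,
      show k - n + ((s + l + n - k).toNat : ℤ) = s + l by omega]
  refine ⟨f, f', s, s + l, s + m, k, hMf, hMf', hf, hf', hfs, hfk, by omega, by omega, hjk, hkn, ?_⟩
  rw [add_sub_cancel_left]
  exact_mod_cast hodd

end CyclicWalk

end Alternation

/-! ### All edges of a monomial have one type -/

section Sufficiency

open CyclicWalk

variable {V : Type*} {G : SimpleGraph V} {u : V} {w : G.Walk u u} {hpos : 0 < w.length}

lemma isChord_of_forall_ne {e : G.edgeSet} (he : ∀ k, (ofWalk w hpos).edge k ≠ e)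
    (hsupp : ∀ x ∈ (e : Sym2 V), ∃ i, (ofWalk w hpos).vert i = x) : IsChord w e := by
  refine ⟨e.2, fun x hx => (mem_support_iff_exists x).2 (hsupp x hx), fun h => ?_⟩
  obtain ⟨k, hk⟩ := (mem_edges_iff_exists (hpos := hpos) _).1 h
  exact he k (Subtype.ext hk)

/-- The positions of the ends of an odd chord have the same parity. -/
lemma CyclicWalk.IsPrim.even_of_isOddChord [Finite V] (hc : (ofWalk w hpos).IsPrim) {s t : ℤ}
    (hf : IsOddChord w s((ofWalk w hpos).vert s, (ofWalk w hpos).vert t)) : Even (t - s) := by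
  obtain ⟨hch, hb, i, j, ⟨hij, hj, he⟩, hodd, -⟩ := hf
  have hev := hc.even_cast
  rw [Nat.odd_iff] at hodd
  rw [← ofWalk_vert (hpos := hpos) (k := i) (by omega), ← ofWalk_vert (hpos := hpos) hj.le] at he
  have hdvd (p q : ℤ) (hp : (ofWalk w hpos).vert p = (ofWalk w hpos).vert q)
      (hq : (ofWalk w hpos).vert q ∈
        (s((ofWalk w hpos).vert s, (ofWalk w hpos).vert t) : Sym2 V)) : Even (p - q) := by
    obtain ⟨m, hm⟩ := dvd_of_vert_eq_of_forall_ne hc.pos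
      (hc.vert_ne_of_not_isBridgeChord hch hb hq) hp
    rw [hm]
    exact hev.mul_right m
  rcases Sym2.eq_iff.1 he with ⟨h1, h2⟩ | ⟨h1, h2⟩
  · have e1 := hdvd _ _ h1.symm (by simp)
    have e2 := hdvd _ _ h2.symm (by simp)
    rw [Int.even_iff] at *
    omega
  · have e1 := hdvd _ _ h1.symm (by simp)
    have e2 := hdvd _ _ h2.symm (by simp)
    rw [Int.even_iff] at *
    omega

lemma IsStronglyPrimitive.isStrong [Finite V] (hw : Even w.length) (hs : IsStronglyPrimitive w)
    (hodd : ∀ f : Sym2 V, IsChord w f → IsOddChord w f) : (ofWalk w hpos).IsStrong := by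
  have hc := hs.1.isPrim hpos hw
  have hch (e : G.edgeSet) (s t : ℤ) (he : ∀ k, (ofWalk w hpos).edge k ≠ e)
      (hst : (e : Sym2 V) = s((ofWalk w hpos).vert s, (ofWalk w hpos).vert t)) :
      IsOddChord w e := by
    refine hodd _ (isChord_of_forall_ne he ?_)
    rw [hst]
    intro x hx
    rcases Sym2.mem_iff.1 hx with rfl | rfl <;> exact ⟨_, rfl⟩
  refine ⟨hc, fun i r k h1 h2 h3 h4 h5 h6 h7 =>
    hc.not_isStronglyPrimitive h1 h2 h3 h4 h5 h6 h7 hs, ?_, ?_, ?_⟩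
  · intro e s t he hst
    have := hch e s t he hst
    rw [hst] at this
    exact hc.even_of_isOddChord this
  · intro e s he hsupp hse r hsr hr
    have := hodd _ (isChord_of_forall_ne he hsupp)
    exact hc.vert_ne_of_not_isBridgeChord this.1 this.2.1 hse r hsr hr
  · intro e s t he hst a b h1 h2 h3 h4
    have := hch e s t he hst
    rw [hst] at this
    exact hc.vert_ne_of_separates this.1 this.2.1 h1 h2 h3 h4

/-- Two odd chords with interlacing ends of different parities cross effectively. -/
lemma crossEffectively_of_lt (hw : Even w.length) {f f' : Sym2 V} (hf : IsOddChord w f)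
    (hf' : IsOddChord w f')
    {s t j k : ℤ} (hfs : f = s((ofWalk w hpos).vert s, (ofWalk w hpos).vert j))
    (hft : f' = s((ofWalk w hpos).vert t, (ofWalk w hpos).vert k)) (hst : s < t) (htj : t < j)
    (hjk : j < k) (hk : k < s + w.length) (hodd : Odd (t - s)) (hevj : Even (j - s))
    (hevk : Even (k - t)) : CrossEffectively w f f' := by
  refine ⟨hf, hf', ?_⟩
  obtain ⟨s₀, h1, h2, m, hm⟩ := exists_rep hpos 0 s
  have hev : Even ((w.length : ℤ) * m) := Even.mul_right (by exact_mod_cast hw) m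
  have hshift (p : ℤ) : ∃ p₀ : ℤ, p = p₀ + w.length * m ∧
      (ofWalk w hpos).vert p = (ofWalk w hpos).vert p₀ :=
    ⟨p - w.length * m, by ring, (ofWalk w hpos).vert_congr ⟨m, by ring⟩⟩
  obtain ⟨t₀, ht, ht'⟩ := hshift t
  obtain ⟨j₀, hj, hj'⟩ := hshift j
  obtain ⟨k₀, hk₀, hk'⟩ := hshift k
  have hs' := (ofWalk w hpos).vert_congr ⟨m, hm⟩
  rw [hs', hj'] at hfs
  rw [ht', hk'] at hft
  have hjoin (p q : ℤ) (f : Sym2 V)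
      (h : f = s((ofWalk w hpos).vert p, (ofWalk w hpos).vert q)) (hp : 0 ≤ p) (hpq : p < q)
      (hq : q < w.length) : JoinsAt w f p.toNat q.toNat := by
    refine ⟨by omega, by omega, ?_⟩
    rw [h, ← ofWalk_vert (hpos := hpos) (by omega), ← ofWalk_vert (hpos := hpos) (by omega),
      Int.toNat_of_nonneg hp, Int.toNat_of_nonneg (by omega)]
  have hsub (p : ℤ) : (ofWalk w hpos).vert p = (ofWalk w hpos).vert (p - w.length) :=
    (ofWalk w hpos).vert_congr ⟨1, by ring⟩
  have hwl : Even (w.length : ℤ) := by exact_mod_cast hw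
  rw [Int.odd_iff] at hodd
  rw [Int.even_iff] at hevj hevk hwl hev
  -- With `s₀` in the first period, the last few of `t₀`, `j₀`, `k₀` may exceed it. Moving them back
  -- by a period rotates the cyclic order, which accounts for the alternatives of
  -- `CrossEffectively`.
  by_cases c1 : k₀ < w.length
  · exact ⟨_, _, _, _, hjoin s₀ j₀ f hfs h1 (by omega) (by omega),
      hjoin t₀ k₀ f' hft (by omega) (by omega) c1, by rw [Nat.odd_iff]; omega, Or.inl (by omega)⟩
  rw [hsub k₀, Sym2.eq_swap] at hft
  by_cases c2 : j₀ < w.length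
  · exact ⟨_, _, _, _, hjoin s₀ j₀ f hfs h1 (by omega) (by omega),
      hjoin (k₀ - w.length) t₀ f' hft (by omega) (by omega) (by omega),
      by rw [Nat.odd_iff]; omega, Or.inr (by omega)⟩
  rw [hsub j₀, Sym2.eq_swap] at hfs
  by_cases c3 : t₀ < w.length
  · exact ⟨_, _, _, _, hjoin (j₀ - w.length) s₀ f hfs (by omega) (by omega) (by omega),
      hjoin (k₀ - w.length) t₀ f' hft (by omega) (by omega) (by omega),
      by rw [Nat.odd_iff]; omega, Or.inl (by omega)⟩
  rw [hsub t₀, Sym2.eq_swap] at hft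
  exact ⟨_, _, _, _, hjoin (j₀ - w.length) s₀ f hfs (by omega) (by omega) (by omega),
    hjoin (t₀ - w.length) (k₀ - w.length) f' hft (by omega) (by omega) (by omega),
    by rw [Nat.odd_iff]; omega, Or.inr (by omega)⟩

/-- The edges of the walk in positions `≡ ε`, and the chords of the `F₄` with such edges. -/
def HasType (w : G.Walk u u) (hpos : 0 < w.length) (ε : ℤ) (e : G.edgeSet) : Prop :=
  (∃ i, Even (i + ε) ∧ (ofWalk w hpos).edge i = e) ∨
    ∃ (a b : Fin w.length) (f' : Sym2 V), Even (((a : ℕ) : ℤ) + ε) ∧ IsF4 w a b e f'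

open scoped Classical in
/-- The edges of a monomial in the fiber of a walk all have the same type, if no two odd chords
cross strongly effectively. -/
lemma CyclicWalk.IsStrong.forall_hasType (hc : (ofWalk w hpos).IsStrong)
    (hodd : ∀ f : Sym2 V, IsChord w f → IsOddChord w f)
    (hcross : ¬ ∃ f f' : Sym2 V, CrossStronglyEffectively w f f') (N : ℕ) :
    ∀ M : G.edgeSet →₀ ℕ, deg M = deg ((ofWalk w hpos).seg 0 0 w.length) →
      (M.filter fun e => ∀ k, (ofWalk w hpos).edge k ≠ e).degree ≤ N →
      ∃ ε : ℤ, ∀ e, 0 < M e → HasType w hpos ε e := by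
  -- `N` bounds the number of chords in `M`, with multiplicity.
  induction N using Nat.strong_induction_on with
  | h N ih =>
  intro M hM hN
  by_cases hch : ∀ d, 0 < M d → ∃ k, (ofWalk w hpos).edge k = d
  · have hp := hc.pos_iff_of_forall_exists hM hch
    by_cases h0 : 0 < M ((ofWalk w hpos).edge 0)
    · refine ⟨0, fun e he => Or.inl ?_⟩
      obtain ⟨k, rfl⟩ := hch e he
      rw [hp k] at he
      exact ⟨k, by rw [add_zero]; exact he.2 h0, rfl⟩
    · refine ⟨1, fun e he => Or.inl ?_⟩
      obtain ⟨k, rfl⟩ := hch e he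
      rw [hp k] at he
      exact ⟨k, by rw [Int.even_add_one]; tauto, rfl⟩
  · push Not at hch
    obtain ⟨f₀, hMf₀, hf₀⟩ := hch
    obtain ⟨f, f', s, t, j, k, hMf, hMf', hf, hf', hfs, hft, hst, htj, hjk, hk, hts⟩ :=
      hc.exists_crossing hM hf₀ hMf₀
    have hchord {d : G.edgeSet} (hd : ∀ k, (ofWalk w hpos).edge k ≠ d) (hMd : 0 < M d) :
        IsOddChord w d :=
      hodd _ (isChord_of_forall_ne hd fun _ => exists_vert_eq_of_mem hc.even hM hMd)
    have hcr : CrossEffectively w f f' := crossEffectively_of_lt hc.even (hchord hf hMf)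
      (hchord hf' hMf') hfs hft hst htj hjk hk hts (hc.chord_even f s j hf hfs)
      (hc.chord_even f' t k hf' hft)
    obtain ⟨a, b, hF⟩ : ∃ a b : Fin w.length, IsF4 w a b f f' := by
      by_contra hne
      exact hcross ⟨f, f', hcr, hne⟩
    obtain ⟨hab, hpar, -, x, y, z, v, hnd, e1, e2, e3, e4⟩ := hF
    have hff' : f ≠ f' := by
      rintro rfl
      rw [e2] at e4
      simp only [List.nodup_cons, List.mem_cons, List.not_mem_nil, or_false, not_or] at hnd
      rcases Sym2.eq_iff.1 e4 with h | h
      · exact hnd.1.2.1 h.2.symm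
      · exact hnd.1.1 h.1.symm
    obtain ⟨M₀, rfl⟩ := exists_add_of_le (single_add_single_le hff' hMf hMf')
    have hedge (i : Fin w.length) : ¬ ∀ k, (ofWalk w hpos).edge k ≠ edgeAt w i := by
      push Not
      exact ⟨(i : ℕ), ofWalk_edge i⟩
    have hsw : deg (Finsupp.single (edgeAt w a) 1 + Finsupp.single (edgeAt w b) 1) =
        deg (Finsupp.single f 1 + Finsupp.single f' 1) := by
      rw [deg_add, deg_add, deg_single, deg_single, deg_single, deg_single, e1, e2, e3, e4]
      simp only [edgeVec_mk, one_smul]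
      abel
    -- The chords of the `F₄` are exchanged for its walk edges; the degree is the same and two
    -- chords fewer remain.
    obtain ⟨ε, hε⟩ := ih (M₀.filter fun e => ∀ k, (ofWalk w hpos).edge k ≠ e).degree (by
        rw [Finsupp.filter_add, Finsupp.filter_add, Finsupp.filter_single_of_pos _ hf,
          Finsupp.filter_single_of_pos _ hf', map_add, map_add, Finsupp.degree_single,
          Finsupp.degree_single] at hN
        omega)
      (Finsupp.single (edgeAt w a) 1 + Finsupp.single (edgeAt w b) 1 + M₀)
      (by rw [← hM, deg_add _ M₀, hsw, ← deg_add]) (by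
        rw [Finsupp.filter_add, Finsupp.filter_add, Finsupp.filter_single_of_neg _ (hedge a),
          Finsupp.filter_single_of_neg _ (hedge b), zero_add, zero_add])
    have hF : IsF4 w a b f f' := ⟨hab, hpar, hcr, x, y, z, v, hnd, e1, e2, e3, e4⟩
    -- The exchanged monomial contains the walk edge `a`, whose position fixes the type; by
    -- definition the chords `f` and `f'` have that type too.
    have haε : Even (((a : ℕ) : ℤ) + ε) := by
      rcases hε (edgeAt w a) (by simp) with ⟨i, hi, he⟩ | ⟨a', b', f'', -, h⟩
      · rw [← ofWalk_edge (hpos := hpos)] at he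
        have := hc.even_of_edge_eq he
        rw [Int.even_iff] at *
        omega
      · exact absurd (ofWalk_edge a) (h.2.2.1.1.1.not_edge (hpos := hpos) ((a : ℕ) : ℤ))
    refine ⟨ε, fun e he => ?_⟩
    by_cases hef : e = f
    · exact Or.inr ⟨a, b, f', haε, by rw [hef]; exact hF⟩
    by_cases hef' : e = f'
    · exact Or.inr ⟨a, b, f, haε, by rw [hef']; exact hF.symm⟩
    refine hε e ?_
    rw [Finsupp.add_apply, Finsupp.add_apply, Finsupp.single_eq_of_ne hef,
      Finsupp.single_eq_of_ne hef'] at he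
    rw [Finsupp.add_apply]
    omega

end Sufficiency

/-! ### The type is unambiguous, and the components are distinct -/

section Sufficiency

open CyclicWalk

variable {V : Type*} {G : SimpleGraph V} {u : V} {w : G.Walk u u} {hpos : 0 < w.length}

/-- The chords of an `F₄` join the ends of its two edges of the walk in the order of the walk. -/
lemma IsF4.eq_or_eq [Finite V] (hc : (ofWalk w hpos).IsPrim) {a b : Fin w.length} {f f' : Sym2 V}
    (h : IsF4 w a b f f') :
    (f = s((ofWalk w hpos).vert (a : ℕ), (ofWalk w hpos).vert (b : ℕ)) ∧
      f' = s((ofWalk w hpos).vert ((a : ℕ) + 1), (ofWalk w hpos).vert ((b : ℕ) + 1))) ∨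
    (f = s((ofWalk w hpos).vert ((a : ℕ) + 1), (ofWalk w hpos).vert ((b : ℕ) + 1)) ∧
      f' = s((ofWalk w hpos).vert (a : ℕ), (ofWalk w hpos).vert (b : ℕ))) := by
  obtain ⟨hab, hpar, hcr, x, y, z, t, -, e1, rfl, e3, rfl⟩ := h
  rw [← ofWalk_edge (hpos := hpos), edge_coe] at e1 e3
  have h1 := hcr.1
  have odd_false : ∀ p q : ℤ, Odd (q - p) →
      ¬ IsOddChord w s((ofWalk w hpos).vert p, (ofWalk w hpos).vert q) := fun p q ho h =>
    Int.not_even_iff_odd.2 ho (hc.even_of_isOddChord h)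
  have hpar' : Even (((b : ℕ) : ℤ) - (a : ℕ)) := by
    simp only [Nat.even_iff] at hpar
    rw [Int.even_iff]; omega
  have o1 : Odd (((b : ℕ) : ℤ) - ((a : ℕ) + 1)) := by
    rw [Int.even_iff] at hpar'; rw [Int.odd_iff]; omega
  have o2 : Odd (((b : ℕ) : ℤ) + 1 - (a : ℕ)) := by
    rw [Int.even_iff] at hpar'; rw [Int.odd_iff]; omega
  rcases Sym2.eq_iff.1 e1 with ⟨rfl, rfl⟩ | ⟨rfl, rfl⟩ <;>
    rcases Sym2.eq_iff.1 e3 with ⟨rfl, rfl⟩ | ⟨rfl, rfl⟩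
  · exact absurd h1 (odd_false _ _ o1)
  · exact Or.inr ⟨rfl, Sym2.eq_swap⟩
  · exact Or.inl ⟨rfl, Sym2.eq_swap⟩
  · exact absurd h1 (odd_false _ _ o2)

/-- The ends of an odd chord are visited once, so they determine their positions modulo the period.
-/
lemma dvd_of_sym2_eq [Finite V] (hc : (ofWalk w hpos).IsPrim) {p q r s : ℤ} {f : Sym2 V}
    (hf : IsOddChord w f) (h1 : f = s((ofWalk w hpos).vert p, (ofWalk w hpos).vert q))
    (h2 : f = s((ofWalk w hpos).vert r, (ofWalk w hpos).vert s)) :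
    ((w.length : ℤ) ∣ p - r ∧ (w.length : ℤ) ∣ q - s) ∨
      ((w.length : ℤ) ∣ p - s ∧ (w.length : ℤ) ∣ q - r) := by
  have hdvd (i j : ℤ) (hj : (ofWalk w hpos).vert j ∈ f)
      (h : (ofWalk w hpos).vert i = (ofWalk w hpos).vert j) : (w.length : ℤ) ∣ i - j :=
    dvd_of_vert_eq_of_forall_ne hc.pos (hc.vert_ne_of_not_isBridgeChord hf.1 hf.2.1 hj) h
  have hr : (ofWalk w hpos).vert r ∈ f := by rw [h2]; simp
  have hs : (ofWalk w hpos).vert s ∈ f := by rw [h2]; simp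
  rw [h1] at h2
  exact (Sym2.eq_iff.1 h2).imp (fun h => ⟨hdvd _ _ hr h.1, hdvd _ _ hs h.2⟩)
    fun h => ⟨hdvd _ _ hs h.1, hdvd _ _ hr h.2⟩

/-- If a chord is in two `F₄`, with even and with odd edges of the walk, the one is crossed by a
chord of the other. -/
lemma IsF4.exists_crossesF4 [Finite V] (hc : (ofWalk w hpos).IsPrim) (hlen : 4 < w.length)
    {a b a' b' : Fin w.length} {f f' f'' : Sym2 V} (h : IsF4 w a b f f')
    (h' : IsF4 w a' b' f f'')
    (hf : f = s((ofWalk w hpos).vert (a : ℕ), (ofWalk w hpos).vert (b : ℕ)))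
    (hf' : f' = s((ofWalk w hpos).vert ((a : ℕ) + 1), (ofWalk w hpos).vert ((b : ℕ) + 1)))
    (hg : f = s((ofWalk w hpos).vert ((a' : ℕ) + 1), (ofWalk w hpos).vert ((b' : ℕ) + 1)))
    (hg' : f'' = s((ofWalk w hpos).vert (a' : ℕ), (ofWalk w hpos).vert (b' : ℕ))) :
    CrossesF4 w f'' a b f f' := by
  have hf1 := h.2.2.1.1
  have hf1' := h.2.2.1.2.1
  have hf2 := h'.2.2.1.2.1
  have hab := h.1
  have hpar := h.2.1
  have hb := b.2
  rw [Fin.lt_def] at hab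
  simp only [Nat.even_iff] at hpar
  have hev := hc.even
  rw [Nat.even_iff] at hev
  -- Comparing the two descriptions of `f`, the edges of the second `F₄` are those just before the
  -- edges `a` and `b`.
  have hg2 : f'' = s((ofWalk w hpos).vert ((a : ℕ) - 1), (ofWalk w hpos).vert ((b : ℕ) - 1)) := by
    rcases dvd_of_sym2_eq hc hf1 hf hg with ⟨d1, d2⟩ | ⟨d1, d2⟩
    · rw [hg', (ofWalk w hpos).vert_congr (show (w.length : ℤ) ∣ (a : ℕ) - 1 - (a' : ℕ) by
          rwa [sub_sub, add_comm (1 : ℤ)]),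
        (ofWalk w hpos).vert_congr (show (w.length : ℤ) ∣ (b : ℕ) - 1 - (b' : ℕ) by
          rwa [sub_sub, add_comm (1 : ℤ)])]
    · rw [hg', (ofWalk w hpos).vert_congr (show (w.length : ℤ) ∣ (a : ℕ) - 1 - (b' : ℕ) by
          rwa [sub_sub, add_comm (1 : ℤ)]),
        (ofWalk w hpos).vert_congr (show (w.length : ℤ) ∣ (b : ℕ) - 1 - (a' : ℕ) by
          rwa [sub_sub, add_comm (1 : ℤ)]), Sym2.eq_swap]
  refine ⟨hf2, h, ?_, ?_, ?_⟩
  -- Equality with `f` or `f'` would force the period to divide 1, 2 or 4; hence the hypothesis on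
  -- the length.
  · rintro rfl
    rcases dvd_of_sym2_eq hc hf1 hf hg2 with ⟨d1, -⟩ | ⟨d1, d2⟩
    · have := Int.le_of_dvd (by norm_num) (show (w.length : ℤ) ∣ 1 by simpa using d1)
      omega
    · have := Int.le_of_dvd (by norm_num) (show (w.length : ℤ) ∣ 2 by
        have := dvd_add d1 d2; ring_nf at this; exact this)
      omega
  · rintro rfl
    rcases dvd_of_sym2_eq hc hf1' hf' hg2 with ⟨d1, -⟩ | ⟨d1, d2⟩
    · have := Int.le_of_dvd (by norm_num) (show (w.length : ℤ) ∣ 2 by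
        ring_nf at d1; exact d1)
      omega
    · have := Int.le_of_dvd (by norm_num) (show (w.length : ℤ) ∣ 4 by
        have := dvd_add d1 d2; ring_nf at this; exact this)
      omega
  · have hj : (ofWalk w hpos).vert ((b : ℕ) - 1) = w.getVert (b - 1) := by
      rw [← ofWalk_vert (hpos := hpos) (by omega)]
      congr 1
      omega
    rcases Nat.eq_zero_or_pos a with h0 | h0
    · refine ⟨w.length - 1, b - 1, Or.inr (by omega), by omega, ?_⟩
      rw [hg2, hj, ← (ofWalk w hpos).per, ← ofWalk_vert (hpos := hpos) (k := w.length - 1) (by omega),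
        show ((a : ℕ) : ℤ) - 1 + w.length = (w.length - 1 : ℕ) by omega]
    · refine ⟨a - 1, b - 1, Or.inl (by omega), by omega, ?_⟩
      rw [hg2, hj, ← ofWalk_vert (hpos := hpos) (k := a - 1) (by omega),
        show ((a : ℕ) : ℤ) - 1 = (a - 1 : ℕ) by omega]

/-- A chord joins either the initial or the final vertices of the two walk edges of its `F₄`. If
both `F₄` have it in the same role, the positions agree modulo the even period; if not, one is
crossed by a chord of the other. -/
lemma IsF4.even_sub [Finite V] (hc : (ofWalk w hpos).IsPrim) (hlen : 4 < w.length)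
    (hF4 : ¬ ∃ (g f f' : Sym2 V) (a b : Fin w.length), CrossesF4 w g a b f f')
    {a b a' b' : Fin w.length} {f f' f'' : Sym2 V} (h : IsF4 w a b f f')
    (h' : IsF4 w a' b' f f'') : Even (((a : ℕ) : ℤ) - (a' : ℕ)) := by
  have hf1 := h.2.2.1.1
  have p1 := h.2.1
  have p2 := h'.2.1
  have hev := hc.even_cast
  simp only [Nat.even_iff] at p1 p2
  rw [Int.even_iff] at hev ⊢
  have key (p q : ℤ) (hd : (w.length : ℤ) ∣ p - q) : (p - q) % 2 = 0 :=
    Int.emod_eq_zero_of_dvd ((Int.dvd_of_emod_eq_zero hev).trans hd)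
  rcases h.eq_or_eq hc with ⟨e1, e2⟩ | ⟨e1, e2⟩ <;> rcases h'.eq_or_eq hc with ⟨e3, e4⟩ | ⟨e3, e4⟩
  · rcases dvd_of_sym2_eq hc hf1 e1 e3 with ⟨d1, -⟩ | ⟨d1, -⟩
    · exact key _ _ d1
    · have := key _ _ d1; omega
  · exact absurd ⟨_, _, _, _, _, h.exists_crossesF4 hc hlen h' e1 e2 e3 e4⟩ hF4
  · exact absurd ⟨_, _, _, _, _, h'.exists_crossesF4 hc hlen h e3 e4 e1 e2⟩ hF4
  · rcases dvd_of_sym2_eq hc hf1 e1 e3 with ⟨d1, -⟩ | ⟨d1, -⟩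
    · have := key _ _ d1; omega
    · have := key _ _ d1; omega

/-- The type of an edge is well defined. -/
lemma HasType.even_sub [Finite V] (hc : (ofWalk w hpos).IsPrim) (hlen : 4 < w.length)
    (hF4 : ¬ ∃ (g f f' : Sym2 V) (a b : Fin w.length), CrossesF4 w g a b f f') {ε ε' : ℤ}
    {e : G.edgeSet} (h : HasType w hpos ε e) (h' : HasType w hpos ε' e) : Even (ε - ε') := by
  rcases h with ⟨i, hi, he⟩ | ⟨a, b, f', ha, h⟩ <;> rcases h' with ⟨j, hj, he'⟩ | ⟨a', b', f'', ha', h'⟩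
  · have := hc.even_of_edge_eq (he.trans he'.symm)
    rw [Int.even_iff] at *
    omega
  · exact absurd he (h'.2.2.1.1.1.not_edge i)
  · exact absurd he' (h.2.2.1.1.1.not_edge j)
  · have := h.even_sub hc hlen hF4 h'
    rw [Int.even_iff] at *
    omega

lemma exists_eq_single_of_degree_eq_one {a : G.edgeSet →₀ ℕ} (h : a.degree = 1) :
    ∃ e, a = Finsupp.single e 1 := by
  obtain ⟨e, he⟩ : ∃ e, a e ≠ 0 := by
    by_contra! hne
    rw [show a = 0 from Finsupp.ext hne, map_zero] at h
    omega
  obtain ⟨b, rfl⟩ := exists_add_of_le (single_one_le (Nat.pos_of_ne_zero he))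
  rw [map_add, Finsupp.degree_single] at h
  exact ⟨e, by rw [(Finsupp.degree_eq_zero_iff b).1 (by omega), add_zero]⟩

/-- Without the common variable at most one edge is left, and an edge is determined by its degree.
-/
lemma Linked.eq_of_degree_le_two {a b : G.edgeSet →₀ ℕ} (h : Linked a b) (ha : a.degree ≤ 2) :
    a = b := by
  obtain ⟨e, a', b', rfl, rfl, hab⟩ := h.exists_single
  congr 1
  have hdeg := degree_eq_of_deg_eq hab
  rw [map_add, Finsupp.degree_single] at ha
  rcases Nat.eq_zero_or_pos a'.degree with h0 | h0
  · rw [h0] at hdeg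
    rw [(Finsupp.degree_eq_zero_iff _).1 h0, (Finsupp.degree_eq_zero_iff _).1 hdeg.symm]
  · obtain ⟨d, rfl⟩ := exists_eq_single_of_degree_eq_one (show a'.degree = 1 by omega)
    obtain ⟨d', rfl⟩ := exists_eq_single_of_degree_eq_one (show b'.degree = 1 by omega)
    rw [deg_single, deg_single, one_smul, one_smul] at hab
    rw [Subtype.ext (edgeVec_injective hab)]

lemma Conn.eq_of_degree_le_two {a b : G.edgeSet →₀ ℕ} (h : Conn a b) (ha : a.degree ≤ 2) :
    a = b := by
  induction h with
  | refl => rfl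
  | tail _ h ih =>
    subst ih
    exact h.eq_of_degree_le_two ha

/-- The monomials of a strongly primitive walk are not connected, if all its chords are odd, no two
of them cross strongly effectively, and none of them crosses an `F₄`. -/
lemma IsStronglyPrimitive.not_conn [Finite V] (hpos : 0 < w.length) (hw : Even w.length)
    (hs : IsStronglyPrimitive w) (hodd : ∀ f : Sym2 V, IsChord w f → IsOddChord w f)
    (hcross : ¬ ∃ f f' : Sym2 V, CrossStronglyEffectively w f f')
    (hF4 : ¬ ∃ (g f f' : Sym2 V) (a b : Fin w.length), CrossesF4 w g a b f f') :
    ¬ Conn (posExp w) (negExp w) := by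
  intro hconn
  have hc : (ofWalk w hpos).IsStrong := hs.isStrong hw hodd
  have hpar (M : G.edgeSet →₀ ℕ) (hM : deg M = deg (posExp w)) :
      ∃ ε : ℤ, ∀ e, 0 < M e → HasType w hpos ε e :=
    hc.forall_hasType hodd hcross _ M (by rw [hM, posExp_eq_seg (hpos := hpos)]) le_rfl
  have h1 : 0 < negExp w ((ofWalk w hpos).edge 1) := by
    rw [negExp_eq_seg (hpos := hpos), ← seg_period _ hw 1 1]
    exact seg_pos _ 1 le_rfl (by omega) (by decide)
  have hposExp (e : G.edgeSet) (he : 0 < posExp w e) : HasType w hpos 0 e := by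
    rw [posExp_eq_seg (hpos := hpos)] at he
    obtain ⟨k, -, -, hk, rfl⟩ := exists_of_seg_pos _ he
    exact Or.inl ⟨k, hk, rfl⟩
  have htype1 : HasType w hpos 1 ((ofWalk w hpos).edge 1) := Or.inl ⟨1, by decide, rfl⟩
  -- Up to length four the type may be ambiguous, but the monomials have degree at most two, so
  -- connected means equal, and `E⁺(w)`, `E⁻(w)` have no common edge.
  rcases le_or_gt w.length 4 with hlen | hlen
  · have hdeg := two_mul_degree_posExp w hw hpos
    rw [← hconn.eq_of_degree_le_two (by omega), posExp_eq_seg (hpos := hpos)] at h1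
    obtain ⟨k, -, -, hk, he⟩ := exists_of_seg_pos _ h1
    have := hc.even_of_edge_eq he
    rw [Int.even_iff] at *
    omega
  · have key (M : G.edgeSet →₀ ℕ) (h : Conn (posExp w) M) :
        deg (posExp w) = deg M ∧ ∀ e, 0 < M e → HasType w hpos 0 e := by
      induction h with
      | refl => exact ⟨rfl, hposExp⟩
      | tail _ h ih =>
        obtain ⟨hd, d, hd1, hd2⟩ := h
        -- The shared variable `d` transfers the type 0 from one monomial to the next.
        obtain ⟨ε, hε⟩ := hpar _ (hd.symm.trans ih.1.symm)
        refine ⟨ih.1.trans hd, fun e he => ?_⟩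
        have hev := (hε d hd2).even_sub hc.toIsPrim hlen hF4 (ih.2 d hd1)
        rw [sub_zero] at hev
        refine (hε e he).imp ?_ ?_
        · rintro ⟨i, hi, rfl⟩
          exact ⟨i, by rw [Int.even_iff] at *; omega, rfl⟩
        · rintro ⟨a, b, f', ha, h⟩
          exact ⟨a, b, f', by rw [Int.even_iff] at *; omega, h⟩
    have := ((key _ hconn).2 _ h1).even_sub hc.toIsPrim hlen hF4 htype1
    rw [Int.even_iff] at this
    omega

end Sufficiency

end ToricGraph

theorem theorem4p13 {V : Type*} [Finite V] (G : SimpleGraph V) (hG : G.Connected)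
    (K : Type*) [Field K] {u : V} (w : G.Walk u u) (hpos : 0 < w.length) (hw : Even w.length) :
    ToricGraph.IsMinimalBinomial K G (ToricGraph.walkBinomial K w) ↔
      ToricGraph.IsStronglyPrimitive w ∧
      (∀ f : Sym2 V, ToricGraph.IsChord w f → ToricGraph.IsOddChord w f) ∧
      (¬ ∃ f f' : Sym2 V, ToricGraph.CrossStronglyEffectively w f f') ∧
      (¬ ∃ (g f f' : Sym2 V) (a b : Fin w.length), ToricGraph.CrossesF4 w g a b f f') := by
  rw [ToricGraph.walkBinomial, ToricGraph.isMinimalBinomial_iff (ToricGraph.deg_posExp_eq hpos hw)]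
  constructor
  · intro h
    have hp := ToricGraph.isPrimitive_of_not_conn hw hpos h
    have hc := hp.isPrim hpos hw
    have hn : (ToricGraph.CyclicWalk.ofWalk w hpos).NotConn := by
      rwa [ToricGraph.CyclicWalk.NotConn, ← ToricGraph.posExp_eq_seg, ← ToricGraph.negExp_eq_seg]
    exact ⟨hc.isStronglyPrimitive hn hp, fun f hf => hc.isOddChord hn hf,
      hc.not_crossStronglyEffectively hn, hc.not_crossesF4 hn⟩
  · rintro ⟨h1, h2, h3, h4⟩
    exact h1.not_conn hpos hw h2 h3 h4
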